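/- Let $\mathcal G=(\mathbb V,\mathcal E)$ be a simple undirected, connected, locally finite graph with positive symmetric conductances $(a_{x,y})_{(x,y)\in\mathcal E}$, and put $a_x=\sum_{z\sim x}a_{x,z}$. Let $P_x$ be the law of the Markov chain $X$ started at $x$ with transition probabilities $p_{x,y}=a_{x,y}/a_x$ for $x\sim y$ (and $0$ otherwise), and assume that $X$ is transient. For $K\subset\mathbb V$ let $\tau_K=\inf\{n\ge 0:X_n\in K\}$ and $\tau_K^+=\inf\{n\ge 1:X_n\in K\}$, and for finite $K$ let $e_K(x)=a_xP_x[\tau_K^+=\infty]$ for $x\in K$, $e_K(x)=0$ otherwise (the equilibrium measure). Let $W^+$ and $W$ be the sets of nearest-neighbour trajectories indexed by $\{0,1,2,\dots\}$ and by $\mathbb Z$, respectively, that visit each vertex finitely often, with the $\sigma$-algebras generated by the coordinates; let $W^*$ be the quotient of $W$ by time shifts, with projection $\pi^*$ and the quotient $\sigma$-algebra, and let $W_K$, $W_K^*=\pi^*(W_K)$ be the trajectories that visit $K$. For finite $K$ let $\nu_K$ be the measure on $W$ with $$\nu_K\big((w_{-n})_{n\ge0}\in A,\ w_0=x,\ (w_n)_{n\ge0}\in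 B\big)=P_x[A\mid\tau_K^+=\infty]\,e_K(x)\,P_x[B],$$ and let $\nu=\big(\sum_{n\ge1}\nu_{K_n}\mathbf 1_{W_{K_n}\setminus W_{K_{n-1}}}\big)\circ(\pi^*)^{-1}$, where $(K_n)_{n\ge 0}$ is any exhaustion of $\mathbb V$ (an increasing sequence of finite sets with union $\mathbb V$) with $K_0=\emptyset$. Let $\Omega$ be the set of at most countable sums $\omega=\sum_i\delta_{w_i^*}$ of Dirac masses on $W^*$ such that $\omega(W_K^*)<\infty$ for all finite $K$, with the $\sigma$-algebra generated by the maps $\omega\mapsto\omega(D)$, $D\subset W^*$ measurable, and let $\mathbb P$ be the law on $\Omega$ of a Poisson point process with intensity $\nu$. For finite $K$ and $w\in W_K$, let $\tau_K(w)$ and $\lambda_K(w)$ be the first and last times at which $w$ is in $K$, and put $Out_{K\to}(w)=(w_{\lambda_K(w)+n})_{n\ge0}$ and $Out_{\to K}(w)=(w_{\tau_K(w)+n})_{n\le0}$. For $\omega=\sum_i\delta_{w_i^*}$, with representatives $w_i$ of $w_i^*$, put $$\mathrm{Out}_{K\to}(\omega)=\sum_{i:\,w_i^*\in W_K^*}\delta_{Out_{K\to}(w_i)}+\sum_{i:\,w_i^*\notin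 W_K^*}\delta_{w_i^*},\qquad \mathcal T_{RI\to}=\bigcap_{K\text{ finite}}\sigma(\mathrm{Out}_{K\to}),$$ and define $\mathrm{Out}_{\to K}$ and $\mathcal T_{\to RI}=\bigcap_{K\text{ finite}}\sigma(\mathrm{Out}_{\to K})$ in the same way with $Out_{\to K}$ in place of $Out_{K\to}$. **Theorem.** 1. Every event in $\mathcal T_{RI\to}$ has probability $0$ or $1$ under $\mathbb P$. 2. Every event in $\mathcal T_{\to RI}$ has probability $0$ or $1$ under $\mathbb P$. 3. For every $x\in\mathbb V$, every $\epsilon>0$ and every exhaustion $(L_n)_{n\ge0}$ of $\mathbb V$, $$e_{L_n}\big(\{x'\in\mathbb V:P_{x'}[\tau_x<\infty]>\epsilon\}\big)\longrightarrow0\quad\text{as }n\to\infty.$$ -/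

import Mathlib

open MeasureTheory ProbabilityTheory Filter Topology
open scoped ENNReal

noncomputable section

namespace Interlacement

variable {V : Type*}

/-- A weighted graph: a simple undirected, connected, locally finite graph with positive symmetric
conductances on its edges (the values of `cond` off the edges are never used). -/
structure Network (V : Type*) where
  graph : SimpleGraph V
  connected : graph.Connected
  locallyFinite : ∀ x, (graph.neighborSet x).Finite
  cond : V → V → ℝ
  cond_symm : ∀ x y, graph.Adj x y → cond x y = cond y x
  cond_pos : ∀ x y, graph.Adj x y → 0 < cond x y

/-- An exhaustion: an increasing sequence of finite vertex sets whose union is everything. -/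
structure IsExhaustion (L : ℕ → Finset V) : Prop where
  mono : Monotone L
  cover : ∀ x, ∃ n, x ∈ L n

/-- Hitting time `inf {n ≥ 0 : w n ∈ K}` of a one-sided path, `⊤` if there is no such `n`. -/
def hitTime (K : Set V) (w : ℕ → V) : ℕ∞ := ⨅ (n : ℕ) (_ : w n ∈ K), (n : ℕ∞)

/-- Return time `inf {n ≥ 1 : w n ∈ K}` of a one-sided path, `⊤` if there is no such `n`. -/
def returnTime (K : Set V) (w : ℕ → V) : ℕ∞ := ⨅ (n : ℕ) (_ : 1 ≤ n ∧ w n ∈ K), (n : ℕ∞)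

theorem hitTime_eq_top_iff {K : Set V} {w : ℕ → V} :
    hitTime K w = ⊤ ↔ ∀ n, w n ∉ K := by
  simp [hitTime, iInf_eq_top]

theorem returnTime_eq_top_iff {K : Set V} {w : ℕ → V} :
    returnTime K w = ⊤ ↔ ∀ n, 1 ≤ n → w n ∉ K := by
  simp [returnTime, iInf_eq_top]

namespace Network

variable (N : Network V)

/-- `a_x = ∑_{z ∼ x} a_{x,z}`. -/
def total (x : V) : ℝ := ∑ z ∈ (N.locallyFinite x).toFinset, N.cond x z

/-- The transition probabilities `p_{x,y} = a_{x,y} / a_x` for `y ∼ x`, and `0` otherwise. -/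
def p (x y : V) : ℝ :=
  open Classical in if N.graph.Adj x y then N.cond x y / N.total x else 0

variable [MeasurableSpace V]

/-- The one-step law from `x`. The first case occurs only in the one-vertex graph; the chain is
then put to rest (and it is not transient). -/
def step (x : V) : Measure V :=
  open Classical in
  if N.total x = 0 then Measure.dirac x
  else ∑ y ∈ (N.locallyFinite x).toFinset, ENNReal.ofReal (N.p x y) • Measure.dirac y

instance (x : V) : IsProbabilityMeasure (N.step x) := by
  constructor
  unfold step
  split_ifs with h
  · simp
  · simp only [Measure.coe_finsetSum, Finset.sum_apply, Measure.smul_apply, measure_univ,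
      smul_eq_mul, mul_one]
    have hpos : ∀ z ∈ (N.locallyFinite x).toFinset, 0 < N.cond x z := by
      intro z hz
      exact N.cond_pos x z (by simpa using hz)
    have hp : ∀ z ∈ (N.locallyFinite x).toFinset, N.p x z = N.cond x z / N.total x := by
      intro z hz
      have : N.graph.Adj x z := by simpa using hz
      simp [p, this]
    have ht : 0 ≤ N.total x := Finset.sum_nonneg fun z hz => (hpos z hz).le
    rw [← ENNReal.ofReal_sum_of_nonneg, Finset.sum_congr rfl hp, ← Finset.sum_div]
    · rw [← total, div_self h, ENNReal.ofReal_one]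
    · intro z hz
      rw [hp z hz]
      exact div_nonneg (hpos z hz).le ht

variable [DiscreteMeasurableSpace V]

/-- The transition kernel of the chain. -/
def stepKernel : Kernel V V where
  toFun := N.step
  measurable' := Measurable.of_discrete

instance : IsMarkovKernel N.stepKernel := ⟨fun x => by
  change IsProbabilityMeasure (N.step x); infer_instance⟩

/-- The law `P_x` of the Markov chain started from `x`, on the space of all sequences. -/
def P (x : V) : Measure (ℕ → V) :=
  Kernel.traj (X := fun _ : ℕ => V)
    (fun n => N.stepKernel.comap (fun h : (i : Finset.Iic n) → V => h ⟨n, by simp⟩)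
      (measurable_pi_apply _)) 0 (fun _ => x)

instance (x : V) : IsProbabilityMeasure (N.P x) := by
  unfold P; infer_instance

/-- The chain is transient: from every vertex, it has a positive probability of never returning. -/
def IsTransient : Prop := ∀ x, 0 < N.P x {w | returnTime {x} w = ⊤}

/-- The mass `e_K(x) = a_x P_x[τ_K⁺ = ∞]` for `x ∈ K`, and `0` for `x ∉ K`. -/
def eqMass (K : Finset V) (x : V) : ℝ≥0∞ :=
  open Classical in
  if x ∈ K then ENNReal.ofReal (N.total x) * N.P x {w | returnTime (K : Set V) w = ⊤} else 0

/-- The equilibrium measure `e_K` on the vertex set. -/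
def eqMeasure (K : Finset V) : Measure V := ∑ x ∈ K, N.eqMass K x • Measure.dirac x

end Network

section Trajectories

variable (G : SimpleGraph V)

/-- `W⁺`: transient nearest-neighbour trajectories indexed by the nonnegative integers. -/
def HalfTraj : Type _ :=
  {w : ℕ → V // (∀ n, G.Adj (w n) (w (n + 1))) ∧ ∀ x, {n | w n = x}.Finite}

/-- `W`: transient nearest-neighbour trajectories indexed by the integers. -/
def Traj : Type _ :=
  {w : ℤ → V // (∀ n, G.Adj (w n) (w (n + 1))) ∧ ∀ x, {n | w n = x}.Finite}

instance [MeasurableSpace V] : MeasurableSpace (HalfTraj G) := Subtype.instMeasurableSpace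

instance [MeasurableSpace V] : MeasurableSpace (Traj G) := Subtype.instMeasurableSpace

variable {G}

/-- The trajectory `w` visits `K`. -/
def Traj.Hits (K : Finset V) (w : Traj G) : Prop := ∃ n, w.1 n ∈ K

/-- First visit time to `K` (meaningful for trajectories visiting `K`). -/
def Traj.tau (K : Finset V) (w : Traj G) : ℤ := sInf {n | w.1 n ∈ K}

/-- Last visit time to `K` (meaningful for trajectories visiting `K`). -/
def Traj.lam (K : Finset V) (w : Traj G) : ℤ := sSup {n | w.1 n ∈ K}

/-- The future piece `(w_{λ_K + n})_{n ≥ 0}`. -/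
def Traj.future (K : Finset V) (w : Traj G) : HalfTraj G :=
  ⟨fun n => w.1 (w.lam K + n), by
    refine ⟨fun n => ?_, fun x => ?_⟩
    · have := w.2.1 (w.lam K + n)
      simpa [add_assoc] using this
    · refine Set.Finite.of_finite_image ((w.2.2 x).subset ?_)
        (f := fun n : ℕ => w.lam K + (n : ℤ)) ?_
      · rintro _ ⟨n, hn, rfl⟩
        exact hn
      · intro m _ n _ h
        simpa using h⟩

/-- The past piece `(w_{τ_K + n})_{n ≤ 0}`, read backwards in time as `n ↦ w_{τ_K - n}`, `n ≥ 0`. -/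
def Traj.past (K : Finset V) (w : Traj G) : HalfTraj G :=
  ⟨fun n => w.1 (w.tau K - n), by
    refine ⟨fun n => ?_, fun x => ?_⟩
    · have := (w.2.1 (w.tau K - (n + 1))).symm
      simpa [sub_add] using this
    · refine Set.Finite.of_finite_image ((w.2.2 x).subset ?_)
        (f := fun n : ℕ => w.tau K - (n : ℤ)) ?_
      · rintro _ ⟨n, hn, rfl⟩
        exact hn
      · intro m _ n _ h
        simpa using h⟩

variable (G) in
/-- Equality up to a time shift. -/
instance shiftSetoid : Setoid (Traj G) where
  r w w' := ∃ k : ℤ, ∀ n, w.1 (n + k) = w'.1 n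
  iseqv :=
    { refl := fun w => ⟨0, by simp⟩
      symm := by
        rintro w w' ⟨k, h⟩
        exact ⟨-k, fun n => by rw [← h, neg_add_cancel_right]⟩
      trans := by
        rintro w w' w'' ⟨k, h⟩ ⟨l, h'⟩
        exact ⟨l + k, fun n => by rw [← h', ← h, add_assoc]⟩ }

variable (G) in
/-- `W*`: transient nearest-neighbour bi-infinite trajectories up to time shift. With `V` a
measurable space it carries the quotient σ-algebra. -/
abbrev TrajMod : Type _ := Quotient (shiftSetoid G)

theorem visits_shift {K : Finset V} {w w' : Traj G} {k : ℤ} (h : ∀ n, w.1 (n + k) = w'.1 n) :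
    {n | w.1 n ∈ K} = (fun n => n + k) '' {n | w'.1 n ∈ K} := by
  ext n
  simp only [Set.mem_ofPred_eq, Set.mem_image]
  constructor
  · intro hn
    exact ⟨n - k, by rw [← h]; simpa using hn, by simp⟩
  · rintro ⟨m, hm, rfl⟩
    rw [h]; exact hm

theorem visits_finite (K : Finset V) (w : Traj G) : {n | w.1 n ∈ K}.Finite := by
  have : {n | w.1 n ∈ K} = ⋃ x ∈ K, {n | w.1 n = x} := by ext; simp
  rw [this]
  exact K.finite_toSet.biUnion fun x _ => w.2.2 x

theorem Traj.Hits.congr {K : Finset V} {w w' : Traj G} (h : w ≈ w') : w.Hits K ↔ w'.Hits K := by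
  obtain ⟨k, hk⟩ := h
  constructor
  · rintro ⟨n, hn⟩
    exact ⟨n - k, by rw [← hk]; simpa using hn⟩
  · rintro ⟨n, hn⟩
    exact ⟨n + k, by rw [hk]; exact hn⟩

theorem Traj.future_congr {K : Finset V} {w w' : Traj G} (h : w ≈ w') (hw' : w'.Hits K) :
    w.future K = w'.future K := by
  obtain ⟨k, hk⟩ := h
  have e : w.lam K = w'.lam K + k := by
    unfold lam
    rw [visits_shift hk]
    exact ((OrderIso.addRight k).map_csSup' hw' (visits_finite K w').bddAbove).symm
  apply Subtype.ext
  funext n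
  change w.1 (w.lam K + n) = w'.1 (w'.lam K + n)
  rw [e, ← hk, add_right_comm]

theorem Traj.past_congr {K : Finset V} {w w' : Traj G} (h : w ≈ w') (hw' : w'.Hits K) :
    w.past K = w'.past K := by
  obtain ⟨k, hk⟩ := h
  have e : w.tau K = w'.tau K + k := by
    unfold tau
    rw [visits_shift hk]
    exact ((OrderIso.addRight k).map_csInf' hw' (visits_finite K w').bddBelow).symm
  apply Subtype.ext
  funext n
  change w.1 (w.tau K - n) = w'.1 (w'.tau K - n)
  rw [e, ← hk, add_sub_right_comm]

variable (G) in
/-- `W_K*`: the classes of trajectories visiting `K`. -/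
def hitSet (K : Finset V) : Set (TrajMod G) := Quotient.mk _ '' {w : Traj G | w.Hits K}

/-- What remains of one trajectory when only its future after the last visit to `K` is kept:
the future piece if it visits `K`, the whole trajectory modulo shift otherwise. -/
def keepFuture (K : Finset V) : TrajMod G → HalfTraj G ⊕ TrajMod G :=
  open Classical in
  Quotient.lift (fun w : Traj G => if w.Hits K then Sum.inl (w.future K) else Sum.inr ⟦w⟧) (by
    intro w w' h
    by_cases hw : w'.Hits K
    · rw [if_pos hw, if_pos ((Traj.Hits.congr h).2 hw), Traj.future_congr h hw]
    · rw [if_neg hw, if_neg fun h' => hw ((Traj.Hits.congr h).1 h'), Quotient.sound h])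

/-- What remains of one trajectory when only its past before the first visit to `K` is kept:
the past piece if it visits `K`, the whole trajectory modulo shift otherwise. -/
def keepPast (K : Finset V) : TrajMod G → HalfTraj G ⊕ TrajMod G :=
  open Classical in
  Quotient.lift (fun w : Traj G => if w.Hits K then Sum.inl (w.past K) else Sum.inr ⟦w⟧) (by
    intro w w' h
    by_cases hw : w'.Hits K
    · rw [if_pos hw, if_pos ((Traj.Hits.congr h).2 hw), Traj.past_congr h hw]
    · rw [if_neg hw, if_neg fun h' => hw ((Traj.Hits.congr h).1 h'), Quotient.sound h])

variable [MeasurableSpace V]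

variable (G) in
/-- `Ω`: the at most countable sums of Dirac masses on `W*` that give finite mass to `W_K*` for
every finite `K`. -/
def Config : Type _ :=
  {ω : Measure (TrajMod G) //
    (∃ (I : Set ℕ) (w : I → TrajMod G), ω = Measure.sum fun i => Measure.dirac (w i)) ∧
      ∀ K : Finset V, ω (hitSet G K) < ∞}

/-- The σ-algebra generated by the maps `ω ↦ ω D`, `D ⊆ W*` measurable. -/
instance : MeasurableSpace (Config G) :=
  ⨆ (D : Set (TrajMod G)) (_ : MeasurableSet D),
    MeasurableSpace.comap (fun ω : Config G => ω.1 D) inferInstance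

/-- `Out_{K→}(ω)`, a point measure on `W⁺ ⊔ W*`: the image of the point measure `ω` under
`keepFuture K`. -/
def outFuture (K : Finset V) (ω : Config G) : Measure (HalfTraj G ⊕ TrajMod G) :=
  ω.1.map (keepFuture K)

/-- `Out_{→K}(ω)`, a point measure on `W⁺ ⊔ W*`: the image of the point measure `ω` under
`keepPast K`. -/
def outPast (K : Finset V) (ω : Config G) : Measure (HalfTraj G ⊕ TrajMod G) :=
  ω.1.map (keepPast K)

variable (G) in
/-- The σ-algebra of non-local future events: the intersection over all finite `K` of
`σ(Out_{K→})`. Spaces of measures carry the σ-algebra generated by evaluations on measurable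
sets. -/
@[reducible] def futureTail : MeasurableSpace (Config G) :=
  ⨅ K : Finset V, MeasurableSpace.comap (outFuture K) Measure.instMeasurableSpace

variable (G) in
/-- The σ-algebra of non-local past events: the intersection over all finite `K` of
`σ(Out_{→K})`. -/
@[reducible] def pastTail : MeasurableSpace (Config G) :=
  ⨅ K : Finset V, MeasurableSpace.comap (outPast K) Measure.instMeasurableSpace

/-- `Pr` is the law of a Poisson point process with intensity `ν`: the numbers of points in
disjoint measurable sets are independent, and the number of points in a set `D` of finite
intensity has the Poisson distribution with parameter `ν D`. -/
structure IsPoissonProcess (ν : Measure (TrajMod G)) (Pr : Measure (Config G)) : Prop where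
  isProbabilityMeasure : IsProbabilityMeasure Pr
  poisson : ∀ D : Set (TrajMod G), MeasurableSet D → ν D < ∞ →
    Pr.map (fun ω => ω.1 D) =
      (poissonMeasure (ν D).toNNReal).map (fun k : ℕ => (k : ℝ≥0∞))
  indep : ∀ (m : ℕ) (D : Fin m → Set (TrajMod G)), (∀ i, MeasurableSet (D i)) →
    Pairwise (fun i j => Disjoint (D i) (D j)) → iIndepFun (fun i (ω : Config G) => ω.1 (D i)) Pr

end Trajectories

/-- The bi-infinite sequence with past `u` (read backwards) and future `v`; it is used for
`u 0 = v 0`. -/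
def glue (uv : (ℕ → V) × (ℕ → V)) (n : ℤ) : V :=
  if 0 ≤ n then uv.2 n.toNat else uv.1 (-n).toNat

namespace Network

variable [MeasurableSpace V] [DiscreteMeasurableSpace V] (N : Network V)

/-- The measure `ν_K` on `W`, under which the position at time `0` has law `e_K` (up to mass) and,
given that it is `x`, the past read backwards has law `P_x[· | τ_K⁺ = ∞]` and the future,
independently, has law `P_x`. -/
def nuK (K : Finset V) : Measure (Traj N.graph) :=
  Measure.comap Subtype.val
    (∑ x ∈ K, N.eqMass K x •
      (((N.P x)[|{w | returnTime (K : Set V) w = ⊤}]).prod (N.P x)).map glue)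

/-- The measure `ν` on `W*`, built from an exhaustion `K` with `K 0 = ∅` as the image under the
projection `W → W*` of `∑_{n ≥ 1} ν_{K_n} 1_{W_{K_n} \ W_{K_{n-1}}}`. -/
def nu (K : ℕ → Finset V) : Measure (TrajMod N.graph) :=
  (Measure.sum fun n : ℕ =>
    (N.nuK (K (n + 1))).restrict {w | w.Hits (K (n + 1)) ∧ ¬ w.Hits (K n)}).map (Quotient.mk _)

end Network

end Interlacement

end

/-! Write h_B(y) for the probability that the chain from y ever visits B. All three statements come
down to how little mass the equilibrium measure of a large set L places where h_B is not small, in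
particular to the limit of ∑ e_L(y) h_B(y)² being 0 (`IsTransient.tendsto_sum_eqMass_mul_sq`).

This decay combines reversibility with a last-exit decomposition: for a single vertex x, the sum of
e_L h_x over a set A is at most a_x times the P_x-probability that the last visit to L happens in A
(`IsTransient.sum_eqMass_mul_hitProb_le`). For A = {h_x > ε}, a maximal inequality for the
superharmonic function h_x bounds the probability of visiting A after time m by 1/ε times the
probability of being at x after time m, which is small for m large. A last exit from L before time m
is unlikely once L is large. Since h_x > ε on A, this already gives the third statement.

For the zero-one laws, the intensity ν is the stationary two-sided reversible chain with the origin
placed at the first entrance into K. Mass transport allows the origin to be moved to the last exit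
from K (`IsTransient.twoSided_inter_eq`). Either way, a trajectory cut at K splits at a vertex y
into a kept piece, which escapes K, and a discarded piece, which is an independent chain from y. So,
given the kept piece, the trajectory has visited B ⊆ K with conditional probability h_B(y), and the
law of y has density at most e_K. The second moment of this conditional probability under ν is thus
at most ∑ e_K h_B².

The passage to the point process uses Laplace functionals
(`PoissonCounts.sq_setIntegral_laplace_sub_le`). If f vanishes off the trajectories visiting B and φ
is the conditional expectation of 1 - exp(-f) given the cut trajectory, then the conditional
expectation of exp(-ω(f)) given the cut process is the Laplace functional of g, where 1 - exp(-g) =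
φ. Its variance is exp(-2C)(exp(∫ φ²) - 1) with C = ∫ φ, and ∫ φ² is bounded by the second moment
above. As K grows, a tail event becomes uncorrelated with every Laplace functional; these determine
the process, so the event is independent of itself (`PoissonCounts.zero_one`). -/

noncomputable section

/-! ### The law of the chain: cylinders and the Markov property at time one. -/

namespace Interlacement

variable {V : Type*}

/-- The path that starts at `x` and then follows `w`. -/
def cons (x : V) (w : ℕ → V) (n : ℕ) : V := Nat.casesOn n x w

@[simp] theorem cons_zero (x : V) (w : ℕ → V) : cons x w 0 = x := rfl

@[simp] theorem cons_succ (x : V) (w : ℕ → V) (n : ℕ) : cons x w (n + 1) = w n := rfl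

theorem measurable_cons [MeasurableSpace V] (x : V) : Measurable (cons x) :=
  measurable_pi_lambda _ fun n => by
    cases n with
    | zero => exact measurable_const
    | succ n => exact measurable_pi_apply n

theorem measurableSet_eval_mem {ι : Type*} [MeasurableSpace V] [DiscreteMeasurableSpace V] (i : ι)
    (A : Set V) : MeasurableSet {w : ι → V | w i ∈ A} :=
  (MeasurableSet.of_discrete (s := A)).preimage (measurable_pi_apply i)

theorem measurableSet_eval_eq {ι : Type*} [MeasurableSpace V] [DiscreteMeasurableSpace V] (i : ι)
    (x : V) : MeasurableSet {w : ι → V | w i = x} :=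
  measurableSet_eval_mem i {x}

/-- Finite measures on path space are determined by the masses of the cylinders. -/
theorem ext_of_cylinder [Countable V] [MeasurableSpace V] [DiscreteMeasurableSpace V]
    {μ ν : Measure (ℕ → V)} [IsFiniteMeasure μ] [IsFiniteMeasure ν]
    (h : ∀ (n : ℕ) (s : ℕ → V), μ {w | ∀ i ≤ n, w i = s i} = ν {w | ∀ i ≤ n, w i = s i}) :
    μ = ν := by
  have key : ∀ n : ℕ, μ.map (Preorder.frestrictLe (π := fun _ => V) n)
      = ν.map (Preorder.frestrictLe (π := fun _ => V) n) := by
    intro n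
    refine Measure.ext_of_singleton fun z => ?_
    rw [Measure.map_apply (by fun_prop) (measurableSet_singleton z),
      Measure.map_apply (by fun_prop) (measurableSet_singleton z)]
    have : (Preorder.frestrictLe (π := fun _ => V) n) ⁻¹' {z}
        = {w | ∀ i ≤ n, w i = (fun i => if hi : i ≤ n then z ⟨i, by simpa using hi⟩
            else z ⟨0, by simp⟩) i} := by
      ext w
      simp only [Set.mem_preimage, Set.mem_singleton_iff, Set.mem_ofPred_eq, funext_iff]
      constructor
      · intro hw i hi
        rw [dif_pos hi, ← hw]; rfl
      · rintro hw ⟨i, hi⟩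
        have hi' : i ≤ n := by simpa using hi
        have := hw i hi'
        rw [dif_pos hi'] at this
        exact this
    rw [this, h]
  have hfam : IsProjectiveLimit μ (fun I : Finset ℕ => ν.map I.restrict) :=
    (isProjectiveLimit_nat_iff (by
      intro I J hJI
      dsimp only
      rw [Measure.map_map (by fun_prop) (by fun_prop)]
      rfl) μ).2 fun n => key n
  exact hfam.unique fun I => rfl

namespace Network

variable (N : Network V) [MeasurableSpace V] [DiscreteMeasurableSpace V]

theorem P_cylinder_zero [DecidableEq V] (x : V) (s : ℕ → V) :
    N.P x {w | ∀ i ≤ 0, w i = s i} = if x = s 0 then 1 else 0 := by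
  have e : {w : ℕ → V | ∀ i ≤ 0, w i = s i} = Preorder.frestrictLe (π := fun _ => V) 0 ⁻¹'
      {z | z ⟨0, by simp⟩ = s 0} := by
    ext w; simp
  have hS : MeasurableSet {z : (i : Finset.Iic 0) → V | z ⟨0, by simp⟩ = s 0} :=
    measurableSet_eval_eq _ _
  rw [e, ← Measure.map_apply (by fun_prop) hS, P, Kernel.traj_map_frestrictLe_apply,
    Kernel.partialTraj_self, Kernel.id_apply, Measure.dirac_apply' _ hS]
  simp [Set.indicator_apply]

/-- The kernels fed to `Kernel.traj` may depend on the whole history, but here only on its last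
point. The cylinder fixes that point to be `s n`, so the one-step mass is constant on it and leaves
the integral. -/
theorem P_cylinder_succ (x : V) (n : ℕ) (s : ℕ → V) :
    N.P x {w | ∀ i ≤ n + 1, w i = s i}
      = N.P x {w | ∀ i ≤ n, w i = s i} * N.step (s n) {s (n + 1)} := by
  have e : ∀ n, {w : ℕ → V | ∀ i ≤ n, w i = s i} = Preorder.frestrictLe (π := fun _ => V) n ⁻¹'
      {z | ∀ i, z i = s i.1} := by
    intro n
    ext w
    simp
  have hS : ∀ n, MeasurableSet {z : (i : Finset.Iic n) → V | ∀ i, z i = s i.1} := by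
    intro n
    simp only [Set.ofPred_forall]
    exact MeasurableSet.iInter fun i => measurableSet_eval_eq _ _
  have hm : Measurable (IicProdIoc (X := fun _ : ℕ => V) n (n + 1)) := measurable_IicProdIoc
  rw [e, e, ← Measure.map_apply (by fun_prop) (hS _), ← Measure.map_apply (by fun_prop) (hS _),
    P, Kernel.traj_map_frestrictLe_apply, Kernel.traj_map_frestrictLe_apply,
    Kernel.partialTraj_succ_of_le (Nat.zero_le n), Kernel.map_apply' _ hm _ (hS _),
    Kernel.comp_apply' _ _ _ (hm (hS _))]
  have hpt : ∀ h : (i : Finset.Iic n) → V,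
      (Kernel.id ×ₖ (((fun n => N.stepKernel.comap (fun h : (i : Finset.Iic n) → V => h ⟨n, by simp⟩)
      (measurable_pi_apply _)) n).map (MeasurableEquiv.piSingleton (X := fun _ : ℕ => V) n))) h
        (IicProdIoc (X := fun _ : ℕ => V) n (n + 1) ⁻¹' {z | ∀ i, z i = s i.1})
      = Set.indicator {z : (i : Finset.Iic n) → V | ∀ i, z i = s i.1}
          (fun _ => N.step (s n) {s (n + 1)}) h := by
    intro h
    have : (IicProdIoc (X := fun _ : ℕ => V) n (n + 1) ⁻¹' {z | ∀ i, z i = s i.1})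
       = {z : (i : Finset.Iic n) → V | ∀ i, z i = s i.1} ×ˢ
          {z : (i : Finset.Ioc n (n + 1)) → V | z ⟨n + 1, by simp⟩ = s (n + 1)} := by
      ext ⟨a, b⟩
      simp only [Set.mem_preimage, Set.mem_ofPred_eq, Set.mem_prod, IicProdIoc]
      constructor
      · intro hh
        refine ⟨?_, ?_⟩
        · rintro ⟨i, hi⟩
          have hi' : i ≤ n := by simpa using hi
          have := hh ⟨i, by simp; omega⟩
          simpa [hi'] using this
        · have := hh ⟨n + 1, by simp⟩
          simpa using this
      · rintro ⟨h1, h2⟩ ⟨i, hi⟩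
        by_cases hi' : i ≤ n
        · simpa [hi'] using h1 ⟨i, by simpa using hi'⟩
        · have : i = n + 1 := by simp at hi; omega
          subst this
          simpa using h2
    have h2 : MeasurableSet {z : (i : Finset.Ioc n (n + 1)) → V | z ⟨n + 1, by simp⟩ = s (n + 1)} :=
      measurableSet_eval_eq _ _
    rw [this, Kernel.prod_apply, Measure.prod_prod, Kernel.id_apply, Measure.dirac_apply' _ (hS n),
      Kernel.map_apply' _ (by fun_prop) _ h2]
    by_cases hh : h ∈ {z : (i : Finset.Iic n) → V | ∀ i, z i = s i.1}
    · simp only [Set.indicator_of_mem hh, Pi.one_apply, one_mul]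
      have : h ⟨n, by simp⟩ = s n := hh _
      rw [Kernel.comap_apply, this]
      change N.step (s n) _ = _
      congr 1
    · rw [Set.indicator_of_notMem hh, Set.indicator_of_notMem hh, zero_mul]
  simp_rw [hpt]
  rw [lintegral_indicator_const (hS n), mul_comm]

variable [Countable V]

/-- Markov property at time one. Cylinders determine both measures, and both satisfy the same
recursion when a cylinder is prolonged by one step. -/
theorem P_eq_bind (x : V) : N.P x = (N.step x).bind fun y => (N.P y).map (cons x) := by
  classical
  have : IsProbabilityMeasure ((N.step x).bind fun y => (N.P y).map (cons x)) := by
    constructor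
    rw [Measure.bind_apply MeasurableSet.univ Measurable.of_discrete.aemeasurable]
    simp [Measure.map_apply (measurable_cons x)]
  have hS : ∀ n (s : ℕ → V), MeasurableSet {w : ℕ → V | ∀ i ≤ n, w i = s i} := by
    intro n s
    simp only [Set.ofPred_forall]
    exact MeasurableSet.iInter fun i => MeasurableSet.iInter fun _ =>
      measurableSet_eval_eq _ _
  refine ext_of_cylinder fun n s => ?_
  rw [Measure.bind_apply (hS n s) Measurable.of_discrete.aemeasurable]
  have h1 : ∀ y, (N.P y).map (cons x) {w | ∀ i ≤ n, w i = s i}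
      = N.P y {w | ∀ i ≤ n, cons x w i = s i} := fun y =>
    Measure.map_apply (measurable_cons x) (hS n s)
  simp_rw [h1]
  clear h1
  by_cases hx : x = s 0
  swap
  · have h2 : ∀ y, N.P y {w | ∀ i ≤ n, cons x w i = s i} = 0 := by
      intro y
      rw [show {w | ∀ i ≤ n, cons x w i = s i} = ∅ from ?_, measure_empty]
      ext w
      simp only [Set.mem_ofPred_eq, Set.mem_empty_iff_false, iff_false]
      exact fun h => hx (h 0 (Nat.zero_le n))
    simp only [h2, lintegral_zero]
    refine measure_mono_null (t := {w | ∀ i ≤ 0, w i = s i}) ?_ ?_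
    · intro w hw i hi
      exact hw i (hi.trans (Nat.zero_le n))
    · rw [N.P_cylinder_zero, if_neg hx]
  · induction n with
    | zero =>
      rw [N.P_cylinder_zero, if_pos hx]
      have h2 : ∀ y, N.P y {w | ∀ i ≤ 0, cons x w i = s i} = 1 := by
        intro y
        rw [show {w | ∀ i ≤ 0, cons x w i = s i} = Set.univ from ?_, measure_univ]
        ext w
        simp [hx]
      simp_rw [h2]
      simp
    | succ n ih =>
      rw [N.P_cylinder_succ, ih]
      have hset : ∀ n, {w | ∀ i ≤ n + 1, cons x w i = s i} = {w | ∀ i ≤ n, w i = s (i + 1)} := by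
        intro n
        ext w
        simp only [Set.mem_ofPred_eq]
        constructor
        · intro h i hi
          exact h (i + 1) (by omega)
        · intro h i hi
          cases i with
          | zero => exact hx
          | succ i => exact h i (by omega)
      -- The path after the first step is one coordinate shorter. For `n = 0` its cylinder only
      -- fixes the starting point `y`, so the new factor comes from integrating over `y` and not
      -- from `P_cylinder_succ`.
      cases n with
      | zero =>
        rw [hset]
        have h2 : ∀ y, N.P y {w | ∀ i ≤ 0, cons x w i = s i} = 1 := by
          intro y
          rw [show {w | ∀ i ≤ 0, cons x w i = s i} = Set.univ from ?_, measure_univ]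
          ext w
          simp [hx]
        simp only [h2, lintegral_one, measure_univ, one_mul]
        have h3 : ∀ y, N.P y {w | ∀ i ≤ 0, w i = s (i + 1)} = Set.indicator {s 1} 1 y := by
          intro y
          rw [N.P_cylinder_zero y (fun i => s (i + 1))]
          simp [Set.indicator_apply]
        simp_rw [h3]
        rw [lintegral_indicator_one (measurableSet_singleton _), hx]
      | succ n =>
        rw [hset, hset]
        simp_rw [N.P_cylinder_succ _ n (fun i => s (i + 1))]
        rw [lintegral_mul_const _ Measurable.of_discrete]

theorem lintegral_P (x : V) {f : (ℕ → V) → ℝ≥0∞} (hf : Measurable f) :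
    ∫⁻ w, f w ∂N.P x = ∫⁻ y, ∫⁻ w, f (cons x w) ∂N.P y ∂N.step x := by
  conv_lhs => rw [N.P_eq_bind x]
  rw [Measure.lintegral_bind Measurable.of_discrete.aemeasurable hf.aemeasurable]
  refine lintegral_congr fun y => ?_
  rw [lintegral_map hf (measurable_cons x)]

theorem P_apply (x : V) {S : Set (ℕ → V)} (hS : MeasurableSet S) :
    N.P x S = ∫⁻ y, N.P y (cons x ⁻¹' S) ∂N.step x := by
  rw [← lintegral_indicator_one hS, N.lintegral_P x (measurable_one.indicator hS)]
  refine lintegral_congr fun y => ?_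
  rw [← lintegral_indicator_one (measurable_cons x hS)]
  rfl

theorem P_zero_ae (x : V) : ∀ᵐ w ∂N.P x, w 0 = x := by
  have hS : MeasurableSet {w : ℕ → V | ¬ w 0 = x} :=
    (measurableSet_eval_eq 0 x).compl
  rw [ae_iff, N.P_apply x hS]
  simp

end Network

end Interlacement

/-! ### The stationary two-sided chain, last visits and hitting probabilities. -/

namespace Interlacement

variable {V : Type*}

theorem measurable_glue [MeasurableSpace V] : Measurable (glue (V := V)) := by
  refine measurable_pi_lambda _ fun n => ?_
  unfold glue
  split_ifs
  · exact (measurable_pi_apply _).comp measurable_snd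
  · exact (measurable_pi_apply _).comp measurable_fst

/-- The time shift of a two-sided sequence. -/
def shift (k : ℤ) (w : ℤ → V) (n : ℤ) : V := w (n + k)

theorem measurable_shift [MeasurableSpace V] (k : ℤ) : Measurable (shift (V := V) k) :=
  measurable_pi_lambda _ fun _ => measurable_pi_apply _

theorem shift_shift (k l : ℤ) (w : ℤ → V) : shift k (shift l w) = shift (k + l) w := by
  funext n
  simp [shift, add_assoc]

theorem shift_zero (w : ℤ → V) : shift 0 w = w := by
  funext n
  simp [shift]

/-- Moving the origin one step forward hands its old position to the past. The value `y` is free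
because `glue` reads time 0 from the future and never looks at entry 0 of the past. -/
theorem shift_one_glue {x y : V} {u v : ℕ → V} (h : u 0 = x) :
    shift 1 (glue (u, cons x v)) = glue (cons y u, v) := by
  funext n
  unfold shift glue
  obtain hn | rfl | hn : 0 ≤ n ∨ n = -1 ∨ n < -1 := by omega
  · rw [if_pos (by omega), if_pos hn]
    obtain ⟨k, rfl⟩ := Int.eq_ofNat_of_zero_le hn
    rfl
  · simp [cons, h]
  · rw [if_neg (by omega), if_neg (by omega)]
    obtain ⟨k, hk⟩ := Int.eq_ofNat_of_zero_le (show 0 ≤ -n - 1 by omega)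
    have h1 : (-(n + 1)).toNat = k := by omega
    have h2 : (-n).toNat = k + 1 := by omega
    simp only [h1, h2, cons_succ]

theorem glue_natCast {u v : ℕ → V} (n : ℕ) : glue (u, v) n = v n := by
  simp [glue]

theorem glue_zero {u v : ℕ → V} : glue (u, v) 0 = v 0 := glue_natCast 0

theorem glue_neg_natCast {u v : ℕ → V} (h : u 0 = v 0) (n : ℕ) : glue (u, v) (-n) = u n := by
  cases n with
  | zero => simpa [glue] using h.symm
  | succ n =>
    unfold glue
    rw [if_neg (by omega)]
    simp

/-- The part of a path after time `n`. -/
def after (n : ℕ) (w : ℕ → V) (k : ℕ) : V := w (n + k)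

theorem measurable_after [MeasurableSpace V] (n : ℕ) : Measurable (after (V := V) n) :=
  measurable_pi_lambda _ fun _ => measurable_pi_apply _

theorem measurableSet_returnTime [MeasurableSpace V] [DiscreteMeasurableSpace V] (K : Set V) :
    MeasurableSet {w : ℕ → V | returnTime K w = ⊤} := by
  simp only [returnTime_eq_top_iff, Set.ofPred_forall]
  exact MeasurableSet.iInter fun n => MeasurableSet.iInter fun _ =>
    (measurableSet_eval_mem n K).compl

/-- The events that the last visit to a set takes place at time `n` are disjoint. -/
theorem pairwise_disjoint_lastVisit (K A : Set V) :
    Pairwise (Function.onFun Disjoint fun n : ℕ =>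
      {w : ℕ → V | w n ∈ A ∩ K ∧ after n w ∈ {w | returnTime K w = ⊤}}) := by
  have key : ∀ m n : ℕ, m < n → Disjoint
      {w : ℕ → V | w m ∈ A ∩ K ∧ after m w ∈ {w | returnTime K w = ⊤}}
      {w : ℕ → V | w n ∈ A ∩ K ∧ after n w ∈ {w | returnTime K w = ⊤}} := by
    intro m n hmn
    refine Set.disjoint_left.2 fun w hm hn => ?_
    have := returnTime_eq_top_iff.1 hm.2 (n - m) (by omega)
    rw [after, Nat.add_sub_cancel' hmn.le] at this
    exact this hn.1.2
  intro m n hmn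
  rcases lt_or_gt_of_ne hmn with h | h
  · exact key m n h
  · exact (key n m h).symm

theorem measurableSet_exists_visit [MeasurableSpace V] [DiscreteMeasurableSpace V] (B : Set V) (m : ℕ) :
    MeasurableSet {w : ℕ → V | ∃ k ≥ m, w k ∈ B} := by
  have : {w : ℕ → V | ∃ k ≥ m, w k ∈ B} = ⋃ k, ⋃ (_ : k ≥ m), {w | w k ∈ B} := by
    ext; simp
  rw [this]
  exact MeasurableSet.iUnion fun k => MeasurableSet.iUnion fun _ => measurableSet_eval_mem k B

theorem measurableSet_visit [MeasurableSpace V] [DiscreteMeasurableSpace V] (B : Set V) :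
    MeasurableSet {w : ℕ → V | ∃ n, w n ∈ B} := by
  simpa using measurableSet_exists_visit B 0

namespace Network

variable (N : Network V)

/-- The total conductance `a_x` as an extended nonnegative real. -/
def mass (x : V) : ℝ≥0∞ := ENNReal.ofReal (N.total x)

/-- The conductance of the edge `x y`, extended by `0` off the edges. -/
def rate (x y : V) : ℝ≥0∞ :=
  open Classical in if N.graph.Adj x y then ENNReal.ofReal (N.cond x y) else 0

theorem rate_symm (x y : V) : N.rate x y = N.rate y x := by
  unfold rate
  by_cases h : N.graph.Adj x y
  · rw [if_pos h, if_pos h.symm, N.cond_symm x y h]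
  · rw [if_neg h, if_neg fun h' => h h'.symm]

theorem mass_ne_top (x : V) : N.mass x ≠ ∞ := ENNReal.ofReal_ne_top

theorem total_nonneg (x : V) : 0 ≤ N.total x :=
  Finset.sum_nonneg fun z hz => (N.cond_pos x z (by simpa using hz)).le

variable [MeasurableSpace V] [DiscreteMeasurableSpace V]

omit [DiscreteMeasurableSpace V] in
theorem step_of_total_ne_zero {x : V} (h : N.total x ≠ 0) :
    N.step x = ∑ y ∈ (N.locallyFinite x).toFinset,
      ENNReal.ofReal (N.p x y) • Measure.dirac y := by
  unfold step
  rw [if_neg h]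

/-- Multiplying by a_x replaces transition probabilities by conductances, which are symmetric; this
is the form in which reversibility enters. -/
theorem mass_mul_lintegral_step {x : V} (h : N.total x ≠ 0) (f : V → ℝ≥0∞) :
    N.mass x * ∫⁻ y, f y ∂N.step x = ∑' y, N.rate x y * f y := by
  rw [N.step_of_total_ne_zero h, lintegral_finsetSum_measure, Finset.mul_sum,
    tsum_eq_sum (s := (N.locallyFinite x).toFinset)]
  · refine Finset.sum_congr rfl fun y hy => ?_
    have hy' : N.graph.Adj x y := by simpa using hy
    rw [lintegral_smul_measure, lintegral_dirac' _ Measurable.of_discrete, smul_eq_mul,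
      ← mul_assoc, mass, ← ENNReal.ofReal_mul (N.total_nonneg x), rate, if_pos hy', p, if_pos hy',
      mul_div_cancel₀ _ h]
  · intro y hy
    have hy' : ¬ N.graph.Adj x y := by simpa using hy
    rw [rate, if_neg hy', zero_mul]

theorem ae_step_adj {x : V} (h : N.total x ≠ 0) : ∀ᵐ y ∂N.step x, N.graph.Adj x y := by
  have h0 : N.mass x * ∫⁻ y, {y | ¬ N.graph.Adj x y}.indicator 1 y ∂N.step x = 0 := by
    rw [N.mass_mul_lintegral_step h]
    refine ENNReal.tsum_eq_zero.2 fun y => ?_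
    by_cases hy : N.graph.Adj x y
    · simp [hy]
    · rw [rate, if_neg hy, zero_mul]
  rw [lintegral_indicator_one MeasurableSet.of_discrete, mul_eq_zero] at h0
  refine h0.resolve_left ?_
  simpa [mass] using lt_of_le_of_ne (N.total_nonneg x) (Ne.symm h)

variable [Countable V]

-- A vertex of total conductance 0 is absorbing by the convention in `step`, so the chain there is
-- back at time 1.
variable {N} in
theorem IsTransient.total_ne_zero (hN : N.IsTransient) (x : V) : N.total x ≠ 0 := by
  intro h
  have h1 := hN x
  have hS : MeasurableSet {w : ℕ → V | w 1 ≠ x} := (measurableSet_eval_eq 1 x).compl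
  refine h1.ne' (measure_mono_null (t := {w | w 1 ≠ x}) ?_ ?_)
  · intro w hw
    exact returnTime_eq_top_iff.1 hw 1 le_rfl
  · rw [N.P_apply x hS, step, if_pos h, lintegral_dirac' _ Measurable.of_discrete]
    exact ae_iff.1 (N.P_zero_ae x)

variable {N} in
theorem IsTransient.mass_ne_zero (hN : N.IsTransient) (x : V) : N.mass x ≠ 0 := by
  simpa [mass] using lt_of_le_of_ne (N.total_nonneg x) (hN.total_ne_zero x).symm

theorem mass_mul_lintegral_P {x : V} (h : N.total x ≠ 0) {f : (ℕ → V) → ℝ≥0∞}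
    (hf : Measurable f) :
    N.mass x * ∫⁻ w, f w ∂N.P x = ∑' y, N.rate x y * ∫⁻ w, f (cons x w) ∂N.P y := by
  rw [N.lintegral_P x hf, N.mass_mul_lintegral_step h]

/-- The stationary law of the two-sided chain, an infinite measure. -/
def twoSided : Measure (ℤ → V) :=
  Measure.sum fun x => N.mass x • ((N.P x).prod (N.P x)).map glue

omit [Countable V] in
theorem lintegral_twoSided {f : (ℤ → V) → ℝ≥0∞} (hf : Measurable f) :
    ∫⁻ w, f w ∂N.twoSided
      = ∑' x, N.mass x * ∫⁻ u, ∫⁻ v, f (glue (u, v)) ∂N.P x ∂N.P x := by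
  rw [twoSided, lintegral_sum_measure]
  refine tsum_congr fun x => ?_
  rw [lintegral_smul_measure, smul_eq_mul, lintegral_map hf measurable_glue,
    lintegral_prod (fun q => f (glue q)) (hf.comp measurable_glue).aemeasurable]

variable {N}

/-- Reversibility. Expanding the first step of the future from x, and on the other side the first
step of the past from y, gives the same double sum over edges up to exchanging x and y in the
conductance. -/
theorem IsTransient.map_shift_one (hN : N.IsTransient) :
    N.twoSided.map (shift 1) = N.twoSided := by
  refine Measure.ext_of_lintegral _ fun f hf => ?_
  rw [lintegral_map hf (measurable_shift 1), N.lintegral_twoSided (f := fun w => f (shift 1 w))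
      (hf.comp (measurable_shift 1)),
    N.lintegral_twoSided hf]
  have hL : ∀ x, N.mass x * ∫⁻ u, ∫⁻ v, f (shift 1 (glue (u, v))) ∂N.P x ∂N.P x
      = ∑' y, N.rate x y * ∫⁻ u, ∫⁻ v, f (glue (cons y u, v)) ∂N.P y ∂N.P x := by
    intro x
    have hg : Measurable fun q : (ℕ → V) × (ℕ → V) => f (shift 1 (glue q)) :=
      hf.comp ((measurable_shift 1).comp measurable_glue)
    rw [← lintegral_const_mul _ hg.lintegral_prod_right']
    have h1 : ∀ u, N.mass x * ∫⁻ v, f (shift 1 (glue (u, v))) ∂N.P x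
        = ∑' y, N.rate x y * ∫⁻ v, f (shift 1 (glue (u, cons x v))) ∂N.P y := fun u =>
      N.mass_mul_lintegral_P (hN.total_ne_zero x) (hg.comp measurable_prodMk_left)
    simp_rw [h1]
    have hg' : ∀ y, Measurable fun u =>
        ∫⁻ v, f (shift 1 (glue (u, cons x v))) ∂N.P y := fun y =>
      Measurable.lintegral_prod_right' (f := fun q : (ℕ → V) × (ℕ → V) =>
        f (shift 1 (glue (q.1, cons x q.2))))
        (hg.comp (measurable_fst.prodMk ((measurable_cons x).comp measurable_snd)))
    rw [lintegral_tsum fun y => ((hg' y).const_mul _).aemeasurable]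
    refine tsum_congr fun y => ?_
    rw [lintegral_const_mul _ (hg' y)]
    congr 1
    refine lintegral_congr_ae ?_
    filter_upwards [N.P_zero_ae x] with u hu
    simp_rw [shift_one_glue (y := y) hu]
  have hR : ∀ y, N.mass y * ∫⁻ u, ∫⁻ v, f (glue (u, v)) ∂N.P y ∂N.P y
      = ∑' x, N.rate y x * ∫⁻ u, ∫⁻ v, f (glue (cons y u, v)) ∂N.P y ∂N.P x := fun y =>
    N.mass_mul_lintegral_P (hN.total_ne_zero y)
      (hf.comp measurable_glue).lintegral_prod_right'
  simp_rw [hL, hR]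
  rw [ENNReal.tsum_comm]
  simp_rw [N.rate_symm]

theorem IsTransient.measurePreserving_shift (hN : N.IsTransient) (k : ℤ) :
    MeasurePreserving (shift k) N.twoSided N.twoSided := by
  have h1 : MeasurePreserving (shift 1) N.twoSided N.twoSided :=
    ⟨measurable_shift 1, hN.map_shift_one⟩
  have hnat : ∀ n : ℕ, MeasurePreserving (shift (n : ℤ)) N.twoSided N.twoSided := by
    intro n
    induction n with
    | zero =>
      have : shift (V := V) ((0 : ℕ) : ℤ) = id := by funext w; exact shift_zero w
      rw [this]
      exact MeasurePreserving.id _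
    | succ n ih =>
      have : shift (V := V) ((n + 1 : ℕ) : ℤ) = shift 1 ∘ shift (n : ℤ) := by
        funext w
        rw [Function.comp_apply, shift_shift, add_comm]
        push_cast; rfl
      rw [this]
      exact h1.comp ih
  obtain ⟨n, rfl | rfl⟩ := k.eq_nat_or_neg
  · exact hnat n
  · refine ⟨measurable_shift _, ?_⟩
    conv_lhs => rw [← (hnat n).map_eq]
    rw [Measure.map_map (measurable_shift _) (measurable_shift _)]
    have : shift (V := V) (-(n : ℤ)) ∘ shift (n : ℤ) = id := by
      funext w
      rw [Function.comp_apply, shift_shift, neg_add_cancel, shift_zero]; rfl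
    rw [this, Measure.map_id]

/-- Fixing the position at time 0 selects a single term of the sum defining `twoSided`, in which
past and future are independent. -/
theorem twoSided_apply_of_prod {A : Set (ℤ → V)} (hA : MeasurableSet A) {S T : Set (ℕ → V)}
    (y : V)
    (h : ∀ u v : ℕ → V, u 0 = v 0 → (glue (u, v) ∈ A ↔ v 0 = y ∧ u ∈ S ∧ v ∈ T)) :
    N.twoSided A = N.mass y * (N.P y S * N.P y T) := by
  have hz : ∀ z, ∀ᵐ q ∂(N.P z).prod (N.P z), q.1 0 = z ∧ q.2 0 = z := fun z =>
    (Measure.quasiMeasurePreserving_fst.ae (N.P_zero_ae z)).and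
      (Measure.quasiMeasurePreserving_snd.ae (N.P_zero_ae z))
  rw [twoSided, Measure.sum_apply _ hA, tsum_eq_single y]
  · rw [Measure.smul_apply, Measure.map_apply measurable_glue hA, smul_eq_mul, ← Measure.prod_prod]
    congr 1
    refine measure_congr ?_
    filter_upwards [hz y] with q hq
    refine propext ?_
    change glue (q.1, q.2) ∈ A ↔ q.1 ∈ S ∧ q.2 ∈ T
    rw [h _ _ (hq.1.trans hq.2.symm)]
    simp [hq.2]
  · intro z hzy
    rw [Measure.smul_apply, Measure.map_apply measurable_glue hA, smul_eq_mul]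
    refine mul_eq_zero_of_right _ (measure_eq_zero_iff_ae_notMem.2 ?_)
    filter_upwards [hz z] with q hq hmem
    have := (h q.1 q.2 (hq.1.trans hq.2.symm)).1 hmem
    exact hzy (hq.2.symm.trans this.1)

/-- Both sides are the stationary mass of one event, being at x and, n steps later, at y with a
future in `F`: the origin is put at the time of x on the left and at the time of y on the right. -/
theorem IsTransient.mass_mul_P_after (hN : N.IsTransient) (x y : V) (n : ℕ) {F : Set (ℕ → V)}
    (hF : MeasurableSet F) :
    N.mass x * N.P x {w | w n = y ∧ after n w ∈ F}
      = N.mass y * (N.P y {w | w n = x} * N.P y F) := by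
  have hr : Measurable fun (w : ℤ → V) (k : ℕ) => w k :=
    measurable_pi_lambda _ fun _ => measurable_pi_apply _
  have hA' : MeasurableSet {w : ℤ → V | w (-n) = x ∧ w 0 = y ∧ (fun k : ℕ => w k) ∈ F} :=
    (measurableSet_eval_eq _ x).inter ((measurableSet_eval_eq _ y).inter (hr hF))
  rw [← twoSided_apply_of_prod hA' y (S := {w | w n = x}) (T := F),
    ← (hN.measurePreserving_shift n).measure_preimage hA'.nullMeasurableSet,
    twoSided_apply_of_prod (measurable_shift _ hA') x (S := Set.univ)
      (T := {w | w n = y ∧ after n w ∈ F}), measure_univ, one_mul]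
  · intro u v huv
    simp only [Set.mem_preimage, Set.mem_ofPred_eq, shift, neg_add_cancel, glue_zero, zero_add,
      glue_natCast, Set.mem_univ, true_and]
    have : (fun k : ℕ => glue (u, v) (k + n)) = after n v := by
      funext k
      rw [after, ← glue_natCast (u := u) (v := v)]
      push_cast
      rw [add_comm]
    rw [this]
  · intro u v huv
    simp only [Set.mem_ofPred_eq, glue_neg_natCast huv, glue_zero, glue_natCast]
    tauto

/-- The Markov property at time n follows from the previous identity by comparing `F` with the sure
event. -/
theorem IsTransient.P_after (hN : N.IsTransient) (x y : V) (n : ℕ) {F : Set (ℕ → V)}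
    (hF : MeasurableSet F) :
    N.P x {w | w n = y ∧ after n w ∈ F} = N.P x {w | w n = y} * N.P y F := by
  have h1 := hN.mass_mul_P_after x y n hF
  have h2 := hN.mass_mul_P_after x y n MeasurableSet.univ
  simp only [Set.mem_univ, and_true, measure_univ, mul_one] at h2
  rw [← mul_assoc, ← h2, mul_assoc] at h1
  exact (ENNReal.mul_right_inj (hN.mass_ne_zero x) (N.mass_ne_top x)).1 h1

/-- The Green function is finite: times the positive escape probability from y, it is the
probability that there is a last visit to y. -/
theorem IsTransient.tsum_P_eval_ne_top (hN : N.IsTransient) (x y : V) :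
    ∑' n, N.P x {w | w n = y} ≠ ∞ := by
  have hF := measurableSet_returnTime ({y} : Set V)
  have h1 : (∑' n, N.P x {w | w n = y}) * N.P y {w | returnTime {y} w = ⊤} ≤ 1 := by
    rw [← ENNReal.tsum_mul_right]
    simp_rw [← hN.P_after x y _ hF]
    have hd := pairwise_disjoint_lastVisit ({y} : Set V) {y}
    simp only [Set.inter_self, Set.mem_singleton_iff] at hd
    rw [← measure_iUnion hd fun n => (measurableSet_eval_eq n y).inter (measurable_after n hF)]
    exact prob_le_one
  intro htop
  rw [htop, ENNReal.top_mul (hN y).ne'] at h1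
  exact absurd h1 (by simp)

theorem IsTransient.ae_finite_visits (hN : N.IsTransient) (x : V) :
    ∀ᵐ w ∂N.P x, ∀ y, {n | w n = y}.Finite := by
  rw [ae_all_iff]
  intro y
  exact ae_finite_setOfPred_mem (hN.tsum_P_eval_ne_top x y)

theorem IsTransient.ae_adj (hN : N.IsTransient) (x : V) :
    ∀ᵐ w ∂N.P x, ∀ n, N.graph.Adj (w n) (w (n + 1)) := by
  rw [ae_all_iff]
  intro n
  have hS : ∀ n, MeasurableSet {w : ℕ → V | ¬ N.graph.Adj (w n) (w (n + 1))} := fun n =>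
    (MeasurableSet.of_discrete (s := {a : V × V | ¬ N.graph.Adj a.1 a.2})).preimage
      (f := fun w : ℕ → V => (w n, w (n + 1))) ((measurable_pi_apply n).prodMk (measurable_pi_apply (n + 1)))
  induction n generalizing x with
  | zero =>
    rw [ae_iff, N.P_apply x (hS 0), lintegral_eq_zero_iff Measurable.of_discrete]
    filter_upwards [N.ae_step_adj (hN.total_ne_zero x)] with y hy
    change N.P y _ = 0
    rw [measure_eq_zero_iff_ae_notMem]
    filter_upwards [N.P_zero_ae y] with w hw hmem
    refine hmem ?_
    simpa [hw] using hy
  | succ n ih =>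
    rw [ae_iff, N.P_apply x (hS _), lintegral_eq_zero_iff Measurable.of_discrete]
    filter_upwards with y
    exact ae_iff.1 (ih y)

variable (N) in
/-- The probability that the chain started at `y` visits `B`. -/
def hitProb (B : Set V) (y : V) : ℝ≥0∞ := N.P y {w | ∃ n, w n ∈ B}

omit [Countable V] in
theorem hitProb_le_one (B : Set V) (y : V) : N.hitProb B y ≤ 1 := prob_le_one

variable (N) in
theorem lintegral_hitProb_step_le (B : Set V) (y : V) :
    ∫⁻ z, N.hitProb B z ∂N.step y ≤ N.hitProb B y := by
  rw [hitProb, N.P_apply y (measurableSet_visit B)]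
  refine lintegral_mono fun z => measure_mono ?_
  rintro w ⟨n, hn⟩
  exact ⟨n + 1, hn⟩

-- Maximal inequality for the superharmonic function `hitProb B`. With a finite horizon it follows
-- by induction: a start where the function exceeds ε is trivial, and otherwise one step is made and
-- superharmonicity applied.
variable (N) in
theorem mul_P_exists_le_hitProb (B : Set V) (ε : ℝ≥0∞) (y : V) :
    ε * N.P y {w | ∃ k, w k ∈ {z | ε < N.hitProb B z}} ≤ N.hitProb B y := by
  have hfin : ∀ (m : ℕ) (y : V),
      ε * N.P y {w | ∃ k ≤ m, w k ∈ {z | ε < N.hitProb B z}} ≤ N.hitProb B y := by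
    intro m
    induction m with
    | zero =>
      intro y
      by_cases hy : ε < N.hitProb B y
      · exact (mul_le_of_le_one_right' prob_le_one).trans hy.le
      · rw [measure_eq_zero_iff_ae_notMem.2, mul_zero]
        · exact zero_le
        · filter_upwards [N.P_zero_ae y] with w hw
          simp [hw, not_lt.1 hy]
    | succ m ih =>
      intro y
      by_cases hy : ε < N.hitProb B y
      · exact (mul_le_of_le_one_right' prob_le_one).trans hy.le
      · have hS : MeasurableSet {w : ℕ → V | ∃ k ≤ m + 1, w k ∈ {z | ε < N.hitProb B z}} := by
          have : {w : ℕ → V | ∃ k ≤ m + 1, w k ∈ {z | ε < N.hitProb B z}}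
              = ⋃ k, ⋃ (_ : k ≤ m + 1), {w | w k ∈ {z | ε < N.hitProb B z}} := by
            ext; simp
          rw [this]
          exact MeasurableSet.iUnion fun k => MeasurableSet.iUnion fun _ =>
            measurableSet_eval_mem k _
        rw [N.P_apply y hS, ← lintegral_const_mul _ Measurable.of_discrete]
        refine le_trans (lintegral_mono fun z => ?_) (N.lintegral_hitProb_step_le B y)
        refine le_trans (mul_le_mul_right (measure_mono ?_) _) (ih z)
        rintro w ⟨k, hk, hmem⟩
        cases k with
        | zero => exact absurd hmem hy
        | succ k => exact ⟨k, by omega, hmem⟩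
  have hU : {w : ℕ → V | ∃ k, w k ∈ {z | ε < N.hitProb B z}}
      = ⋃ m : ℕ, {w | ∃ k ≤ m, w k ∈ {z | ε < N.hitProb B z}} := by
    ext w
    simp only [Set.mem_ofPred_eq, Set.mem_iUnion]
    exact ⟨fun ⟨k, hk⟩ => ⟨k, k, le_rfl, hk⟩, fun ⟨_, k, _, hk⟩ => ⟨k, hk⟩⟩
  rw [hU, Monotone.measure_iUnion, ENNReal.mul_iSup]
  · exact iSup_le fun m => hfin m y
  · rintro m n hmn w ⟨k, hk, h⟩
    exact ⟨k, hk.trans hmn, h⟩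

-- The maximal inequality applied to the chain after time m. It controls visits to {h_B > ε} at late
-- times by late visits to B, which is what makes the bound small.
variable (N) in
theorem mul_P_exists_ge_le (B : Set V) (ε : ℝ≥0∞) (m : ℕ) (y : V) :
    ε * N.P y {w | ∃ k ≥ m, w k ∈ {z | ε < N.hitProb B z}} ≤ N.P y {w | ∃ k ≥ m, w k ∈ B} := by
  induction m generalizing y with
  | zero => simpa [hitProb] using N.mul_P_exists_le_hitProb B ε y
  | succ m ih =>
    have hpre : ∀ A : Set V, cons y ⁻¹' {w | ∃ k ≥ m + 1, w k ∈ A} = {w | ∃ k ≥ m, w k ∈ A} := by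
      intro A
      ext w
      simp only [Set.mem_preimage, Set.mem_ofPred_eq]
      constructor
      · rintro ⟨k, hk, h⟩
        obtain ⟨j, rfl⟩ : ∃ j, k = j + 1 := ⟨k - 1, by omega⟩
        exact ⟨j, by omega, h⟩
      · rintro ⟨k, hk, h⟩
        exact ⟨k + 1, by omega, h⟩
    rw [N.P_apply y (measurableSet_exists_visit _ _), N.P_apply y (measurableSet_exists_visit _ _),
      ← lintegral_const_mul _ Measurable.of_discrete]
    simp_rw [hpre]
    exact lintegral_mono fun z => ih z

end Network

end Interlacement

/-! ### Decay of hitting probabilities under equilibrium measures. -/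

namespace Interlacement

variable {V : Type*}

theorem returnTime_event_eq (K : Set V) :
    {w : ℕ → V | returnTime K w = ⊤} = {w | ∀ n, 1 ≤ n → w n ∉ K} := by
  ext w
  exact returnTime_eq_top_iff

namespace Network

variable {N : Network V} [MeasurableSpace V] [DiscreteMeasurableSpace V] [Countable V]

omit [Countable V] in
theorem hitProb_singleton_le_tsum (x y : V) :
    N.hitProb {x} y ≤ ∑' n, N.P y {w | w n = x} := by
  refine le_trans (measure_mono ?_) (measure_iUnion_le fun n => {w : ℕ → V | w n = x})
  rintro w ⟨n, hn⟩
  exact Set.mem_iUnion.2 ⟨n, hn⟩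

/-- The hitting probability of x from y is at most the expected number of visits. By reversibility,
a_y P_y[w_n = x] P_y[no return to L] is a_x times the probability that the chain from x makes its
last visit to L at time n and at y; these events are disjoint in n and y. -/
theorem IsTransient.sum_eqMass_mul_hitProb_le (hN : N.IsTransient) (L : Finset V) (A : Set V)
    (x : V) :
    ∑ y ∈ L, N.eqMass L y * (N.hitProb {x} y * A.indicator 1 y)
      ≤ N.mass x * N.P x {w | ∃ n, w n ∈ A ∩ L ∧
          after n w ∈ {w : ℕ → V | returnTime (L : Set V) w = ⊤}} := by
  classical
  set F := {w : ℕ → V | returnTime (L : Set V) w = ⊤} with hFdef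
  have hF : MeasurableSet F := measurableSet_returnTime _
  have hm : ∀ (n : ℕ) (B : Set V), MeasurableSet {w : ℕ → V | w n ∈ B ∧ after n w ∈ F} := fun n B =>
    (measurableSet_eval_mem n B).inter (measurable_after n hF)
  have h1 : ∀ y ∈ L, N.eqMass L y * (N.hitProb {x} y * A.indicator 1 y)
      ≤ ∑' n, N.mass x * N.P x {w | w n ∈ ({y} ∩ A : Set V) ∧ after n w ∈ F} := by
    intro y hy
    by_cases hA : y ∈ A
    · have e : ({y} ∩ A : Set V) = {y} := by simpa using hA
      simp only [Set.indicator_of_mem hA, Pi.one_apply, mul_one, e, Set.mem_singleton_iff,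
        hN.mass_mul_P_after x y _ hF]
      rw [ENNReal.tsum_mul_left, ENNReal.tsum_mul_right, eqMass, if_pos hy]
      calc N.mass y * N.P y F * N.hitProb {x} y = N.mass y * (N.hitProb {x} y * N.P y F) := by ring
        _ ≤ _ := by
          gcongr
          exact hitProb_singleton_le_tsum x y
    · simp [Set.indicator_of_notMem hA]
  have hd : Pairwise (Function.onFun Disjoint fun n : ℕ =>
      {w : ℕ → V | w n ∈ A ∩ L ∧ after n w ∈ F}) := pairwise_disjoint_lastVisit _ _
  have hU : {w : ℕ → V | ∃ n, w n ∈ A ∩ L ∧ after n w ∈ F}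
      = ⋃ n, {w | w n ∈ A ∩ L ∧ after n w ∈ F} := by
    ext; simp
  rw [hU, measure_iUnion hd fun n => hm n _, ← ENNReal.tsum_mul_left]
  refine (Finset.sum_le_sum h1).trans ?_
  rw [← Summable.tsum_finsetSum fun _ _ => ENNReal.summable]
  refine ENNReal.tsum_le_tsum fun n => ?_
  rw [← Finset.mul_sum, ← measure_biUnion_finset ?_ fun y _ => hm n _]
  · gcongr
    intro w hw
    simp only [Set.mem_iUnion] at hw
    obtain ⟨y, hy, hyA, hwF⟩ := hw
    have : w n = y := hyA.1
    exact ⟨⟨hyA.2, by rw [this]; exact hy⟩, hwF⟩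
  · intro y _ z _ hyz
    refine Set.disjoint_left.2 fun w h h' => hyz ?_
    exact (h.1.1 : w n = y).symm.trans (h'.1.1 : w n = z)

theorem IsTransient.sum_eqMass_mul_hitProb_le_mass (hN : N.IsTransient) (L : Finset V) (x : V) :
    ∑ y ∈ L, N.eqMass L y * N.hitProb {x} y ≤ N.mass x := by
  have h := hN.sum_eqMass_mul_hitProb_le L Set.univ x
  simp only [Set.indicator_univ, Pi.one_apply, mul_one] at h
  exact h.trans (mul_le_of_le_one_right' prob_le_one)

theorem IsTransient.tendsto_P_exists_ge (hN : N.IsTransient) (x : V) :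
    Tendsto (fun m => N.P x {w | ∃ k ≥ m, w k ∈ ({x} : Set V)}) atTop (𝓝 0) := by
  refine tendsto_of_tendsto_of_tendsto_of_le_of_le tendsto_const_nhds
    (ENNReal.tendsto_sum_nat_add _ (hN.tsum_P_eval_ne_top x x)) (fun _ => zero_le) fun m => ?_
  refine le_trans (measure_mono ?_) (measure_iUnion_le fun k => {w : ℕ → V | w (k + m) = x})
  rintro w ⟨k, hk, h⟩
  refine Set.mem_iUnion.2 ⟨k - m, ?_⟩
  rw [← Nat.sub_add_cancel hk] at h
  exact h

omit [Countable V] in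
theorem tendsto_P_eval_notMem {L : ℕ → Finset V} (hL : IsExhaustion L) (x : V) (m : ℕ) :
    Tendsto (fun n => N.P x {w | w m ∉ L n}) atTop (𝓝 0) := by
  have h : Tendsto (fun n => N.P x {w | w m ∉ L n}) atTop
      (𝓝 (N.P x (⋂ n, {w | w m ∉ L n}))) := by
    refine tendsto_measure_iInter_atTop (fun n => ?_) ?_ ⟨0, measure_ne_top _ _⟩
    · exact (measurableSet_eval_mem m (L n : Set V)).compl.nullMeasurableSet
    · intro a b hab w hw hmem
      exact hw (hL.mono hab hmem)
  have e : (⋂ n, {w : ℕ → V | w m ∉ L n}) = ∅ := by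
    ext w
    simpa using hL.cover (w m)
  rwa [e, measure_empty] at h

/-- The last visit to L_n in A = {h_x > ε} takes place either at a time ≥ m, which costs at most 1/ε
times the probability of being at x after time m, or earlier, and then w_m is outside L_n. First m
is chosen, then n tends to infinity. -/
theorem IsTransient.tendsto_sum_eqMass_indicator (hN : N.IsTransient) (x : V) {ε : ℝ≥0∞}
    (hε : ε ≠ 0) {L : ℕ → Finset V} (hL : IsExhaustion L) :
    Tendsto (fun n => ∑ y ∈ L n, N.eqMass (L n) y *
      (N.hitProb {x} y * {z | ε < N.hitProb {x} z}.indicator 1 y)) atTop (𝓝 0) := by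
  by_cases htop : ε = ∞
  · simp [htop]
  rw [ENNReal.tendsto_nhds_zero]
  intro δ hδ
  obtain ⟨A, hAdef⟩ : ∃ A : Set V, A = {z | ε < N.hitProb {x} z} := ⟨_, rfl⟩
  rw [← hAdef]
  have hbound : ∀ m n, ∑ y ∈ L n, N.eqMass (L n) y * (N.hitProb {x} y * A.indicator 1 y)
      ≤ N.mass x * (ε⁻¹ * N.P x {w | ∃ k ≥ m, w k ∈ ({x} : Set V)})
        + N.mass x * N.P x {w | w m ∉ L n} := by
    intro m n
    refine (hN.sum_eqMass_mul_hitProb_le (L n) A x).trans ?_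
    rw [← mul_add]
    gcongr
    have hA : N.P x {w | ∃ k ≥ m, w k ∈ A} ≤ ε⁻¹ * N.P x {w | ∃ k ≥ m, w k ∈ ({x} : Set V)} := by
      have := N.mul_P_exists_ge_le {x} ε m x
      rw [← hAdef] at this
      rw [← ENNReal.div_eq_inv_mul, ENNReal.le_div_iff_mul_le (Or.inl hε) (Or.inl htop), mul_comm]
      exact this
    have hU : N.P x ({w | ∃ k ≥ m, w k ∈ A} ∪ {w | w m ∉ L n})
        ≤ ε⁻¹ * N.P x {w | ∃ k ≥ m, w k ∈ ({x} : Set V)} + N.P x {w | w m ∉ L n} :=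
      (measure_union_le _ _).trans (add_le_add hA le_rfl)
    refine le_trans (measure_mono ?_) hU
    rintro w ⟨k, hk, hF⟩
    by_cases hkm : m ≤ k
    · exact Or.inl ⟨k, hkm, hk.1⟩
    · refine Or.inr ?_
      have := returnTime_eq_top_iff.1 hF (m - k) (by omega)
      rw [after, Nat.add_sub_cancel' (by omega)] at this
      exact this
  have h1 : Tendsto (fun m => N.mass x * (ε⁻¹ * N.P x {w | ∃ k ≥ m, w k ∈ ({x} : Set V)})) atTop
      (𝓝 0) := by
    have := ENNReal.Tendsto.const_mul (a := N.mass x) (ENNReal.Tendsto.const_mul (a := ε⁻¹)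
      (hN.tendsto_P_exists_ge x) (Or.inr (ENNReal.inv_ne_top.2 hε))) (Or.inr (N.mass_ne_top x))
    simpa using this
  have hδ2 : 0 < δ / 2 := ENNReal.half_pos hδ.ne'
  obtain ⟨m, hm⟩ := (ENNReal.tendsto_nhds_zero.1 h1 (δ / 2) hδ2).exists
  have h2 : Tendsto (fun n => N.mass x * N.P x {w | w m ∉ L n}) atTop (𝓝 0) := by
    have := ENNReal.Tendsto.const_mul (a := N.mass x) (N.tendsto_P_eval_notMem hL x m)
      (Or.inr (N.mass_ne_top x))
    simpa using this
  filter_upwards [ENNReal.tendsto_nhds_zero.1 h2 (δ / 2) hδ2] with n hn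
  exact (hbound m n).trans ((add_le_add hm hn).trans_eq (ENNReal.add_halves δ))

/-- On the set {h_x > ε} one has 1 ≤ h_x / ε, so its equilibrium mass is at most 1/ε times the
previous sum. -/
theorem IsTransient.tendsto_eqMeasure (hN : N.IsTransient) (x : V) {ε : ℝ≥0∞} (hε : ε ≠ 0)
    {L : ℕ → Finset V} (hL : IsExhaustion L) :
    Tendsto (fun n => N.eqMeasure (L n) {z | ε < N.hitProb {x} z}) atTop (𝓝 0) := by
  have h := ENNReal.Tendsto.const_mul (a := ε⁻¹) (hN.tendsto_sum_eqMass_indicator x hε hL)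
    (Or.inr (ENNReal.inv_ne_top.2 hε))
  rw [mul_zero] at h
  refine tendsto_of_tendsto_of_tendsto_of_le_of_le tendsto_const_nhds h (fun _ => zero_le)
    fun n => ?_
  simp only [eqMeasure, Measure.coe_finsetSum, Finset.sum_apply, Measure.smul_apply, smul_eq_mul,
    Finset.mul_sum]
  refine Finset.sum_le_sum fun y _ => ?_
  rw [Measure.dirac_apply' _ MeasurableSet.of_discrete]
  by_cases hy : ε < N.hitProb {x} y
  · have htop : ε ≠ ∞ := hy.ne_top
    have hmem : y ∈ {z | ε < N.hitProb {x} z} := hy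
    simp only [Set.indicator_of_mem hmem, Pi.one_apply, mul_one]
    rw [mul_left_comm]
    refine le_mul_of_one_le_right' ?_
    rw [← ENNReal.inv_mul_cancel hε htop]
    gcongr
  · have hmem : y ∉ {z | ε < N.hitProb {x} z} := hy
    simp [Set.indicator_of_notMem hmem]

theorem IsTransient.tendsto_sum_eqMass_mul_sq_singleton (hN : N.IsTransient) (x : V)
    {L : ℕ → Finset V} (hL : IsExhaustion L) :
    Tendsto (fun n => ∑ y ∈ L n, N.eqMass (L n) y * N.hitProb {x} y ^ 2) atTop (𝓝 0) := by
  rw [ENNReal.tendsto_nhds_zero]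
  intro δ hδ
  have hδ2 : 0 < δ / 2 := ENNReal.half_pos hδ.ne'
  -- The sum of e_L h_x is at most a_x, so the part with h_x ≤ ε contributes at most ε a_x = δ / 2
  -- to the sum of squares.
  set ε := δ / 2 / N.mass x
  have hε : ε ≠ 0 := (ENNReal.div_pos hδ2.ne' (N.mass_ne_top x)).ne'
  filter_upwards [ENNReal.tendsto_nhds_zero.1 (hN.tendsto_sum_eqMass_indicator x hε hL) (δ / 2) hδ2]
    with n hn
  have hpt : ∀ y, N.hitProb {x} y ^ 2 ≤ ε * N.hitProb {x} y
      + N.hitProb {x} y * {z | ε < N.hitProb {x} z}.indicator 1 y := by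
    intro y
    rw [sq]
    by_cases hy : ε < N.hitProb {x} y
    · have hmem : y ∈ {z | ε < N.hitProb {x} z} := hy
      simp only [Set.indicator_of_mem hmem, Pi.one_apply, mul_one]
      exact (mul_le_of_le_one_right' (N.hitProb_le_one {x} y)).trans le_add_self
    · exact (mul_le_mul_left (not_lt.1 hy) _).trans le_self_add
  calc ∑ y ∈ L n, N.eqMass (L n) y * N.hitProb {x} y ^ 2
      ≤ ∑ y ∈ L n, (ε * (N.eqMass (L n) y * N.hitProb {x} y) + N.eqMass (L n) y *
        (N.hitProb {x} y * {z | ε < N.hitProb {x} z}.indicator 1 y)) := by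
        refine Finset.sum_le_sum fun y _ => ?_
        rw [mul_left_comm, ← mul_add]
        gcongr
        exact hpt y
    _ ≤ δ / 2 + δ / 2 := by
        rw [Finset.sum_add_distrib, ← Finset.mul_sum]
        refine add_le_add ?_ hn
        calc ε * ∑ y ∈ L n, N.eqMass (L n) y * N.hitProb {x} y ≤ ε * N.mass x := by
              gcongr
              exact hN.sum_eqMass_mul_hitProb_le_mass (L n) x
          _ = δ / 2 := ENNReal.div_mul_cancel (hN.mass_ne_zero x) (N.mass_ne_top x)
    _ = δ := ENNReal.add_halves δ

theorem IsTransient.tendsto_sum_eqMass_mul_sq (hN : N.IsTransient) (B : Finset V)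
    {L : ℕ → Finset V} (hL : IsExhaustion L) :
    Tendsto (fun n => ∑ y ∈ L n, N.eqMass (L n) y * N.hitProb (B : Set V) y ^ 2) atTop (𝓝 0) := by
  classical
  induction B using Finset.induction_on with
  | empty => simp [hitProb]
  | insert x B hx ih =>
    have h := ENNReal.Tendsto.const_mul (a := 4)
      ((hN.tendsto_sum_eqMass_mul_sq_singleton x hL).add ih) (Or.inr (by simp))
    rw [add_zero, mul_zero] at h
    refine tendsto_of_tendsto_of_tendsto_of_le_of_le tendsto_const_nhds h (fun _ => zero_le)
      fun n => ?_
    dsimp only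
    rw [← Finset.sum_add_distrib, Finset.mul_sum]
    refine Finset.sum_le_sum fun y _ => ?_
    rw [← mul_add, mul_left_comm]
    gcongr
    have hsub : N.hitProb ((insert x B : Finset V) : Set V) y
        ≤ N.hitProb {x} y + N.hitProb (B : Set V) y := by
      refine le_trans (measure_mono ?_) (measure_union_le _ _)
      rintro w ⟨n, hn⟩
      rw [Finset.coe_insert] at hn
      rcases hn with hn | hn
      · exact Or.inl ⟨n, hn⟩
      · exact Or.inr ⟨n, hn⟩
    -- The constant 4 comes from replacing both terms by the larger one; any finite constant
    -- suffices for the limit.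
    have hsq : ∀ a b : ℝ≥0∞, (a + b) ^ 2 ≤ 4 * (a ^ 2 + b ^ 2) := by
      have : ∀ a b : ℝ≥0∞, a ≤ b → (a + b) ^ 2 ≤ 4 * (a ^ 2 + b ^ 2) := by
        intro a b hab
        calc (a + b) ^ 2 ≤ (b + b) ^ 2 := by gcongr
          _ = 4 * b ^ 2 := by ring
          _ ≤ 4 * (a ^ 2 + b ^ 2) := by gcongr; exact le_add_self
      intro a b
      rcases le_total a b with hab | hab
      · exact this a b hab
      · rw [add_comm a b, add_comm (a ^ 2)]
        exact this b a hab
    exact (by gcongr : _ ≤ (N.hitProb {x} y + N.hitProb (B : Set V) y) ^ 2).trans (hsq _ _)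

end Network

end Interlacement

/-! ### Laplace functionals of Poisson point processes. -/

namespace Interlacement

open scoped NNReal

/-- The Laplace functional `exp (-∫ f dμ)` of a measure. -/
def laplace {X : Type*} [MeasurableSpace X] (f : X → ℝ≥0) (μ : Measure X) : ℝ :=
  Real.exp (-(∫⁻ x, f x ∂μ).toReal)

/-- Bounded measurable functions that vanish off some set of the sequence `H`. -/
structure IsTest {X : Type*} [MeasurableSpace X] (H : ℕ → Set X) (f : X → ℝ≥0) : Prop where
  measurable : Measurable f
  bound : ∃ (n : ℕ) (c : ℝ≥0), ∀ x, f x ≤ (H n).indicator (fun _ => c) x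

section Test

variable {X : Type*} [MeasurableSpace X] {H : ℕ → Set X} {f g : X → ℝ≥0} {μ : Measure X}

theorem laplace_nonneg : 0 ≤ laplace f μ := (Real.exp_pos _).le

theorem laplace_le_one : laplace f μ ≤ 1 := by
  rw [laplace, Real.exp_le_one_iff, neg_nonpos]
  exact ENNReal.toReal_nonneg

theorem isTest_zero : IsTest H (fun _ => 0) :=
  ⟨measurable_const, 0, 0, fun x => by simp⟩

theorem isTest_indicator {D : Set X} (hD : MeasurableSet D) {n : ℕ} (hDn : D ⊆ H n) (c : ℝ≥0) :
    IsTest H (D.indicator fun _ => c) :=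
  ⟨measurable_const.indicator hD, n, c, fun x => by
    refine Set.indicator_le_indicator_of_subset hDn (fun _ => zero_le) x⟩

theorem IsTest.add (hf : IsTest H f) (hg : IsTest H g) (hH : Monotone H) :
    IsTest H (fun x => f x + g x) := by
  obtain ⟨n, c, hc⟩ := hf.bound
  obtain ⟨m, d, hd⟩ := hg.bound
  refine ⟨hf.measurable.add hg.measurable, max n m, c + d, fun x => ?_⟩
  refine (add_le_add (hc x) (hd x)).trans ?_
  have h1 := Set.indicator_le_indicator_of_subset (hH (le_max_left n m)) (f := fun _ : X => c)
    (fun _ => zero_le) x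
  have h2 := Set.indicator_le_indicator_of_subset (hH (le_max_right n m)) (f := fun _ : X => d)
    (fun _ => zero_le) x
  refine (add_le_add h1 h2).trans_eq ?_
  by_cases hx : x ∈ H (max n m) <;> simp [hx]

/-- Needed because `laplace` passes through `toReal`: an infinite integral would produce the value 1
where 0 is meant. -/
theorem IsTest.lintegral_ne_top (hf : IsTest H f) (hμ : ∀ n, μ (H n) ≠ ∞) :
    ∫⁻ x, f x ∂μ ≠ ∞ := by
  obtain ⟨n, c, hc⟩ := hf.bound
  have h1 : ∫⁻ x, f x ∂μ ≤ ∫⁻ x, (H n).indicator (fun _ => (c : ℝ≥0∞)) x ∂μ := by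
    refine lintegral_mono fun x => ?_
    have := ENNReal.coe_le_coe.2 (hc x)
    rwa [ENNReal.coe_indicator] at this
  refine ne_top_of_le_ne_top ?_ (h1.trans (lintegral_indicator_const_le _ _))
  exact ENNReal.mul_ne_top ENNReal.coe_ne_top (hμ n)

theorem laplace_add (hf : IsTest H f) (hg : IsTest H g) (hμ : ∀ n, μ (H n) ≠ ∞) :
    laplace (fun x => f x + g x) μ = laplace f μ * laplace g μ := by
  simp only [laplace, ENNReal.coe_add]
  rw [lintegral_add_left hf.measurable.coe_nnreal_ennreal,
    ENNReal.toReal_add (hf.lintegral_ne_top hμ) (hg.lintegral_ne_top hμ), neg_add, Real.exp_add]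

theorem laplace_indicator {D : Set X} (hD : MeasurableSet D) (c : ℝ≥0) :
    laplace (D.indicator fun _ => c) μ = Real.exp (-(c * (μ D).toReal)) := by
  simp only [laplace, ENNReal.coe_indicator]
  rw [lintegral_indicator_const hD, ENNReal.toReal_mul, ENNReal.coe_toReal]

theorem measurable_laplace (hf : Measurable f) : Measurable (laplace f) :=
  Real.measurable_exp.comp
    (Measure.measurable_lintegral (measurable_coe_nnreal_ennreal.comp hf)).ennreal_toReal.neg

end Test

section PoissonLaplace

theorem integral_exp_neg_poisson (r : ℝ≥0) (c : ℝ) :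
    ∫ k : ℕ, Real.exp (-(c * k)) ∂(poissonMeasure r) = Real.exp (-(r * (1 - Real.exp (-c)))) := by
  rw [integral_poissonMeasure]
  have h := (NormedSpace.expSeries_div_hasSum_exp ((r : ℝ) * Real.exp (-c))).mul_left
    (Real.exp (-r))
  rw [← Real.exp_eq_exp_ℝ, ← Real.exp_add] at h
  rw [show -((r : ℝ) * (1 - Real.exp (-c))) = -r + r * Real.exp (-c) by ring, ← h.tsum_eq]
  refine tsum_congr fun n => ?_
  rw [smul_eq_mul, mul_pow, ← Real.exp_nat_mul, show -(c * n) = n * -c by ring]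
  ring

/-- The properties of a Poisson point process of intensity `ν`, for random measures `η`. -/
structure PoissonCounts {X Ω : Type*} [MeasurableSpace X] [MeasurableSpace Ω] (ν : Measure X)
    (η : Ω → Measure X) (Pr : Measure Ω) : Prop where
  poisson : ∀ D, MeasurableSet D → ν D < ∞ →
    Pr.map (fun ω => η ω D) = (poissonMeasure (ν D).toNNReal).map (fun k : ℕ => (k : ℝ≥0∞))
  indep : ∀ (m : ℕ) (D : Fin m → Set X), (∀ i, MeasurableSet (D i)) →
    Pairwise (fun i j => Disjoint (D i) (D j)) → iIndepFun (fun i (ω : Ω) => η ω (D i)) Pr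

variable {X Ω : Type*} [MeasurableSpace X] [MeasurableSpace Ω] {ν : Measure X}
  {η : Ω → Measure X} {Pr : Measure Ω} {H : ℕ → Set X} {f : X → ℝ≥0}

theorem PoissonCounts.integral_exp_count (h : PoissonCounts ν η Pr) (hη : Measurable η) {D : Set X}
    (hD : MeasurableSet D) (hνD : ν D < ∞) (c : ℝ) :
    ∫ ω, Real.exp (-(c * (η ω D).toReal)) ∂Pr
      = Real.exp (-((ν D).toReal * (1 - Real.exp (-c)))) := by
  have hm : Measurable fun ω => η ω D := (Measure.measurable_coe hD).comp hη
  have hg : Measurable fun t : ℝ≥0∞ => Real.exp (-(c * t.toReal)) :=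
    Real.measurable_exp.comp ((ENNReal.measurable_toReal.const_mul c).neg)
  have h1 : ∫ ω, Real.exp (-(c * (η ω D).toReal)) ∂Pr
      = ∫ t, Real.exp (-(c * t.toReal)) ∂(Pr.map fun ω => η ω D) :=
    (integral_map hm.aemeasurable hg.aestronglyMeasurable).symm
  rw [h1, h.poisson D hD hνD, integral_map Measurable.of_discrete.aemeasurable
    hg.aestronglyMeasurable]
  simp only [ENNReal.toReal_natCast]
  rw [integral_exp_neg_poisson]
  rfl

/-- The function `1 - exp (-f)`. -/
def oneSubExp (c : ℝ≥0) : ℝ≥0∞ := ENNReal.ofReal (1 - Real.exp (-c))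

theorem measurable_oneSubExp : Measurable oneSubExp := by
  unfold oneSubExp
  fun_prop

theorem oneSubExp_zero : oneSubExp 0 = 0 := by simp [oneSubExp]

theorem oneSubExp_le_one (c : ℝ≥0) : oneSubExp c ≤ 1 := by
  rw [oneSubExp, ENNReal.ofReal_le_one]
  linarith [Real.exp_pos (-(c : ℝ))]

theorem toReal_oneSubExp (c : ℝ≥0) : (oneSubExp c).toReal = 1 - Real.exp (-c) := by
  rw [oneSubExp, ENNReal.toReal_ofReal]
  rw [sub_nonneg, Real.exp_le_one_iff]
  simp

theorem monotone_oneSubExp : Monotone oneSubExp := by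
  intro a b hab
  refine ENNReal.ofReal_le_ofReal ?_
  have : (a : ℝ) ≤ b := hab
  have := Real.exp_le_exp.2 (neg_le_neg this)
  linarith

theorem continuous_oneSubExp : Continuous oneSubExp := by
  unfold oneSubExp
  exact ENNReal.continuous_ofReal.comp (by fun_prop)

theorem oneSubExp_add (a b : ℝ≥0) :
    oneSubExp (a + b) = oneSubExp b + ENNReal.ofReal (Real.exp (-b)) * oneSubExp a := by
  have h : ∀ c : ℝ≥0, 0 ≤ 1 - Real.exp (-c) := fun c => by
    rw [sub_nonneg, Real.exp_le_one_iff]; simp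
  rw [oneSubExp, oneSubExp, oneSubExp, ← ENNReal.ofReal_mul (Real.exp_pos _).le,
    ← ENNReal.ofReal_add (h b) (mul_nonneg (Real.exp_pos _).le (h a))]
  congr 1
  rw [NNReal.coe_add, neg_add, Real.exp_add]
  ring

theorem IsTest.lintegral_oneSubExp_ne_top (hf : IsTest H f) (hν : ∀ n, ν (H n) ≠ ∞) :
    ∫⁻ x, oneSubExp (f x) ∂ν ≠ ∞ := by
  refine ne_top_of_le_ne_top (hf.lintegral_ne_top hν) (lintegral_mono fun x => ?_)
  rw [oneSubExp, ← ENNReal.ofReal_coe_nnreal]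
  refine ENNReal.ofReal_le_ofReal ?_
  linarith [Real.add_one_le_exp (-(f x : ℝ))]

/-- The functional is a product over the level sets of `f`, whose counts are independent and
Poisson. -/
theorem PoissonCounts.integral_laplace_simpleFunc (h : PoissonCounts ν η Pr) (hη : Measurable η)
    (hν : ∀ n, ν (H n) ≠ ∞) (hηH : ∀ ω n, η ω (H n) ≠ ∞) (f : SimpleFunc X ℝ≥0)
    (hf : IsTest H f) :
    ∫ ω, laplace f (η ω) ∂Pr = Real.exp (-(∫⁻ x, oneSubExp (f x) ∂ν).toReal) := by
  classical
  obtain ⟨n, c, hc⟩ := hf.bound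
  have hfin : ∀ (μ : Measure X), μ (H n) ≠ ∞ → ∀ y ≠ 0, μ (f ⁻¹' {y}) ≠ ∞ := by
    intro μ hμ y hy
    refine ne_top_of_le_ne_top hμ (measure_mono fun x hx => ?_)
    by_contra hxn
    have := hc x
    rw [Set.indicator_of_notMem hxn] at this
    exact hy ((show f x = y from hx).symm.trans (le_antisymm this zero_le))
  -- The level 0 is discarded: it contributes nothing, and it is the only level set that may have
  -- infinite mass.
  set s := f.range.erase 0 with hs
  have hsum : ∀ (μ : Measure X), μ (H n) ≠ ∞ → ∀ g : ℝ≥0 → ℝ≥0∞, g 0 = 0 →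
      (∀ y, g y ≠ ∞) → (∫⁻ x, g (f x) ∂μ).toReal
        = ∑ y : s, (g y).toReal * (μ (f ⁻¹' {(y : ℝ≥0)})).toReal := by
    intro μ hμ g hg0 hg
    have h1 : ∫⁻ x, g (f x) ∂μ = (f.map g).lintegral μ := by
      rw [← SimpleFunc.lintegral_eq_lintegral]
      rfl
    rw [h1, SimpleFunc.map_lintegral, ← Finset.sum_erase (a := 0) _ (by rw [hg0, zero_mul]),
      ENNReal.toReal_sum, ← Finset.sum_coe_sort]
    · simp only [ENNReal.toReal_mul]
      rfl
    · intro y hy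
      exact ENNReal.mul_ne_top (hg y) (hfin μ hμ y (Finset.ne_of_mem_erase hy))
  let e := s.equivFin
  have hne : ∀ y : s, (y : ℝ≥0) ≠ 0 := fun y => Finset.ne_of_mem_erase y.2
  have hind := h.indep s.card (fun i => f ⁻¹' {((e.symm i : s) : ℝ≥0)})
    (fun i => f.measurableSet_fiber _) (by
      intro i j hij
      refine Set.disjoint_left.2 fun x hx hx' => hij ?_
      have hx1 : f x = ((e.symm i : s) : ℝ≥0) := hx
      have hx2 : f x = ((e.symm j : s) : ℝ≥0) := hx'
      exact e.symm.injective (Subtype.ext (hx1.symm.trans hx2)))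
  have hm : ∀ y, Measurable fun ω => η ω (f ⁻¹' {y}) := fun y =>
    (Measure.measurable_coe (f.measurableSet_fiber y)).comp hη
  have hg : ∀ c : ℝ, Measurable fun t : ℝ≥0∞ => Real.exp (-(c * t.toReal)) := fun c =>
    Real.measurable_exp.comp ((ENNReal.measurable_toReal.const_mul c).neg)
  have hL : ∀ ω, laplace f (η ω) = ∏ i, Real.exp (-(((e.symm i : s) : ℝ≥0) *
      (η ω (f ⁻¹' {((e.symm i : s) : ℝ≥0)})).toReal)) := by
    intro ω
    rw [laplace, hsum (η ω) (hηH ω n) (fun y => (y : ℝ≥0∞)) (by simp) (by simp), ← Real.exp_sum,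
      Finset.sum_neg_distrib]
    congr 2
    rw [← e.symm.sum_comp]
    rfl
  simp_rw [hL]
  rw [hind.integral_fun_prod_comp (fun i => (hm _).aemeasurable)
    (f := fun i t => Real.exp (-(((e.symm i : s) : ℝ≥0) * t.toReal)))
    (fun i => (hg _).aestronglyMeasurable)]
  rw [hsum ν (hν n) oneSubExp oneSubExp_zero
    (fun y => ne_top_of_le_ne_top ENNReal.one_ne_top (oneSubExp_le_one y)),
    ← Finset.sum_neg_distrib, Real.exp_sum, ← e.symm.prod_comp]
  refine Finset.prod_congr rfl fun i _ => ?_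
  rw [h.integral_exp_count hη (f.measurableSet_fiber _)
    (hfin ν (hν n) _ (hne _)).lt_top, toReal_oneSubExp, mul_comm]

theorem PoissonCounts.integral_laplace [IsProbabilityMeasure Pr] (h : PoissonCounts ν η Pr)
    (hη : Measurable η) (hν : ∀ n, ν (H n) ≠ ∞) (hηH : ∀ ω n, η ω (H n) ≠ ∞) (hf : IsTest H f) :
    ∫ ω, laplace f (η ω) ∂Pr = Real.exp (-(∫⁻ x, oneSubExp (f x) ∂ν).toReal) := by
  have hfm : Measurable fun x => (f x : ℝ≥0∞) := measurable_coe_nnreal_ennreal.comp hf.measurable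
  let F : ℕ → SimpleFunc X ℝ≥0 := fun k =>
    (SimpleFunc.eapprox (fun x => (f x : ℝ≥0∞)) k).map ENNReal.toNNReal
  have hFcoe : ∀ k x, (F k x : ℝ≥0∞) = SimpleFunc.eapprox (fun x => (f x : ℝ≥0∞)) k x := fun k x =>
    ENNReal.coe_toNNReal (SimpleFunc.eapprox_lt_top _ k x).ne
  have hFle : ∀ k x, F k x ≤ f x := by
    intro k x
    rw [← ENNReal.coe_le_coe, hFcoe, ← SimpleFunc.iSup_eapprox_apply hfm x]
    exact le_iSup (fun n => SimpleFunc.eapprox (fun x => (f x : ℝ≥0∞)) n x) k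
  have hFmono : ∀ x, Monotone fun k => F k x := by
    intro x i j hij
    change F i x ≤ F j x
    rw [← ENNReal.coe_le_coe, hFcoe, hFcoe]
    exact SimpleFunc.monotone_eapprox _ hij x
  have hFtend : ∀ x, Tendsto (fun k => F k x) atTop (𝓝 (f x)) := by
    intro x
    rw [← ENNReal.tendsto_coe]
    simp_rw [hFcoe]
    exact SimpleFunc.tendsto_eapprox hfm x
  obtain ⟨n, c, hc⟩ := hf.bound
  have hFtest : ∀ k, IsTest H (F k) := fun k =>
    ⟨(F k).measurable, n, c, fun x => (hFle k x).trans (hc x)⟩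
  have hleft : Tendsto (fun k => ∫ ω, laplace (F k) (η ω) ∂Pr) atTop
      (𝓝 (∫ ω, laplace f (η ω) ∂Pr)) := by
    refine tendsto_integral_of_dominated_convergence (fun _ => 1)
      (fun k => ((measurable_laplace (F k).measurable).comp hη).aestronglyMeasurable)
      (integrable_const 1) (fun k => ?_) ?_
    · filter_upwards with ω
      rw [Real.norm_eq_abs, abs_of_nonneg laplace_nonneg]
      exact laplace_le_one
    · filter_upwards with ω
      have := lintegral_tendsto_of_tendsto_of_monotone (μ := η ω)
        (f := fun k x => (F k x : ℝ≥0∞)) (F := fun x => (f x : ℝ≥0∞))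
        (fun k => (measurable_coe_nnreal_ennreal.comp (F k).measurable).aemeasurable)
        (ae_of_all _ fun x i j hij => ENNReal.coe_le_coe.2 (hFmono x hij))
        (ae_of_all _ fun x => ENNReal.tendsto_coe.2 (hFtend x))
      exact (Real.continuous_exp.tendsto _).comp
        (((ENNReal.tendsto_toReal (hf.lintegral_ne_top (hηH ω))).comp this).neg)
  have hright : Tendsto (fun k => Real.exp (-(∫⁻ x, oneSubExp (F k x) ∂ν).toReal)) atTop
      (𝓝 (Real.exp (-(∫⁻ x, oneSubExp (f x) ∂ν).toReal))) := by
    have := lintegral_tendsto_of_tendsto_of_monotone (μ := ν)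
      (f := fun k x => oneSubExp (F k x)) (F := fun x => oneSubExp (f x))
      (fun k => (measurable_oneSubExp.comp (F k).measurable).aemeasurable)
      (ae_of_all _ fun x i j hij => monotone_oneSubExp (hFmono x hij))
      (ae_of_all _ fun x => (continuous_oneSubExp.tendsto _).comp (hFtend x))
    exact (Real.continuous_exp.tendsto _).comp
      (((ENNReal.tendsto_toReal (hf.lintegral_oneSubExp_ne_top hν)).comp this).neg)
  refine tendsto_nhds_unique hleft (hright.congr fun k => ?_)
  exact (h.integral_laplace_simpleFunc hη hν hηH (F k) (hFtest k)).symm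

end PoissonLaplace

end Interlacement

/-! ### Laplace functionals determine a counting process. -/

namespace Interlacement

open scoped NNReal

/-- When the earlier coefficients vanish, dividing by s^k leaves |a_k| ≤ s ∑ |a_j|, and s tends to
0. -/
theorem eq_zero_of_power_series {a : ℕ → ℝ} (ha : Summable fun k => |a k|)
    (h : ∀ s : ℝ, 0 < s → s < 1 → HasSum (fun k => a k * s ^ k) 0) (k : ℕ) : a k = 0 := by
  induction k using Nat.strong_induction_on with
  | _ k ih =>
  set C := ∑' j, |a j|
  have hC : 0 ≤ C := tsum_nonneg fun j => abs_nonneg _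
  have hbound : ∀ s : ℝ, 0 < s → s < 1 → |a k| ≤ s * C := by
    intro s hs hs1
    have h1 : HasSum (fun j => a (j + (k + 1)) * s ^ (j + (k + 1))) (-(a k * s ^ k)) := by
      have := (hasSum_nat_add_iff' (k + 1)).2 (h s hs hs1)
      have hz : ∑ i ∈ Finset.range (k + 1), a i * s ^ i = a k * s ^ k := by
        rw [Finset.sum_range_succ, Finset.sum_eq_zero, zero_add]
        intro i hi
        rw [ih i (Finset.mem_range.1 hi), zero_mul]
      rwa [hz, zero_sub] at this
    have hle : ∀ j, |a (j + (k + 1)) * s ^ (j + (k + 1))| ≤ s ^ (k + 1) * |a (j + (k + 1))| := by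
      intro j
      have hp : s ^ (j + (k + 1)) ≤ s ^ (k + 1) :=
        pow_le_pow_of_le_one hs.le hs1.le (Nat.le_add_left _ _)
      have hp0 : 0 ≤ s ^ (j + (k + 1)) := by positivity
      rw [abs_mul, abs_of_nonneg hp0, mul_comm]
      exact mul_le_mul_of_nonneg_right hp (abs_nonneg _)
    have hsum : Summable fun j => |a (j + (k + 1))| :=
      (summable_nat_add_iff (f := fun j => |a j|) (k + 1)).2 ha
    have h2 : |a k * s ^ k| ≤ s ^ (k + 1) * ∑' j, |a (j + (k + 1))| := by
      rw [← abs_neg, ← h1.tsum_eq]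
      exact tsum_of_norm_bounded (f := fun j => a (j + (k + 1)) * s ^ (j + (k + 1)))
        (hsum.hasSum.mul_left (s ^ (k + 1))) hle
    have h3 : ∑' j, |a (j + (k + 1))| ≤ C := by
      have := ha.sum_add_tsum_nat_add (k + 1)
      have h4 : 0 ≤ ∑ i ∈ Finset.range (k + 1), |a i| := Finset.sum_nonneg fun _ _ => abs_nonneg _
      linarith
    have hsk : 0 < s ^ k := pow_pos hs k
    rw [abs_mul, abs_of_pos hsk, pow_succ, mul_assoc, mul_comm] at h2
    exact (le_of_mul_le_mul_left h2 hsk).trans (mul_le_mul_of_nonneg_left h3 hs.le)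
  have hlim : Tendsto (fun s : ℝ => s * C) (𝓝[>] 0) (𝓝 0) := by
    have : Tendsto (fun s : ℝ => s * C) (𝓝 0) (𝓝 (0 * C)) := tendsto_id.mul_const C
    rw [zero_mul] at this
    exact this.mono_left nhdsWithin_le_nhds
  have hle : |a k| ≤ 0 := by
    refine ge_of_tendsto hlim ?_
    filter_upwards [Ioo_mem_nhdsGT (zero_lt_one' ℝ)] with s hs
    exact hbound s hs.1 hs.2
  exact abs_nonpos_iff.1 hle

section Uniqueness

variable {X Ω : Type*} [MeasurableSpace X] [MeasurableSpace Ω]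
  {η : Ω → Measure X} {Pr : Measure Ω} {H : ℕ → Set X} {ψ : Ω → ℝ}

/-- The integrals of `ψ` against all Laplace functionals of `η` vanish. -/
def LaplaceNull (H : ℕ → Set X) (η : Ω → Measure X) (Pr : Measure Ω) (ψ : Ω → ℝ) : Prop :=
  Integrable ψ Pr ∧ ∀ g, IsTest H g → ∫ ω, ψ ω * laplace g (η ω) ∂Pr = 0

/-- Every set inside some `H n` has an integer mass. -/
def IsCounting (H : ℕ → Set X) (η : Ω → Measure X) : Prop :=
  ∀ ω n D, MeasurableSet D → D ⊆ H n → ∃ k : ℕ, η ω D = k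

theorem integrable_mul_laplace (hη : Measurable η) (hψ : Integrable ψ Pr) {g : X → ℝ≥0}
    (hg : Measurable g) : Integrable (fun ω => ψ ω * laplace g (η ω)) Pr := by
  refine hψ.mul_bdd (c := 1) ((measurable_laplace hg).comp hη).aestronglyMeasurable ?_
  filter_upwards with ω
  rw [Real.norm_eq_abs, abs_of_nonneg laplace_nonneg]
  exact laplace_le_one

theorem measurableSet_count (hη : Measurable η) {D : Set X} (hD : MeasurableSet D) (k : ℕ) :
    MeasurableSet {ω | η ω D = k} :=
  (measurableSet_singleton (k : ℝ≥0∞)).preimage ((Measure.measurable_coe hD).comp hη)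

/-- Adding a multiple of the indicator of `D` to the test function inserts the factor s ^ η(D).
Split according to the value of η(D), the vanishing integrals form a power series in s that is
identically 0, so each coefficient is 0. The conclusion has the form of the hypothesis, so that it
can be iterated over several sets. -/
theorem LaplaceNull.indicator_count (hψ : LaplaceNull H η Pr ψ) (hη : Measurable η)
    (hH : Monotone H) (hHm : ∀ n, MeasurableSet (H n)) (hηH : IsCounting H η) {D : Set X} {n : ℕ}
    (hD : MeasurableSet D) (hDn : D ⊆ H n) (k : ℕ) :
    LaplaceNull H η Pr ({ω | η ω D = k}.indicator ψ) := by
  have hmS := fun k : ℕ => measurableSet_count hη hD k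
  refine ⟨hψ.1.indicator (hmS k), fun g hg => ?_⟩
  have hfin : ∀ ω n, η ω (H n) ≠ ∞ := fun ω n => by
    obtain ⟨k, hk⟩ := hηH ω n (H n) (hHm n) le_rfl
    rw [hk]; exact ENNReal.natCast_ne_top k
  have hint := integrable_mul_laplace hη hψ.1 hg.measurable
  have hd : Pairwise (Function.onFun Disjoint fun k : ℕ => {ω | η ω D = k}) := by
    intro i j hij
    refine Set.disjoint_left.2 fun ω hi hj => hij ?_
    have : (i : ℝ≥0∞) = j := (show η ω D = i from hi).symm.trans hj
    exact_mod_cast this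
  have hU : (⋃ k : ℕ, {ω | η ω D = k}) = Set.univ := by
    refine Set.eq_univ_of_forall fun ω => ?_
    obtain ⟨k, hk⟩ := hηH ω n D hD hDn
    exact Set.mem_iUnion.2 ⟨k, hk⟩
  set a : ℕ → ℝ := fun k => ∫ ω in {ω | η ω D = k}, ψ ω * laplace g (η ω) ∂Pr with ha
  have hsum : Summable fun k => |a k| := by
    have h1 := hasSum_integral_iUnion (μ := Pr) (f := fun ω => ‖ψ ω * laplace g (η ω)‖) hmS hd
      hint.norm.integrableOn
    refine Summable.of_nonneg_of_le (fun _ => abs_nonneg _) (fun k => ?_) h1.summable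
    exact norm_integral_le_integral_norm (fun ω => ψ ω * laplace g (η ω))
  have hps : ∀ s : ℝ, 0 < s → s < 1 → HasSum (fun k => a k * s ^ k) 0 := by
    intro s hs hs1
    have hlog : 0 ≤ -Real.log s := by linarith [Real.log_neg hs hs1]
    -- With this weight, exp(-c η(D)) = s ^ η(D).
    set c : ℝ≥0 := ⟨-Real.log s, hlog⟩ with hc
    have htest : IsTest H (D.indicator fun _ => c) := isTest_indicator hD hDn c
    have h0 := hψ.2 _ (hg.add htest hH)
    have h1 := hasSum_integral_iUnion hmS hd
      (integrable_mul_laplace hη hψ.1 (hg.add htest hH).measurable).integrableOn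
    rw [hU, setIntegral_univ, h0] at h1
    refine (congrArg (fun b => HasSum b 0) (funext fun k => ?_)).mpr h1
    rw [ha, ← integral_mul_const]
    refine setIntegral_congr_fun (hmS k) fun ω hω => ?_
    have hωk : η ω D = k := hω
    have hexp : laplace (D.indicator fun _ => c) (η ω) = s ^ k := by
      rw [laplace_indicator hD, hωk, ENNReal.toReal_natCast, hc]
      change Real.exp (-(-Real.log s * k)) = s ^ k
      rw [neg_mul, neg_neg, mul_comm, Real.exp_nat_mul, Real.exp_log hs]
    rw [laplace_add hg htest (hfin ω), hexp, mul_assoc]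
  have h0 := eq_zero_of_power_series hsum hps k
  rw [← h0, ha]
  dsimp only
  rw [← integral_indicator (hmS k)]
  refine integral_congr_ae (ae_of_all _ fun ω => ?_)
  by_cases hω : ω ∈ {ω | η ω D = k} <;> simp [hω]

-- Sets inside some `H n` have integer counts, so countably many events describe each count; a
-- general set is exhausted by its traces on the `H n`.
omit [MeasurableSpace Ω] in
theorem comap_le_generateFrom_count (hH : Monotone H)
    (hHm : ∀ n, MeasurableSet (H n)) (hcover : ⋃ n, H n = Set.univ) (hηH : IsCounting H η)
    {C : Set (Set Ω)}
    (hC : ∀ D n, MeasurableSet D → D ⊆ H n → ∀ k : ℕ, {ω | η ω D = k} ∈ C) :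
    MeasurableSpace.comap η Measure.instMeasurableSpace ≤ MeasurableSpace.generateFrom C := by
  have h1 : ∀ D n, MeasurableSet D → D ⊆ H n →
      Measurable[MeasurableSpace.generateFrom C] fun ω => η ω D := by
    intro D n hD hDn B _
    have : (fun ω => η ω D) ⁻¹' B = ⋃ (k : ℕ) (_ : (k : ℝ≥0∞) ∈ B), {ω | η ω D = k} := by
      ext ω
      obtain ⟨k, hk⟩ := hηH ω n D hD hDn
      simp only [Set.mem_preimage, Set.mem_iUnion, Set.mem_ofPred_eq, exists_prop]
      constructor
      · intro h
        exact ⟨k, hk ▸ h, hk⟩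
      · rintro ⟨j, hj, h⟩
        rwa [h]
    rw [this]
    exact MeasurableSet.iUnion fun k => MeasurableSet.iUnion fun _ =>
      MeasurableSpace.measurableSet_generateFrom (hC D n hD hDn k)
  rw [← measurable_iff_comap_le]
  refine @Measure.measurable_of_measurable_coe _ _ _ (MeasurableSpace.generateFrom C) η
    fun D hD => ?_
  have h2 : (fun ω => η ω D) = fun ω => ⨆ n, η ω (D ∩ H n) := by
    funext ω
    rw [← Monotone.measure_iUnion, ← Set.inter_iUnion, hcover, Set.inter_univ]
    intro i j hij
    exact Set.inter_subset_inter_right _ (hH hij)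
  rw [h2]
  exact Measurable.iSup fun n => h1 _ n (hD.inter (hHm n)) Set.inter_subset_right

/-- A function orthogonal to the Laplace functionals of a counting process integrates to `0` on
all events of the process. -/
theorem LaplaceNull.setIntegral_eq_zero (hψ : LaplaceNull H η Pr ψ) (hη : Measurable η)
    (hH : Monotone H) (hHm : ∀ n, MeasurableSet (H n)) (hcover : ⋃ n, H n = Set.univ)
    (hηH : IsCounting H η) {E : Set Ω}
    (hE : MeasurableSet[MeasurableSpace.comap η Measure.instMeasurableSpace] E) :
    ∫ ω in E, ψ ω ∂Pr = 0 := by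
  let ev : List (Set X × ℕ) → Set Ω := fun l => {ω | ∀ p ∈ l, η ω p.1 = p.2}
  let good : List (Set X × ℕ) → Prop := fun l => ∀ p ∈ l, MeasurableSet p.1 ∧ ∃ n, p.1 ⊆ H n
  have hev : ∀ l, good l → MeasurableSet (ev l) ∧ LaplaceNull H η Pr ((ev l).indicator ψ) := by
    intro l
    induction l with
    | nil =>
      intro _
      have : ev [] = Set.univ := by ext; simp [ev]
      rw [this, Set.indicator_univ]
      exact ⟨MeasurableSet.univ, hψ⟩
    | cons p l ih =>
      intro hl
      have hl' := ih fun q hq => hl q (List.mem_cons_of_mem _ hq)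
      obtain ⟨hD, n, hDn⟩ := hl p List.mem_cons_self
      have : ev (p :: l) = {ω | η ω p.1 = p.2} ∩ ev l := by
        ext ω
        exact List.forall_mem_cons
      rw [this, ← Set.indicator_indicator]
      exact ⟨(measurableSet_count hη hD _).inter hl'.1,
        hl'.2.indicator_count hη hH hHm hηH hD hDn _⟩
  -- Prescribing finitely many counts, through lists so that intersection is concatenation, gives a
  -- π-system; iterating `indicator_count` along a list handles its members, and the rest is a
  -- Dynkin argument.
  set C : Set (Set Ω) := {A | ∃ l, good l ∧ A = ev l} with hCdef
  have hpi : IsPiSystem C := by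
    rintro _ ⟨l, hl, rfl⟩ _ ⟨l', hl', rfl⟩ _
    refine ⟨l ++ l', ?_, ?_⟩
    · intro p hp
      rcases List.mem_append.1 hp with h | h
      · exact hl p h
      · exact hl' p h
    · ext ω
      simp only [ev, Set.mem_inter_iff, Set.mem_ofPred_eq, List.mem_append]
      constructor
      · rintro ⟨h1, h2⟩ p (h | h)
        · exact h1 p h
        · exact h2 p h
      · intro h
        exact ⟨fun p hp => h p (Or.inl hp), fun p hp => h p (Or.inr hp)⟩
  have hle := comap_le_generateFrom_count hH hHm hcover hηH (C := C) (by
    intro D n hD hDn k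
    refine ⟨[(D, k)], ?_, ?_⟩
    · intro p hp
      rw [List.mem_singleton.1 hp]
      exact ⟨hD, n, hDn⟩
    · ext; simp [ev])
  have hCm : MeasurableSpace.generateFrom C ≤ (inferInstance : MeasurableSpace Ω) := by
    refine MeasurableSpace.generateFrom_le ?_
    rintro _ ⟨l, hl, rfl⟩
    exact (hev l hl).1
  have h0 : ∫ ω, ψ ω ∂Pr = 0 := by
    have := hψ.2 _ isTest_zero
    simpa [laplace] using this
  refine MeasurableSpace.induction_on_inter (m := MeasurableSpace.generateFrom C)
    (C := fun E _ => ∫ ω in E, ψ ω ∂Pr = 0) rfl hpi (by simp) ?_ ?_ ?_ E (hle E hE)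
  · rintro _ ⟨l, hl, rfl⟩
    have := (hev l hl).2.2 _ isTest_zero
    rw [← integral_indicator (hev l hl).1]
    simpa [laplace] using this
  · intro A hA ih
    have := integral_add_compl (hCm A hA) hψ.1
    rw [ih, h0, zero_add] at this
    exact this
  · intro A hd hA ih
    rw [integral_iUnion (fun i => hCm _ (hA i)) hd hψ.1.integrableOn]
    simp [ih]

end Uniqueness

end Interlacement

/-! ### An abstract zero-one law for images of a Poisson process. -/

namespace Interlacement

open scoped NNReal

/-- The inverse of `oneSubExp`. -/
def negLogOneSub (t : ℝ≥0∞) : ℝ≥0 := Real.toNNReal (-Real.log (1 - t.toReal))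

theorem measurable_negLogOneSub : Measurable negLogOneSub :=
  ((Real.measurable_log.comp (ENNReal.measurable_toReal.const_sub 1)).neg).real_toNNReal

/-- The bound keeps `t` strictly below 1, where the logarithm is a true inverse, and gives the bound
on the result that test functions need. -/
theorem negLogOneSub_spec {t : ℝ≥0∞} {c : ℝ≥0} (h : t ≤ oneSubExp c) :
    oneSubExp (negLogOneSub t) = t ∧ negLogOneSub t ≤ c := by
  have htop : t ≠ ∞ := ne_top_of_le_ne_top ENNReal.one_ne_top (h.trans (oneSubExp_le_one c))
  have h1 : t.toReal ≤ 1 - Real.exp (-c) := by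
    rw [← toReal_oneSubExp]
    exact ENNReal.toReal_mono
      (ne_top_of_le_ne_top ENNReal.one_ne_top (oneSubExp_le_one c)) h
  have h2 : Real.exp (-c) ≤ 1 - t.toReal := by linarith
  have hpos : 0 < 1 - t.toReal := (Real.exp_pos _).trans_le h2
  have hlog : -(c : ℝ) ≤ Real.log (1 - t.toReal) := (Real.le_log_iff_exp_le hpos).2 h2
  have hlog0 : Real.log (1 - t.toReal) ≤ 0 :=
    Real.log_nonpos hpos.le (by linarith [ENNReal.toReal_nonneg (a := t)])
  have hcoe : ((negLogOneSub t : ℝ≥0) : ℝ) = -Real.log (1 - t.toReal) :=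
    Real.coe_toNNReal _ (by linarith)
  refine ⟨?_, ?_⟩
  · rw [oneSubExp, hcoe, neg_neg, Real.exp_log hpos, sub_sub_cancel, ENNReal.ofReal_toReal htop]
  · rw [← NNReal.coe_le_coe, hcoe]
    linarith

theorem measurable_oneSubExp_comp {X : Type*} [MeasurableSpace X] {g : X → ℝ≥0}
    (hg : Measurable g) : Measurable fun x => oneSubExp (g x) :=
  measurable_oneSubExp.comp hg

theorem exp_neg_add_oneSubExp (c : ℝ≥0) :
    ENNReal.ofReal (Real.exp (-c)) + oneSubExp c = 1 := by
  rw [oneSubExp, ← ENNReal.ofReal_add (Real.exp_pos _).le]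
  · simp
  · rw [sub_nonneg, Real.exp_le_one_iff]; simp

section

variable {X T Ω : Type*} [MeasurableSpace X] [MeasurableSpace T] [MeasurableSpace Ω]
  {ν : Measure X} {η : Ω → Measure X} {Pr : Measure Ω} {H : ℕ → Set X}

/-- If `q` is the conditional probability of `A` given `κ`, a function `u` bounded by `δ` on `A` and
vanishing off `A` has a conditional expectation given `κ` that is bounded by `δ q`. -/
theorem exists_map_withDensity_eq {κ : X → T} (hκ : Measurable κ) {A : Set X}
    (hA : MeasurableSet A) (hνA : ν A ≠ ∞) {q : T → ℝ≥0∞} (hq : Measurable q)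
    (hqA : (ν.restrict A).map κ = (ν.map κ).withDensity q) {u : X → ℝ≥0∞} {δ : ℝ≥0∞}
    (hδ : δ ≠ ∞) (hu : ∀ x, u x ≤ A.indicator (fun _ => δ) x) :
    ∃ φ : T → ℝ≥0∞, Measurable φ ∧ (∀ t, φ t ≤ δ * q t) ∧
      (ν.withDensity u).map κ = (ν.map κ).withDensity φ := by
  set ρ := (ν.withDensity u).map κ
  set θ := (ν.restrict A).map κ with hθ
  have : IsFiniteMeasure (ν.restrict A) := ⟨by simpa using hνA.lt_top⟩
  have : IsFiniteMeasure θ := by rw [hθ]; infer_instance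
  have hle : ∀ G, MeasurableSet G → ρ G ≤ δ * θ G := by
    intro G hG
    rw [Measure.map_apply hκ hG, Measure.map_apply hκ hG, withDensity_apply _ (hκ hG),
      Measure.restrict_apply (hκ hG)]
    calc ∫⁻ x in κ ⁻¹' G, u x ∂ν ≤ ∫⁻ x in κ ⁻¹' G, A.indicator (fun _ => δ) x ∂ν :=
          lintegral_mono hu
      _ = δ * ν (κ ⁻¹' G ∩ A) := by
          rw [lintegral_indicator_const hA, Measure.restrict_apply hA, Set.inter_comm]
  -- The Radon–Nikodym derivative is taken against the finite measure θ, as the full image of ν need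
  -- not be σ-finite; multiplying by `q` then returns to a density against the full image.
  have hac : ρ ≪ θ := by
    refine Measure.AbsolutelyContinuous.mk fun G hG h0 => ?_
    have := hle G hG
    rw [h0, mul_zero] at this
    exact le_antisymm this zero_le
  have hρ : IsFiniteMeasure ρ := by
    refine ⟨(hle _ MeasurableSet.univ).trans_lt ?_⟩
    exact ENNReal.mul_lt_top (lt_top_iff_ne_top.2 hδ) (measure_lt_top _ _)
  have hr : ρ.rnDeriv θ ≤ᵐ[θ] fun _ => δ := by
    refine ae_le_of_forall_setLIntegral_le_of_sigmaFinite (Measure.measurable_rnDeriv _ _) ?_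
    intro G hG _
    rw [lintegral_const, Measure.restrict_apply_univ]
    exact (Measure.setLIntegral_rnDeriv_le G).trans (hle G hG)
  -- Capping at δ changes nothing θ-almost everywhere and makes the bound hold at every point.
  refine ⟨fun t => q t * min (ρ.rnDeriv θ t) δ, hq.mul
    ((Measure.measurable_rnDeriv _ _).min measurable_const), fun t => ?_, ?_⟩
  · rw [mul_comm δ]
    exact mul_le_mul_right (min_le_right _ _) _
  · have h1 : (ν.map κ).withDensity (fun t => q t * min (ρ.rnDeriv θ t) δ)
        = ((ν.map κ).withDensity q).withDensity fun t => min (ρ.rnDeriv θ t) δ :=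
      withDensity_mul _ hq ((Measure.measurable_rnDeriv _ _).min measurable_const)
    rw [h1, ← hqA, ← Measure.withDensity_rnDeriv_eq ρ θ hac]
    refine withDensity_congr_ae ?_
    rw [Measure.withDensity_rnDeriv_eq ρ θ hac]
    filter_upwards [hr] with t ht
    exact (min_eq_left ht).symm

theorem laplace_map {κ : X → T} (hκ : Measurable κ) {g : T → ℝ≥0} (hg : Measurable g)
    (μ : Measure X) : laplace g (μ.map κ) = laplace (fun x => g (κ x)) μ := by
  rw [laplace, laplace, lintegral_map hg.coe_nnreal_ennreal hκ]

/-- Nonnegativity of the variance of 1_E Z, followed by 1_E Z² ≤ Z². -/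
theorem sq_setIntegral_le [IsProbabilityMeasure Pr] {Z : Ω → ℝ} (hZ : Measurable Z)
    (hZb : ∀ ω, |Z ω| ≤ 1) {E : Set Ω} (hE : MeasurableSet E) :
    (∫ ω in E, Z ω ∂Pr) ^ 2 ≤ ∫ ω, Z ω ^ 2 ∂Pr := by
  have hb : ∀ ω, ‖E.indicator Z ω‖ ≤ 1 := fun ω =>
    (norm_indicator_le_norm_self Z ω).trans (hZb ω)
  have hY : MemLp (E.indicator Z) 2 Pr :=
    MemLp.of_bound (hZ.indicator hE).aestronglyMeasurable 1 (ae_of_all _ hb)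
  have h1 := variance_eq_sub hY
  have h2 := variance_nonneg (E.indicator Z) Pr
  rw [integral_indicator hE] at h1
  have hint : Integrable (fun ω => Z ω ^ 2) Pr :=
    Integrable.of_bound (hZ.pow_const 2).aestronglyMeasurable 1 (ae_of_all _ fun ω => by
      rw [Real.norm_eq_abs, abs_pow]
      exact pow_le_one₀ (abs_nonneg _) (hZb ω))
  have h3 : ∫ ω, (E.indicator Z ^ 2) ω ∂Pr ≤ ∫ ω, Z ω ^ 2 ∂Pr := by
    refine integral_mono hY.integrable_sq hint fun ω => ?_
    by_cases hω : ω ∈ E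
    · simp [hω]
    · simp [hω, sq_nonneg]
  linarith

omit [MeasurableSpace Ω] in
theorem IsCounting.ne_top (hηH : IsCounting H η) (hHm : ∀ n, MeasurableSet (H n)) (ω : Ω)
    (n : ℕ) : η ω (H n) ≠ ∞ := by
  obtain ⟨k, hk⟩ := hηH ω n (H n) (hHm n) le_rfl
  rw [hk]
  exact ENNReal.natCast_ne_top k

theorem integrable_laplace [IsProbabilityMeasure Pr] (hη : Measurable η) {f : X → ℝ≥0}
    (hf : Measurable f) : Integrable (fun ω => laplace f (η ω)) Pr :=
  Integrable.of_bound ((measurable_laplace hf).comp hη).aestronglyMeasurable 1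
    (ae_of_all _ fun ω => by
      rw [Real.norm_eq_abs, abs_of_nonneg laplace_nonneg]
      exact laplace_le_one)

/-- The correlation of a Laplace functional of a Poisson process with an event that depends on the
process only through its image under `κ` is controlled by the second moment of the conditional
probability, given `κ`, of the set `A` on which the functional depends. -/
theorem PoissonCounts.sq_setIntegral_laplace_sub_le [IsProbabilityMeasure Pr]
    (hP : PoissonCounts ν η Pr) (hη : Measurable η) (hH : Monotone H)
    (hHm : ∀ n, MeasurableSet (H n)) (hηH : IsCounting H η) (hν : ∀ n, ν (H n) ≠ ∞)
    {κ : X → T} (hκ : Measurable κ) {S : ℕ → Set T} (hS : Monotone S)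
    (hSm : ∀ j, MeasurableSet (S j)) (hScover : ⋃ j, S j = Set.univ) {n : ℕ}
    (hSH : ∀ j, κ ⁻¹' (S j) = H (n + j)) {m : ℕ}
    {q : T → ℝ≥0∞} (hq : Measurable q) (hq1 : ∀ t, q t ≤ (S 0).indicator 1 t)
    (hqA : ∀ G, MeasurableSet G → ν (κ ⁻¹' G ∩ H m) = ∫⁻ t in G, q t ∂(ν.map κ))
    {f : X → ℝ≥0} (hf : Measurable f) {c : ℝ≥0} (hfc : ∀ x, f x ≤ (H m).indicator (fun _ => c) x)
    {E : Set Ω} (hE : MeasurableSet[MeasurableSpace.comap (fun ω => (η ω).map κ)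
      Measure.instMeasurableSpace] E) (hQ : ∫⁻ t, q t ^ 2 ∂(ν.map κ) ≠ ∞) :
    (∫ ω in E, laplace f (η ω) ∂Pr - (∫ ω, laplace f (η ω) ∂Pr) * Pr.real E) ^ 2
      ≤ Real.exp (∫⁻ t, q t ^ 2 ∂(ν.map κ)).toReal - 1 := by
  have hηfin := hηH.ne_top hHm
  have hηκ : Measurable fun ω => (η ω).map κ := (Measure.measurable_map κ hκ).comp hη
  have hftest : IsTest H f := ⟨hf, m, c, hfc⟩
  have hu : Measurable fun x => oneSubExp (f x) := measurable_oneSubExp_comp hf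
  obtain ⟨φ, hφ, hφq, hφρ⟩ := exists_map_withDensity_eq hκ (hHm m) (hν m) hq (δ := oneSubExp c)
    (u := fun x => oneSubExp (f x)) (by
      refine Measure.ext fun G hG => ?_
      rw [Measure.map_apply hκ hG, Measure.restrict_apply (hκ hG), withDensity_apply _ hG,
        hqA G hG])
      (ne_top_of_le_ne_top ENNReal.one_ne_top (oneSubExp_le_one c)) (by
      intro x
      have := monotone_oneSubExp (hfc x)
      by_cases hx : x ∈ H m
      · simpa [hx] using this
      · simpa [hx, oneSubExp_zero] using this)
  have hq1' : ∀ t, q t ≤ 1 := fun t => (hq1 t).trans (Set.indicator_le_self' (by simp) t)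
  have hφc : ∀ t, φ t ≤ oneSubExp c := fun t => (hφq t).trans (mul_le_of_le_one_right' (hq1' t))
  -- Chosen so that 1 - exp(-g) = φ, the conditional expectation of 1 - exp(-f). The Laplace
  -- functional of `g` at the image process is then the conditional expectation of that of `f`,
  -- which `hnull` expresses.
  set g : T → ℝ≥0 := fun t => negLogOneSub (φ t) with hgdef
  have hgφ : ∀ t, oneSubExp (g t) = φ t := fun t => (negLogOneSub_spec (hφc t)).1
  have hgm : Measurable g := measurable_negLogOneSub.comp hφ
  have hgtest : IsTest S g := by
    refine ⟨hgm, 0, c, fun t => ?_⟩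
    by_cases ht : t ∈ S 0
    · rw [Set.indicator_of_mem ht]
      exact (negLogOneSub_spec (hφc t)).2
    · rw [Set.indicator_of_notMem ht]
      have h0 : q t ≤ 0 := by simpa [ht] using hq1 t
      have h1 : φ t ≤ oneSubExp 0 := by
        rw [oneSubExp_zero]
        exact (hφq t).trans (by rw [le_antisymm h0 zero_le, mul_zero])
      exact (negLogOneSub_spec h1).2
  have hcomp : ∀ g' : T → ℝ≥0, IsTest S g' → IsTest H fun x => g' (κ x) := by
    intro g' hg'
    obtain ⟨j, d, hd⟩ := hg'.bound
    refine ⟨hg'.measurable.comp hκ, n + j, d, fun x => ?_⟩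
    rw [← hSH j]
    exact hd (κ x)
  have hgκ := hcomp g hgtest
  -- both densities have the same integrals against functions of `κ`
  have hdens : ∀ h : T → ℝ≥0∞, Measurable h →
      ∫⁻ x, h (κ x) * oneSubExp (f x) ∂ν = ∫⁻ x, h (κ x) * oneSubExp (g (κ x)) ∂ν := by
    intro h hh
    have h1 : ∫⁻ t, h t ∂((ν.withDensity fun x => oneSubExp (f x)).map κ)
        = ∫⁻ x, h (κ x) * oneSubExp (f x) ∂ν := by
      have hhκ : Measurable fun x => h (κ x) := hh.comp hκ
      rw [lintegral_map hh hκ, lintegral_withDensity_eq_lintegral_mul _ hu hhκ]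
      simp only [Pi.mul_apply, mul_comm]
    have h2 : ∫⁻ t, h t ∂((ν.map κ).withDensity φ) = ∫⁻ x, h (κ x) * oneSubExp (g (κ x)) ∂ν := by
      rw [lintegral_withDensity_eq_lintegral_mul _ hφ hh, lintegral_map (hφ.mul hh) hκ]
      simp only [Pi.mul_apply, mul_comm, hgφ]
    rw [← h1, ← h2, hφρ]
  have hL : ∀ g' : X → ℝ≥0, IsTest H g' → ∫ ω, laplace g' (η ω) ∂Pr
      = Real.exp (-(∫⁻ x, oneSubExp (g' x) ∂ν).toReal) := fun g' hg' =>
    hP.integral_laplace hη hν hηfin hg'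
  have hnull : LaplaceNull S (fun ω => (η ω).map κ) Pr
      fun ω => laplace f (η ω) - laplace (fun x => g (κ x)) (η ω) := by
    refine ⟨(integrable_laplace hη hf).sub (integrable_laplace hη hgκ.measurable), ?_⟩
    intro g' hg'
    have hg'κ := hcomp g' hg'
    have e : ∀ ω, (laplace f (η ω) - laplace (fun x => g (κ x)) (η ω)) * laplace g' ((η ω).map κ)
        = laplace (fun x => f x + g' (κ x)) (η ω)
          - laplace (fun x => g (κ x) + g' (κ x)) (η ω) := by
      intro ω
      rw [laplace_map hκ hg'.measurable, laplace_add hftest hg'κ (hηfin ω),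
        laplace_add hgκ hg'κ (hηfin ω), sub_mul]
    simp_rw [e]
    have t1 := hftest.add hg'κ hH
    have t2 := hgκ.add hg'κ hH
    rw [integral_sub (integrable_laplace hη t1.measurable) (integrable_laplace hη t2.measurable),
      hL _ t1, hL _ t2]
    have hme : Measurable fun t => ENNReal.ofReal (Real.exp (-(g' t : ℝ))) :=
      (Real.measurable_exp.comp hg'.measurable.coe_nnreal_real.neg).ennreal_ofReal
    have hd := hdens _ hme
    -- From 1 - exp(-(f + g')) = (1 - exp(-g')) + exp(-g')(1 - exp(-f)): only the last factor
    -- distinguishes f from g ∘ κ, and `hdens` equates the two integrals.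
    simp_rw [oneSubExp_add]
    rw [lintegral_add_left (measurable_oneSubExp_comp hg'κ.measurable),
      lintegral_add_left (measurable_oneSubExp_comp hg'κ.measurable), hd, sub_self]
  have hEm : MeasurableSet E := hηκ.comap_le E hE
  have hcountκ : IsCounting S fun ω => (η ω).map κ := by
    intro ω j D hD hDj
    rw [Measure.map_apply hκ hD]
    exact hηH ω (n + j) _ (hκ hD) (by rw [← hSH]; exact Set.preimage_mono hDj)
  have hEf := hnull.setIntegral_eq_zero hηκ hS hSm hScover hcountκ hE
  rw [integral_sub (integrable_laplace hη hf).integrableOn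
    (integrable_laplace hη hgκ.measurable).integrableOn, sub_eq_zero] at hEf
  set C := (∫⁻ x, oneSubExp (g (κ x)) ∂ν).toReal with hC
  have hCf : ∫ ω, laplace f (η ω) ∂Pr = Real.exp (-C) := by
    rw [hL f hftest, hC]
    have := hdens (fun _ => 1) measurable_const
    simp only [one_mul] at this
    rw [this]
  have hCg : ∫ ω, laplace (fun x => g (κ x)) (η ω) ∂Pr = Real.exp (-C) := hL _ hgκ
  rw [hCf, hEf]
  set Z : Ω → ℝ := fun ω => laplace (fun x => g (κ x)) (η ω) with hZ
  have hZm : Measurable Z := (measurable_laplace hgκ.measurable).comp hη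
  have hZi : Integrable Z Pr := integrable_laplace hη hgκ.measurable
  have hexp1 : Real.exp (-C) ≤ 1 := by
    rw [Real.exp_le_one_iff, neg_nonpos]
    exact ENNReal.toReal_nonneg
  have h1 := sq_setIntegral_le (Pr := Pr) (Z := fun ω => Z ω - Real.exp (-C))
    (hZm.sub_const _) (fun ω => by
      have h0 : 0 ≤ Z ω := laplace_nonneg
      have h1 : Z ω ≤ 1 := laplace_le_one
      rw [abs_le]
      constructor <;> linarith [Real.exp_pos (-C)]) hEm
  have h2 : ∫ ω in E, (Z ω - Real.exp (-C)) ∂Pr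
      = ∫ ω in E, Z ω ∂Pr - Real.exp (-C) * Pr.real E := by
    rw [integral_sub hZi.integrableOn (integrable_const _), setIntegral_const, smul_eq_mul,
      mul_comm]
  rw [h2] at h1
  refine h1.trans ?_
  have hZ2 : ∀ ω, Z ω ^ 2 = laplace (fun x => g (κ x) + g (κ x)) (η ω) := fun ω => by
    rw [sq, laplace_add hgκ hgκ (hηfin ω)]
  have t2 := hgκ.add hgκ hH
  have hZ2i : Integrable (fun ω => Z ω ^ 2) Pr := by
    simp_rw [hZ2]
    exact integrable_laplace hη t2.measurable
  have h3 : ∫ ω, (Z ω - Real.exp (-C)) ^ 2 ∂Pr = ∫ ω, Z ω ^ 2 ∂Pr - Real.exp (-C) ^ 2 := by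
    have e : ∀ ω, (Z ω - Real.exp (-C)) ^ 2
        = Z ω ^ 2 - (2 * Real.exp (-C) * Z ω - Real.exp (-C) ^ 2) := fun ω => by ring
    simp_rw [e]
    have hi : Integrable (fun ω => 2 * Real.exp (-C) * Z ω - Real.exp (-C) ^ 2) Pr :=
      (hZi.const_mul _).sub (integrable_const _)
    rw [integral_sub hZ2i hi,
      integral_sub (hZi.const_mul _) (integrable_const _), integral_const_mul, hCg]
    simp
    ring
  set I2 := ∫⁻ x, oneSubExp (g (κ x) + g (κ x)) ∂ν with hI2
  set Q := ∫⁻ x, φ (κ x) ^ 2 ∂ν with hQdef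
  -- This integrates 1 - exp(-2g) = 2φ - φ², with φ² moved to the left to avoid subtraction in
  -- `ℝ≥0∞`.
  have hadd : I2 + Q = 2 * ∫⁻ x, oneSubExp (g (κ x)) ∂ν := by
    rw [hI2, hQdef, ← lintegral_add_left (measurable_oneSubExp_comp t2.measurable),
      ← lintegral_const_mul _ (measurable_oneSubExp_comp hgκ.measurable)]
    refine lintegral_congr fun x => ?_
    rw [oneSubExp_add, ← hgφ, sq, add_assoc, ← add_mul, exp_neg_add_oneSubExp]
    ring
  have hQle : Q ≤ ∫⁻ t, q t ^ 2 ∂(ν.map κ) := by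
    rw [lintegral_map (hq.pow_const 2) hκ]
    refine lintegral_mono fun x => ?_
    have : φ (κ x) ≤ q (κ x) := (hφq _).trans (mul_le_of_le_one_left' (oneSubExp_le_one c))
    dsimp only
    gcongr
  have hI2r : I2.toReal = 2 * C - Q.toReal := by
    have := congrArg ENNReal.toReal hadd
    rw [ENNReal.toReal_add (t2.lintegral_oneSubExp_ne_top hν) (ne_top_of_le_ne_top hQ hQle),
      ENNReal.toReal_mul] at this
    simp only [ENNReal.toReal_ofNat] at this
    rw [← hC] at this
    linarith
  rw [h3]
  simp_rw [hZ2]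
  rw [hL _ t2, ← hI2, hI2r, ← Real.exp_nat_mul]
  -- This difference is the variance of `Z`.
  have hfac : Real.exp (-(2 * C - Q.toReal)) - Real.exp ((2 : ℕ) * -C)
      = Real.exp (-(2 * C)) * (Real.exp Q.toReal - 1) := by
    rw [mul_sub, ← Real.exp_add, mul_one]
    push_cast
    congr 2 <;> ring
  rw [hfac]
  have hQr : Real.exp Q.toReal ≤ Real.exp (∫⁻ t, q t ^ 2 ∂(ν.map κ)).toReal :=
    Real.exp_le_exp.2 (ENNReal.toReal_mono hQ hQle)
  have hQ1 : 1 ≤ Real.exp Q.toReal := Real.one_le_exp ENNReal.toReal_nonneg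
  have hC2 : Real.exp (-(2 * C)) ≤ 1 := by
    rw [Real.exp_le_one_iff, neg_nonpos]
    exact mul_nonneg zero_le_two ENNReal.toReal_nonneg
  calc Real.exp (-(2 * C)) * (Real.exp Q.toReal - 1) ≤ 1 * (Real.exp Q.toReal - 1) :=
        mul_le_mul_of_nonneg_right hC2 (by linarith)
    _ ≤ _ := by linarith

/-- A zero-one law for events that depend, for every `n`, only on the image of a Poisson process
under `κ n`, when the conditional probability, given `κ n`, of every set `H m` tends to `0` in
mean square. -/
theorem PoissonCounts.zero_one [IsProbabilityMeasure Pr]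
    (hP : PoissonCounts ν η Pr) (hη : Measurable η)
    (hΩ : (inferInstance : MeasurableSpace Ω)
      ≤ MeasurableSpace.comap η Measure.instMeasurableSpace) (hH : Monotone H)
    (hHm : ∀ n, MeasurableSet (H n)) (hcover : ⋃ n, H n = Set.univ) (hηH : IsCounting H η)
    (hν : ∀ n, ν (H n) ≠ ∞)
    {κ : ℕ → X → T} (hκ : ∀ n, Measurable (κ n)) {S : ℕ → ℕ → Set T} (hS : ∀ n, Monotone (S n))
    (hSm : ∀ n j, MeasurableSet (S n j)) (hScover : ∀ n, ⋃ j, S n j = Set.univ)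
    (hSH : ∀ n j, κ n ⁻¹' (S n j) = H (n + j))
    {q : ℕ → ℕ → T → ℝ≥0∞} (hq : ∀ m n, Measurable (q m n))
    (hq1 : ∀ m n t, q m n t ≤ (S n 0).indicator 1 t)
    (hqA : ∀ m n, m ≤ n → ∀ G, MeasurableSet G →
      ν (κ n ⁻¹' G ∩ H m) = ∫⁻ t in G, q m n t ∂(ν.map (κ n)))
    (hlim : ∀ m, Tendsto (fun n => ∫⁻ t, q m n t ^ 2 ∂(ν.map (κ n))) atTop (𝓝 0))
    {E : Set Ω} (hE : ∀ n, MeasurableSet[MeasurableSpace.comap (fun ω => (η ω).map (κ n))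
      Measure.instMeasurableSpace] E) : Pr E = 0 ∨ Pr E = 1 := by
  have hEm : MeasurableSet E :=
    ((Measure.measurable_map (κ 0) (hκ 0)).comp hη).comap_le E (hE 0)
  have hindep : ∀ f, IsTest H f → ∫ ω in E, laplace f (η ω) ∂Pr
      = (∫ ω, laplace f (η ω) ∂Pr) * Pr.real E := by
    intro f hf
    obtain ⟨m, c, hc⟩ := hf.bound
    set d := ∫ ω in E, laplace f (η ω) ∂Pr - (∫ ω, laplace f (η ω) ∂Pr) * Pr.real E with hd
    have h1 : Tendsto (fun n => Real.exp (∫⁻ t, q m n t ^ 2 ∂(ν.map (κ n))).toReal - 1) atTop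
        (𝓝 0) := by
      have h2 := (ENNReal.tendsto_toReal ENNReal.zero_ne_top).comp (hlim m)
      have h3 := ((Real.continuous_exp.tendsto _).comp h2).sub_const 1
      simpa using h3
    -- The covariance `d` does not involve `n`, while its bound tends to 0 with `n`.
    have hd2 : d ^ 2 ≤ 0 := by
      refine ge_of_tendsto h1 ?_
      have hev : ∀ᶠ n in atTop, ∫⁻ t, q m n t ^ 2 ∂(ν.map (κ n)) < ∞ :=
        (hlim m).eventually (gt_mem_nhds ENNReal.zero_lt_top)
      filter_upwards [hev, eventually_ge_atTop m] with n hn hmn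
      exact hP.sq_setIntegral_laplace_sub_le hη hH hHm hηH hν (hκ n) (hS n) (hSm n) (hScover n)
        (hSH n) (hq m n) (hq1 m n) (hqA m n hmn) hf.measurable hc (hE n) hn.ne
    have : d = 0 := pow_eq_zero_iff two_ne_zero |>.1 (le_antisymm hd2 (sq_nonneg d))
    linarith
  have hnull : LaplaceNull H η Pr fun ω => E.indicator 1 ω - Pr.real E := by
    refine ⟨((integrable_const (1 : ℝ)).indicator hEm).sub (integrable_const _), fun g hg => ?_⟩
    have e : ∀ ω, (E.indicator 1 ω - Pr.real E) * laplace g (η ω)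
        = E.indicator (fun ω => laplace g (η ω)) ω - Pr.real E * laplace g (η ω) := by
      intro ω
      by_cases hω : ω ∈ E <;> simp [hω, sub_mul]
    simp_rw [e]
    have hi := integrable_laplace (Pr := Pr) hη hg.measurable
    rw [integral_sub (hi.indicator hEm) (hi.const_mul _), integral_indicator hEm,
      integral_const_mul, hindep g hg]
    ring
  -- Integrating 1_E - P(E) over `E` itself yields P(E)(1 - P(E)) = 0.
  have h0 := hnull.setIntegral_eq_zero hη hH hHm hcover hηH (hΩ E hEm)
  have hi1 : Integrable (E.indicator (1 : Ω → ℝ)) Pr := (integrable_const (1 : ℝ)).indicator hEm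
  rw [integral_sub hi1.integrableOn (integrable_const _),
    setIntegral_const, setIntegral_indicator hEm, Set.inter_self] at h0
  simp only [Pi.one_apply, integral_const, smul_eq_mul, mul_one, measureReal_restrict_apply_univ]
    at h0
  have h1 : Pr.real E * (1 - Pr.real E) = 0 := by linarith
  rcases mul_eq_zero.1 h1 with h | h
  · left
    exact (measureReal_eq_zero_iff).1 h
  · right
    have : Pr.real E = 1 := by linarith
    rw [measureReal_def, ENNReal.toReal_eq_one_iff] at this
    exact this

end

end Interlacement

/-! ### Measurability of trajectories and of their pieces. -/

namespace Interlacement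

variable {V : Type*}

section Measurability

variable [MeasurableSpace V] [DiscreteMeasurableSpace V]

theorem measurableSet_adj [Countable V] {ι : Type*} (G : SimpleGraph V) (i j : ι) :
    MeasurableSet {w : ι → V | G.Adj (w i) (w j)} :=
  (MeasurableSet.of_discrete (s := {a : V × V | G.Adj a.1 a.2})).preimage
    (f := fun w : ι → V => (w i, w j)) ((measurable_pi_apply i).prodMk (measurable_pi_apply j))

variable [Countable V] (G : SimpleGraph V)

omit [Countable V] in
theorem measurableSet_finite_visits {ι : Type*} [Countable ι] (x : V) :
    MeasurableSet {w : ι → V | {n | w n = x}.Finite} := by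
  have : {w : ι → V | {n | w n = x}.Finite} = ⋃ s : Finset ι, ⋂ n, ⋂ (_ : n ∉ s), {w | w n ≠ x} := by
    ext w
    simp only [Set.mem_ofPred_eq, Set.mem_iUnion, Set.mem_iInter]
    constructor
    · intro h
      exact ⟨h.toFinset, fun n hn => by simpa using hn⟩
    · rintro ⟨s, hs⟩
      refine s.finite_toSet.subset fun n hn => ?_
      by_contra h
      exact hs n h hn
  rw [this]
  exact MeasurableSet.iUnion fun s => MeasurableSet.iInter fun n => MeasurableSet.iInter fun _ =>
    (measurableSet_eval_eq n x).compl

theorem measurableSet_halfTraj :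
    MeasurableSet {w : ℕ → V | (∀ n, G.Adj (w n) (w (n + 1))) ∧ ∀ x, {n | w n = x}.Finite} := by
  simp only [Set.ofPred_and, Set.ofPred_forall]
  exact (MeasurableSet.iInter fun n => measurableSet_adj G n (n + 1)).inter
    (MeasurableSet.iInter fun x => measurableSet_finite_visits x)

theorem measurableSet_traj :
    MeasurableSet {w : ℤ → V | (∀ n, G.Adj (w n) (w (n + 1))) ∧ ∀ x, {n | w n = x}.Finite} := by
  simp only [Set.ofPred_and, Set.ofPred_forall]
  exact (MeasurableSet.iInter fun n => measurableSet_adj G n (n + 1)).inter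
    (MeasurableSet.iInter fun x => measurableSet_finite_visits x)

theorem measurableEmbedding_traj_val :
    MeasurableEmbedding (Subtype.val : Traj G → ℤ → V) :=
  MeasurableEmbedding.subtype_coe (measurableSet_traj G)

theorem measurableEmbedding_halfTraj_val :
    MeasurableEmbedding (Subtype.val : HalfTraj G → ℕ → V) :=
  MeasurableEmbedding.subtype_coe (measurableSet_halfTraj G)

variable {G}

omit [Countable V] in
theorem measurableSet_visits {ι : Type*} [Countable ι] (K : Finset V) :
    MeasurableSet {w : ι → V | ∃ n, w n ∈ K} := by
  simp only [Set.ofPred_exists]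
  exact MeasurableSet.iUnion fun n => measurableSet_eval_mem n (K : Set V)

theorem measurableSet_hits (K : Finset V) : MeasurableSet {w : Traj G | w.Hits K} :=
  (measurableEmbedding_traj_val G).measurable (measurableSet_visits K)

omit [MeasurableSpace V] [DiscreteMeasurableSpace V] [Countable V] in
theorem mk_mem_hitSet {K : Finset V} {w : Traj G} :
    (⟦w⟧ : TrajMod G) ∈ hitSet G K ↔ w.Hits K := by
  constructor
  · rintro ⟨w', hw', h⟩
    exact (Traj.Hits.congr (Quotient.exact h)).1 hw'
  · intro h
    exact ⟨w, h, rfl⟩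

omit [DiscreteMeasurableSpace V] [Countable V] in
theorem measurable_mk : Measurable (Quotient.mk (shiftSetoid G)) := measurable_quotient_mk'

theorem measurableSet_hitSet (K : Finset V) : MeasurableSet (hitSet G K) := by
  rw [measurableSet_quotient]
  have : (Quotient.mk'' ⁻¹' hitSet G K : Set (Traj G)) = {w : Traj G | w.Hits K} := by
    ext w
    exact mk_mem_hitSet
  rw [this]
  exact measurableSet_hits K

omit [MeasurableSpace V] [DiscreteMeasurableSpace V] [Countable V] in
theorem hitSet_mono {K K' : Finset V} (h : K ⊆ K') : hitSet G K ⊆ hitSet G K' := by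
  rintro _ ⟨w, ⟨n, hn⟩, rfl⟩
  exact ⟨w, ⟨n, h hn⟩, rfl⟩

omit [MeasurableSpace V] [DiscreteMeasurableSpace V] [Countable V] in
theorem tau_eq_iff {K : Finset V} {w : Traj G} (h : w.Hits K) (k : ℤ) :
    w.tau K = k ↔ w.1 k ∈ K ∧ ∀ n < k, w.1 n ∉ K := by
  have hb : BddBelow {n | w.1 n ∈ K} := (visits_finite K w).bddBelow
  have hne : {n | w.1 n ∈ K}.Nonempty := h
  constructor
  · rintro rfl
    exact ⟨Int.csInf_mem hne hb, fun n hn hmem => absurd (csInf_le hb hmem) (not_le.2 hn)⟩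
  · rintro ⟨h1, h2⟩
    refine le_antisymm (csInf_le hb h1) (le_csInf hne fun n hn => ?_)
    by_contra hlt
    exact h2 n (not_le.1 hlt) hn

omit [MeasurableSpace V] [DiscreteMeasurableSpace V] [Countable V] in
theorem lam_eq_iff {K : Finset V} {w : Traj G} (h : w.Hits K) (k : ℤ) :
    w.lam K = k ↔ w.1 k ∈ K ∧ ∀ n > k, w.1 n ∉ K := by
  have hb : BddAbove {n | w.1 n ∈ K} := (visits_finite K w).bddAbove
  have hne : {n | w.1 n ∈ K}.Nonempty := h
  constructor
  · rintro rfl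
    exact ⟨Int.csSup_mem hne hb, fun n hn hmem => absurd (le_csSup hb hmem) (not_le.2 hn)⟩
  · rintro ⟨h1, h2⟩
    refine le_antisymm (csSup_le hne fun n hn => ?_) (le_csSup hb h1)
    by_contra hlt
    exact h2 n (not_le.1 hlt) hn

theorem measurableSet_traj_eval (n : ℤ) (A : Set V) : MeasurableSet {w : Traj G | w.1 n ∈ A} :=
  (measurableEmbedding_traj_val G).measurable (measurableSet_eval_mem n A)

/-- Both `tau` and `lam` take the default value 0 on trajectories missing `K`, so only level sets
among the visiting trajectories need work. -/
theorem measurable_of_hits {K : Finset V} {t : Traj G → ℤ}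
    (h0 : ∀ w, ¬ w.Hits K → t w = 0)
    (h : ∀ k, MeasurableSet {w : Traj G | w.Hits K ∧ t w = k}) : Measurable t := by
  refine measurable_to_countable' fun k => ?_
  have : t ⁻¹' {k} = {w | w.Hits K ∧ t w = k} ∪ ({w | w.Hits K}ᶜ ∩ {_w | k = 0}) := by
    ext w
    by_cases hw : w.Hits K
    · simp [hw]
    · simp [hw, h0 w hw, eq_comm]
  rw [this]
  exact (h k).union ((measurableSet_hits K).compl.inter (MeasurableSet.const _))

theorem measurable_tau (K : Finset V) : Measurable (Traj.tau (G := G) K) := by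
  refine measurable_of_hits (K := K) (fun w hw => ?_) fun k => ?_
  · have : {n | w.1 n ∈ K} = ∅ := by
      ext n
      simp only [Set.mem_ofPred_eq, Set.mem_empty_iff_false, iff_false]
      exact fun hn => hw ⟨n, hn⟩
    rw [Traj.tau, this, Int.csInf_empty]
  · have : {w : Traj G | w.Hits K ∧ w.tau K = k}
        = {w | w.1 k ∈ (K : Set V)} ∩ ⋂ n, ⋂ (_ : n < k), {w | w.1 n ∈ (K : Set V)}ᶜ := by
      ext w
      simp only [Set.mem_ofPred_eq, Set.mem_inter_iff, Set.mem_iInter, Set.mem_compl_iff,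
        SetLike.mem_coe]
      constructor
      · rintro ⟨h1, h2⟩
        exact (tau_eq_iff h1 k).1 h2
      · intro h
        exact ⟨⟨k, h.1⟩, (tau_eq_iff ⟨k, h.1⟩ k).2 h⟩
    rw [this]
    exact (measurableSet_traj_eval _ _).inter (MeasurableSet.iInter fun n =>
      MeasurableSet.iInter fun _ => (measurableSet_traj_eval _ _).compl)

theorem measurable_lam (K : Finset V) : Measurable (Traj.lam (G := G) K) := by
  refine measurable_of_hits (K := K) (fun w hw => ?_) fun k => ?_
  · have : {n | w.1 n ∈ K} = ∅ := by
      ext n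
      simp only [Set.mem_ofPred_eq, Set.mem_empty_iff_false, iff_false]
      exact fun hn => hw ⟨n, hn⟩
    rw [Traj.lam, this, Int.csSup_empty]
  · have : {w : Traj G | w.Hits K ∧ w.lam K = k}
        = {w | w.1 k ∈ (K : Set V)} ∩ ⋂ n, ⋂ (_ : n > k), {w | w.1 n ∈ (K : Set V)}ᶜ := by
      ext w
      simp only [Set.mem_ofPred_eq, Set.mem_inter_iff, Set.mem_iInter, Set.mem_compl_iff,
        SetLike.mem_coe]
      constructor
      · rintro ⟨h1, h2⟩
        exact (lam_eq_iff h1 k).1 h2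
      · intro h
        exact ⟨⟨k, h.1⟩, (lam_eq_iff ⟨k, h.1⟩ k).2 h⟩
    rw [this]
    exact (measurableSet_traj_eval _ _).inter (MeasurableSet.iInter fun n =>
      MeasurableSet.iInter fun _ => (measurableSet_traj_eval _ _).compl)

theorem measurable_eval_at {t : Traj G → ℤ} (ht : Measurable t) :
    Measurable fun w : Traj G => w.1 (t w) := by
  refine measurable_to_countable' fun x => ?_
  have : (fun w : Traj G => w.1 (t w)) ⁻¹' {x} = ⋃ k, (t ⁻¹' {k} ∩ {w | w.1 k ∈ ({x} : Set V)}) := by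
    ext w
    simp
  rw [this]
  exact MeasurableSet.iUnion fun k => (ht (measurableSet_singleton k)).inter
    (measurableSet_traj_eval _ _)

theorem measurable_future (K : Finset V) : Measurable (Traj.future (G := G) K) :=
  (measurableEmbedding_halfTraj_val G).measurable_comp_iff.1
    (measurable_pi_lambda _ fun n => measurable_eval_at ((measurable_lam K).add_const (n : ℤ)))

theorem measurable_past (K : Finset V) : Measurable (Traj.past (G := G) K) :=
  (measurableEmbedding_halfTraj_val G).measurable_comp_iff.1
    (measurable_pi_lambda _ fun n => measurable_eval_at ((measurable_tau K).sub_const (n : ℤ)))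

theorem measurable_keepFuture (K : Finset V) : Measurable (keepFuture (G := G) K) := by
  classical
  refine measurable_from_quotient.2 ?_
  exact Measurable.ite (measurableSet_hits K) (measurable_inl.comp (measurable_future K))
    (measurable_inr.comp measurable_mk)

theorem measurable_keepPast (K : Finset V) : Measurable (keepPast (G := G) K) := by
  classical
  refine measurable_from_quotient.2 ?_
  exact Measurable.ite (measurableSet_hits K) (measurable_inl.comp (measurable_past K))
    (measurable_inr.comp measurable_mk)

end Measurability

/-! ### Choices of the time origin and the intensity measure. -/

section Anchors

/-- Two-sided sequences that enter `K` at time `0`. -/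
def entersAtZero (K : Finset V) : Set (ℤ → V) := {w | w 0 ∈ K ∧ ∀ n < 0, w n ∉ K}

/-- Two-sided sequences that leave `K` at time `0`. -/
def leavesAtZero (K : Finset V) : Set (ℤ → V) := {w | w 0 ∈ K ∧ ∀ n > 0, w n ∉ K}

theorem measurableSet_entersAtZero [MeasurableSpace V] [DiscreteMeasurableSpace V] (K : Finset V) :
    MeasurableSet (entersAtZero K) := by
  simp only [entersAtZero, Set.ofPred_and, Set.ofPred_forall]
  exact (measurableSet_eval_mem 0 (K : Set V)).inter (MeasurableSet.iInter fun n =>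
    MeasurableSet.iInter fun _ => (measurableSet_eval_mem n (K : Set V)).compl)

theorem measurableSet_leavesAtZero [MeasurableSpace V] [DiscreteMeasurableSpace V] (K : Finset V) :
    MeasurableSet (leavesAtZero K) := by
  simp only [leavesAtZero, Set.ofPred_and, Set.ofPred_forall]
  exact (measurableSet_eval_mem 0 (K : Set V)).inter (MeasurableSet.iInter fun n =>
    MeasurableSet.iInter fun _ => (measurableSet_eval_mem n (K : Set V)).compl)

variable {G : SimpleGraph V}

theorem existsUnique_entersAtZero {K : Finset V} {w : Traj G} (h : w.Hits K) :
    ∃! k, shift k w.1 ∈ entersAtZero K := by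
  have key : ∀ k, shift k w.1 ∈ entersAtZero K ↔ w.tau K = k := by
    intro k
    rw [tau_eq_iff h]
    simp only [entersAtZero, shift, Set.mem_ofPred_eq, zero_add]
    refine and_congr_right fun _ => ⟨fun hn n hnk => ?_, fun hn n hn0 => hn _ (by omega)⟩
    simpa using hn (n - k) (by omega)
  exact ⟨w.tau K, (key _).2 rfl, fun k hk => ((key k).1 hk).symm⟩

theorem existsUnique_leavesAtZero {K : Finset V} {w : Traj G} (h : w.Hits K) :
    ∃! k, shift k w.1 ∈ leavesAtZero K := by
  have key : ∀ k, shift k w.1 ∈ leavesAtZero K ↔ w.lam K = k := by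
    intro k
    rw [lam_eq_iff h]
    simp only [leavesAtZero, shift, Set.mem_ofPred_eq, zero_add]
    refine and_congr_right fun _ => ⟨fun hn n hnk => ?_, fun hn n hn0 => hn _ (by omega)⟩
    simpa using hn (n - k) (by omega)
  exact ⟨w.lam K, (key _).2 rfl, fun k hk => ((key k).1 hk).symm⟩

/-- The two-sided sequences whose class modulo shift lies in `D`. -/
def unfold (D : Set (TrajMod G)) : Set (ℤ → V) :=
  (fun t : Traj G => t.1) '' (Quotient.mk (shiftSetoid G) ⁻¹' D)

theorem shift_mem_unfold {D : Set (TrajMod G)} {w : ℤ → V} (k : ℤ) (h : w ∈ unfold D) :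
    shift k w ∈ unfold D := by
  obtain ⟨t, ht, rfl⟩ := h
  have hfin : ∀ x, {n | shift k t.1 n = x}.Finite := by
    intro x
    refine Set.Finite.of_finite_image ((t.2.2 x).subset ?_) (f := fun n : ℤ => n + k) ?_
    · rintro _ ⟨n, hn, rfl⟩
      exact hn
    · intro m _ n _ hmn
      simpa using hmn
  have hadj : ∀ n, G.Adj (shift k t.1 n) (shift k t.1 (n + 1)) := by
    intro n
    have := t.2.1 (n + k)
    rwa [add_right_comm] at this
  refine ⟨⟨shift k t.1, hadj, hfin⟩, ?_, rfl⟩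
  have e : (⟦⟨shift k t.1, hadj, hfin⟩⟧ : TrajMod G) = ⟦t⟧ :=
    (Quotient.sound ⟨k, fun n => rfl⟩ : (⟦t⟧ : TrajMod G) = ⟦⟨shift k t.1, hadj, hfin⟩⟧).symm
  change (⟦⟨shift k t.1, hadj, hfin⟩⟧ : TrajMod G) ∈ D
  rw [e]
  exact ht

theorem preimage_shift_unfold (D : Set (TrajMod G)) (k : ℤ) : shift k ⁻¹' unfold D = unfold D := by
  ext w
  refine ⟨fun h => ?_, fun h => shift_mem_unfold k h⟩
  have := shift_mem_unfold (-k) h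
  rwa [shift_shift, neg_add_cancel, shift_zero] at this

theorem measurableSet_unfold [MeasurableSpace V] [DiscreteMeasurableSpace V] [Countable V]
    {D : Set (TrajMod G)} (hD : MeasurableSet D) : MeasurableSet (unfold D) :=
  (measurableEmbedding_traj_val G).measurableSet_image.2 (measurable_mk hD)

end Anchors

namespace Network

variable {N : Network V} [MeasurableSpace V] [DiscreteMeasurableSpace V] [Countable V]

/-- Mass transport: an invariant set has the same mass relative to any two equivariant choices of
the origin. -/
theorem IsTransient.twoSided_inter_eq (hN : N.IsTransient) {A F F' : Set (ℤ → V)}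
    (hA : MeasurableSet A) (hAinv : ∀ k, shift k ⁻¹' A = A) (hF : MeasurableSet F)
    (hF' : MeasurableSet F') (h : ∀ w ∈ A, ∃! k, shift k w ∈ F)
    (h' : ∀ w ∈ A, ∃! k, shift k w ∈ F') :
    N.twoSided (A ∩ F) = N.twoSided (A ∩ F') := by
  have key : ∀ {F F' : Set (ℤ → V)}, MeasurableSet F → MeasurableSet F' →
      (∀ w ∈ A, ∃! k, shift k w ∈ F') →
      N.twoSided (A ∩ F) = ∑' k, N.twoSided (A ∩ F ∩ shift k ⁻¹' F') := by
    intro F F' hF hF' h'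
    rw [← measure_iUnion]
    · congr 1
      ext w
      simp only [Set.mem_iUnion, Set.mem_inter_iff, Set.mem_preimage]
      constructor
      · rintro ⟨hwA, hwF⟩
        obtain ⟨k, hk, _⟩ := h' w hwA
        exact ⟨k, ⟨hwA, hwF⟩, hk⟩
      · rintro ⟨k, hw, _⟩
        exact hw
    · intro i j hij
      refine Set.disjoint_left.2 fun w hi hj => hij ?_
      exact (h' w hi.1.1).unique hi.2 hj.2
    · exact fun k => (hA.inter hF).inter (measurable_shift k hF')
  -- If the F'-origin lies k after the F-origin, then the F-origin lies -k after the F'-origin: the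
  -- two sums agree term by term after k ↦ -k and a shift.
  rw [key hF hF' h', key hF' hF h, ← (Equiv.neg ℤ).tsum_eq]
  refine tsum_congr fun k => ?_
  have hm : MeasurableSet (A ∩ F ∩ shift (-k) ⁻¹' F') :=
    (hA.inter hF).inter (measurable_shift _ hF')
  rw [Equiv.neg_apply, ← (hN.measurePreserving_shift k).measure_preimage hm.nullMeasurableSet]
  congr 1
  rw [Set.preimage_inter, Set.preimage_inter, hAinv, ← Set.preimage_comp]
  have : shift (V := V) (-k) ∘ shift k = id := by
    funext w
    rw [Function.comp_apply, shift_shift, neg_add_cancel, shift_zero, id]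
  rw [this, Set.preimage_id, Set.inter_right_comm]

/-- The conditioning and the equilibrium mass cancel: e_K(x) P_x[· | no return] is a_x P_x
restricted to no return, and a past that never returns to `K` means entering `K` at time 0. -/
theorem nuK_apply (K : Finset V) {S : Set (Traj N.graph)} (hS : MeasurableSet S) :
    N.nuK K S = N.twoSided ((fun t : Traj N.graph => t.1) '' S ∩ entersAtZero K) := by
  have hA : MeasurableSet ((fun t : Traj N.graph => t.1) '' S) :=
    (measurableEmbedding_traj_val N.graph).measurableSet_image.2 hS
  set A : Set (ℤ → V) := (fun t : Traj N.graph => t.1) '' S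
  set F := {w : ℕ → V | returnTime (K : Set V) w = ⊤} with hFdef
  have hF : MeasurableSet F := measurableSet_returnTime _
  refine ((measurableEmbedding_traj_val N.graph).comap_apply _ _).trans ?_
  change (∑ x ∈ K, N.eqMass K x • (((N.P x)[|F]).prod (N.P x)).map glue) A
    = N.twoSided (A ∩ entersAtZero K)
  rw [twoSided,
    Measure.sum_apply _ (hA.inter (measurableSet_entersAtZero K)), Measure.coe_finsetSum,
    Finset.sum_apply, tsum_eq_sum (s := K)]
  · refine Finset.sum_congr rfl fun x hx => ?_
    rw [Measure.smul_apply, Measure.smul_apply, Measure.map_apply measurable_glue hA,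
      Measure.map_apply measurable_glue (hA.inter (measurableSet_entersAtZero K)), smul_eq_mul,
      smul_eq_mul, eqMass, if_pos hx, ← mass, mul_assoc]
    congr 1
    have e1 : (N.P x)[|F] = (N.P x F)⁻¹ • (N.P x).restrict F := rfl
    have e2 : ((N.P x).restrict F).prod (N.P x)
        = ((N.P x).prod (N.P x)).restrict (F ×ˢ Set.univ) := by
      rw [← Measure.prod_restrict, Measure.restrict_univ]
    have e3 : ((N.P x).prod (N.P x)) (glue ⁻¹' (A ∩ entersAtZero K))
        = ((N.P x).restrict F).prod (N.P x) (glue ⁻¹' A) := by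
      rw [e2, Measure.restrict_apply (measurable_glue hA)]
      refine measure_congr ?_
      filter_upwards [Measure.quasiMeasurePreserving_fst.ae (N.P_zero_ae x),
        Measure.quasiMeasurePreserving_snd.ae (N.P_zero_ae x)] with q hq1 hq2
      refine propext ?_
      change glue q ∈ A ∧ (glue (q.1, q.2) 0 ∈ K ∧ ∀ n < 0, glue (q.1, q.2) n ∉ K)
        ↔ glue q ∈ A ∧ (q.1 ∈ F ∧ q.2 ∈ Set.univ)
      refine and_congr_right fun _ => ?_
      rw [glue_zero, hq2, hFdef, returnTime_event_eq]
      simp only [hx, true_and, Set.mem_univ, and_true, Set.mem_ofPred_eq, SetLike.mem_coe]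
      constructor
      · intro h n hn
        have := h (-(n : ℤ)) (by omega)
        rwa [glue_neg_natCast (hq1.trans hq2.symm)] at this
      · intro h n hn
        obtain ⟨k, rfl⟩ : ∃ k : ℕ, n = -(k : ℤ) := ⟨n.natAbs, by omega⟩
        rw [glue_neg_natCast (hq1.trans hq2.symm)]
        exact h k (by omega)
    rw [e3]
    -- Conditioning on a null event gives nothing to cancel, but then both sides vanish.
    by_cases h0 : N.P x F = 0
    · rw [h0, zero_mul, Measure.restrict_eq_zero.2 h0, Measure.zero_prod]
      simp
    · rw [e1, Measure.prod_smul_left, Measure.smul_apply, smul_eq_mul, ← mul_assoc,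
        ENNReal.mul_inv_cancel h0 (measure_ne_top _ _), one_mul]
  · intro x hx
    rw [Measure.smul_apply, Measure.map_apply measurable_glue
      (hA.inter (measurableSet_entersAtZero K)), smul_eq_mul]
    refine mul_eq_zero_of_right _ (measure_eq_zero_iff_ae_notMem.2 ?_)
    filter_upwards [Measure.quasiMeasurePreserving_snd.ae (N.P_zero_ae x)] with q hq hmem
    have h1 : glue (q.1, q.2) 0 ∈ K := hmem.2.1
    rw [glue_zero, hq] at h1
    exact hx h1

/-- Each layer of ν puts the origin at the entrance into its own set; by mass transport all layers
may use the entrance into the single set `K j`, and then they add up. -/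
theorem IsTransient.nu_apply_enters (hN : N.IsTransient) {K : ℕ → Finset V} (hK : IsExhaustion K)
    (hK0 : K 0 = ∅) (j : ℕ) {D : Set (TrajMod N.graph)} (hD : MeasurableSet D)
    (hDj : D ⊆ hitSet N.graph (K j)) :
    N.nu K D = N.twoSided (unfold D ∩ entersAtZero (K j)) := by
  classical
  let Dn : ℕ → Set (TrajMod N.graph) := fun n =>
    D ∩ (hitSet N.graph (K (n + 1)) \ hitSet N.graph (K n))
  have hDn : ∀ n, MeasurableSet (Dn n) := fun n =>
    hD.inter ((measurableSet_hitSet _).diff (measurableSet_hitSet _))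
  have h1 : N.nu K D = ∑' n, N.twoSided (unfold (Dn n) ∩ entersAtZero (K (n + 1))) := by
    rw [nu, Measure.map_apply measurable_mk hD, Measure.sum_apply _ (measurable_mk hD)]
    refine tsum_congr fun n => ?_
    rw [Measure.restrict_apply (measurable_mk hD)]
    have : Quotient.mk (shiftSetoid N.graph) ⁻¹' D
        ∩ {w | w.Hits (K (n + 1)) ∧ ¬ w.Hits (K n)}
        = Quotient.mk (shiftSetoid N.graph) ⁻¹' Dn n := by
      ext w
      simp only [Dn, Set.mem_inter_iff, Set.mem_preimage, Set.mem_ofPred_eq, Set.mem_sdiff]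
      rw [← mk_mem_hitSet, ← mk_mem_hitSet]
    rw [this, nuK_apply _ (measurable_mk (hDn n))]
    rfl
  have h2 : ∀ n, N.twoSided (unfold (Dn n) ∩ entersAtZero (K (n + 1)))
      = N.twoSided (unfold (Dn n) ∩ entersAtZero (K j)) := by
    intro n
    refine hN.twoSided_inter_eq (measurableSet_unfold (hDn n)) (preimage_shift_unfold _)
      (measurableSet_entersAtZero _) (measurableSet_entersAtZero _) ?_ ?_
    · rintro _ ⟨t, ht, rfl⟩
      exact existsUnique_entersAtZero (mk_mem_hitSet.1 ht.2.1)
    · rintro _ ⟨t, ht, rfl⟩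
      exact existsUnique_entersAtZero (mk_mem_hitSet.1 (hDj ht.1))
  rw [h1]
  simp_rw [h2]
  rw [← measure_iUnion]
  · congr 1
    rw [← Set.iUnion_inter]
    congr 1
    ext w
    simp only [Set.mem_iUnion]
    constructor
    · rintro ⟨n, t, ht, rfl⟩
      exact ⟨t, ht.1, rfl⟩
    · rintro ⟨t, ht, rfl⟩
      have hex : ∃ n, t.Hits (K n) := ⟨j, mk_mem_hitSet.1 (hDj ht)⟩
      have h0 : ¬ t.Hits (K 0) := by
        rw [hK0]
        rintro ⟨n, hn⟩
        simp at hn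
      -- The layer is found from the first set of the exhaustion that is visited; its index is
      -- positive because `K 0` is empty.
      obtain ⟨n, hn⟩ : ∃ n, Nat.find hex = n + 1 :=
        Nat.exists_eq_succ_of_ne_zero fun h => h0 (h ▸ Nat.find_spec hex)
      refine ⟨n, t, ⟨ht, mk_mem_hitSet.2 (hn ▸ Nat.find_spec hex), fun hmem => ?_⟩, rfl⟩
      exact Nat.find_min hex (by omega) (mk_mem_hitSet.1 hmem)
  · have key : ∀ m n, m < n → Disjoint (unfold (Dn m) ∩ entersAtZero (K j))
        (unfold (Dn n) ∩ entersAtZero (K j)) := by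
      intro m n hmn
      refine Set.disjoint_left.2 ?_
      rintro _ ⟨⟨t, ht, rfl⟩, _⟩ ⟨⟨t', ht', htt'⟩, _⟩
      obtain rfl : t' = t := Subtype.ext htt'
      exact ht'.2.2 (hitSet_mono (hK.mono hmn) ht.2.1)
    intro m n hmn
    rcases lt_or_gt_of_ne hmn with h | h
    · exact key m n h
    · exact (key n m h).symm
  · exact fun n => (measurableSet_unfold (hDn n)).inter (measurableSet_entersAtZero _)

/-- Moving the origin from the first entrance to the last exit is what puts the future version on
the same footing as the past version. -/
theorem IsTransient.nu_apply_leaves (hN : N.IsTransient) {K : ℕ → Finset V} (hK : IsExhaustion K)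
    (hK0 : K 0 = ∅) (j : ℕ) {D : Set (TrajMod N.graph)} (hD : MeasurableSet D)
    (hDj : D ⊆ hitSet N.graph (K j)) :
    N.nu K D = N.twoSided (unfold D ∩ leavesAtZero (K j)) := by
  rw [hN.nu_apply_enters hK hK0 j hD hDj]
  refine hN.twoSided_inter_eq (measurableSet_unfold hD) (preimage_shift_unfold _)
    (measurableSet_entersAtZero _) (measurableSet_leavesAtZero _) ?_ ?_
  · rintro _ ⟨t, ht, rfl⟩
    exact existsUnique_entersAtZero (mk_mem_hitSet.1 (hDj ht))
  · rintro _ ⟨t, ht, rfl⟩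
    exact existsUnique_leavesAtZero (mk_mem_hitSet.1 (hDj ht))

end Network

end Interlacement

/-! ### Cut trajectories and their zero-one law. -/

namespace Interlacement

variable {V : Type*}

section Config

variable {G : SimpleGraph V}

theorem keepFuture_of_hits {K : Finset V} {w : Traj G} (h : w.Hits K) :
    keepFuture K ⟦w⟧ = Sum.inl (w.future K) := if_pos h

theorem keepFuture_of_not_hits {K : Finset V} {w : Traj G} (h : ¬ w.Hits K) :
    keepFuture K ⟦w⟧ = Sum.inr ⟦w⟧ := if_neg h

theorem keepPast_of_hits {K : Finset V} {w : Traj G} (h : w.Hits K) :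
    keepPast K ⟦w⟧ = Sum.inl (w.past K) := if_pos h

theorem keepPast_of_not_hits {K : Finset V} {w : Traj G} (h : ¬ w.Hits K) :
    keepPast K ⟦w⟧ = Sum.inr ⟦w⟧ := if_neg h

variable [MeasurableSpace V]

theorem exists_nat_eq_of_tsum_ne_top {ι : Type*} {f : ι → ℝ≥0∞} (hf : ∀ i, f i = 0 ∨ f i = 1)
    (h : ∑' i, f i ≠ ∞) : ∃ k : ℕ, ∑' i, f i = k := by
  have hfin := ENNReal.finite_const_le_of_tsum_ne_top h one_ne_zero
  refine ⟨hfin.toFinset.card, ?_⟩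
  rw [tsum_eq_sum (s := hfin.toFinset), Finset.card_eq_sum_ones, Nat.cast_sum]
  · refine Finset.sum_congr rfl fun i hi => ?_
    have h1 : 1 ≤ f i := by simpa using hi
    rcases hf i with h | h
    · rw [h] at h1; simp at h1
    · simp [h]
  · intro i hi
    rcases hf i with h | h
    · exact h
    · exact absurd (by simpa using h.ge) hi

/-- A sum of Dirac masses evaluates to a sum of zeros and ones, here finite by local finiteness. -/
theorem isCounting_config (K : ℕ → Finset V) :
    IsCounting (fun n => hitSet G (K n)) (fun ω : Config G => ω.1) := by
  intro ω n D hD hDn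
  obtain ⟨⟨I, w, hω⟩, hfin⟩ := ω.2
  have hne : ω.1 D ≠ ∞ := ne_top_of_le_ne_top (hfin (K n)).ne (measure_mono hDn)
  have e : ω.1 D = ∑' i : I, Measure.dirac (w i) D := by rw [hω, Measure.sum_apply _ hD]
  obtain ⟨k, hk⟩ := exists_nat_eq_of_tsum_ne_top (f := fun i => Measure.dirac (w i) D)
    (fun i => by
      rw [Measure.dirac_apply' _ hD]
      by_cases h : w i ∈ D <;> simp [h]) (e ▸ hne)
  exact ⟨k, e.trans hk⟩

theorem config_measurableSpace_eq :
    (inferInstance : MeasurableSpace (Config G))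
      = MeasurableSpace.comap (fun ω : Config G => ω.1) Measure.instMeasurableSpace := by
  simp only [Measure.instMeasurableSpace, MeasurableSpace.comap_iSup, MeasurableSpace.comap_comp]
  rfl

theorem measurable_config_val : Measurable fun ω : Config G => ω.1 := by
  rw [measurable_iff_comap_le, ← config_measurableSpace_eq]

theorem IsPoissonProcess.poissonCounts {ν : Measure (TrajMod G)} {Pr : Measure (Config G)}
    (h : IsPoissonProcess ν Pr) : PoissonCounts ν (fun ω : Config G => ω.1) Pr :=
  ⟨h.poisson, h.indep⟩

end Config

namespace Network

variable {N : Network V}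

/-- The function of a marked trajectory that is `f` of the starting vertex if the trajectory was
cut at `K`, and `0` otherwise. -/
def startFun (N : Network V) (K : Finset V) (f : V → ℝ≥0∞) :
    HalfTraj N.graph ⊕ TrajMod N.graph → ℝ≥0∞ :=
  open Classical in
  Sum.elim (fun g => if g.1 0 ∈ K then f (g.1 0) else 0) (fun _ => 0)

theorem startFun_eq_sum (K : Finset V) (f : V → ℝ≥0∞) (t : HalfTraj N.graph ⊕ TrajMod N.graph) :
    N.startFun K f t
      = ∑ y ∈ K, f y * (Sum.inl '' {g : HalfTraj N.graph | g.1 0 = y}).indicator 1 t := by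
  classical
  rcases t with g | z
  · have e : ∀ y, (Sum.inl '' {g : HalfTraj N.graph | g.1 0 = y}).indicator
        (1 : HalfTraj N.graph ⊕ TrajMod N.graph → ℝ≥0∞) (Sum.inl g)
        = if g.1 0 = y then 1 else 0 := by
      intro y
      rw [Set.indicator_apply]
      simp [Sum.inl_injective.mem_set_image]
    simp only [e, mul_ite, mul_one, mul_zero, Finset.sum_ite_eq, startFun, Sum.elim_inl]
  · simp [startFun]

theorem startFun_sq (K : Finset V) (f : V → ℝ≥0∞) (t : HalfTraj N.graph ⊕ TrajMod N.graph) :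
    N.startFun K f t ^ 2 = N.startFun K (fun y => f y ^ 2) t := by
  rcases t with g | z
  · by_cases h : g.1 0 ∈ K <;> simp [startFun, h]
  · simp [startFun]

variable [MeasurableSpace V] [DiscreteMeasurableSpace V]

theorem measurableSet_start [Countable V] (y : V) :
    MeasurableSet {g : HalfTraj N.graph | g.1 0 = y} :=
  (measurableEmbedding_halfTraj_val N.graph).measurable (measurableSet_eval_eq 0 y)

theorem measurable_startFun [Countable V] (K : Finset V) (f : V → ℝ≥0∞) :
    Measurable (N.startFun K f) := by
  have : N.startFun K f = fun t =>
      ∑ y ∈ K, f y * (Sum.inl '' {g : HalfTraj N.graph | g.1 0 = y}).indicator 1 t := by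
    funext t
    exact startFun_eq_sum K f t
  rw [this]
  exact Finset.measurable_fun_sum _ fun y _ =>
    (measurable_one.indicator (measurableSet_start y).inl_image).const_mul _

/-- The paths in `S` that never return to `K`. -/
def escaping (K : Finset V) (S : Set (HalfTraj N.graph)) : Set (ℕ → V) :=
  (fun g : HalfTraj N.graph => g.1) '' S ∩ {w | returnTime (K : Set V) w = ⊤}

variable [Countable V]

/-- Almost every path of the chain lies in W⁺, so requiring the discarded piece to be a genuine
trajectory costs no probability. -/
theorem IsTransient.P_halfTraj_visits (hN : N.IsTransient) (B : Finset V) (y : V) :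
    N.P y ({w | (∀ n, N.graph.Adj (w n) (w (n + 1))) ∧ ∀ x, {n | w n = x}.Finite}
      ∩ {w | ∃ n, w n ∈ B}) = N.hitProb (B : Set V) y := by
  rw [hitProb]
  refine measure_congr ?_
  filter_upwards [hN.ae_adj y, hN.ae_finite_visits y] with w h1 h2
  refine propext ⟨fun h => h.2, fun h => ⟨⟨h1, h2⟩, h⟩⟩

omit [MeasurableSpace V] [DiscreteMeasurableSpace V] [Countable V] in
theorem glue_mem_traj {G : SimpleGraph V} {u v : ℕ → V} (huv : u 0 = v 0)
    (hu : (∀ n, G.Adj (u n) (u (n + 1))) ∧ ∀ x, {n | u n = x}.Finite)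
    (hv : (∀ n, G.Adj (v n) (v (n + 1))) ∧ ∀ x, {n | v n = x}.Finite) :
    (∀ n, G.Adj (glue (u, v) n) (glue (u, v) (n + 1))) ∧ ∀ x, {n | glue (u, v) n = x}.Finite := by
  refine ⟨fun n => ?_, fun x => ?_⟩
  · rcases le_or_gt 0 n with hn | hn
    · obtain ⟨k, rfl⟩ := Int.eq_ofNat_of_zero_le hn
      have := hv.1 k
      rw [← glue_natCast (u := u) (v := v) k, ← glue_natCast (u := u) (v := v) (k + 1)] at this
      exact_mod_cast this
    · obtain ⟨k, rfl⟩ : ∃ k : ℕ, n = -((k + 1 : ℕ) : ℤ) := ⟨n.natAbs - 1, by omega⟩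
      rw [glue_neg_natCast huv, show -((k + 1 : ℕ) : ℤ) + 1 = -(k : ℤ) by push_cast; ring,
        glue_neg_natCast huv]
      exact (hu.1 k).symm
  · refine (((hu.2 x).image fun n : ℕ => -(n : ℤ)).union
      ((hv.2 x).image fun n : ℕ => (n : ℤ))).subset fun n hn => ?_
    rcases le_or_gt 0 n with h0 | h0
    · obtain ⟨k, rfl⟩ := Int.eq_ofNat_of_zero_le h0
      exact Or.inr ⟨k, (glue_natCast (u := u) (v := v) k).symm.trans hn, rfl⟩
    · obtain ⟨k, rfl⟩ : ∃ k : ℕ, n = -(k : ℤ) := ⟨n.natAbs, by omega⟩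
      exact Or.inl ⟨k, (glue_neg_natCast huv k).symm.trans hn, rfl⟩

omit [MeasurableSpace V] [DiscreteMeasurableSpace V] [Countable V] in
theorem half_of_traj {G : SimpleGraph V} (t : Traj G) :
    ((∀ n : ℕ, G.Adj (t.1 n) (t.1 (n + 1 : ℕ))) ∧ ∀ x, {n : ℕ | t.1 n = x}.Finite) ∧
    ((∀ n : ℕ, G.Adj (t.1 (-n)) (t.1 (-(n + 1 : ℕ)))) ∧ ∀ x, {n : ℕ | t.1 (-n) = x}.Finite) := by
  refine ⟨⟨fun n => ?_, fun x => ?_⟩, fun n => ?_, fun x => ?_⟩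
  · have := t.2.1 n
    exact_mod_cast this
  · refine Set.Finite.of_finite_image ((t.2.2 x).subset ?_) (f := fun n : ℕ => (n : ℤ)) ?_
    · rintro _ ⟨n, hn, rfl⟩
      exact hn
    · intro m _ n _ h
      simpa using h
  · have := (t.2.1 (-(n + 1 : ℕ))).symm
    rwa [show -((n + 1 : ℕ) : ℤ) + 1 = -(n : ℤ) by push_cast; ring] at this
  · refine Set.Finite.of_finite_image ((t.2.2 x).subset ?_) (f := fun n : ℕ => -(n : ℤ)) ?_
    · rintro _ ⟨n, hn, rfl⟩
      exact hn
    · intro m _ n _ h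
      simpa using h

/-- A map that cuts trajectories at `K` and keeps a piece that starts in `K`, such that the rest of
the trajectory is, given the starting point of the piece, an independent copy of the chain. -/
structure IsCut (N : Network V) (ν : Measure (TrajMod N.graph)) (K : Finset V)
    (κ : TrajMod N.graph → HalfTraj N.graph ⊕ TrajMod N.graph) : Prop where
  measurable : Measurable κ
  of_hits : ∀ z ∈ hitSet N.graph K, ∃ g : HalfTraj N.graph, g.1 0 ∈ K ∧ κ z = Sum.inl g
  of_not_hits : ∀ z ∉ hitSet N.graph K, κ z = Sum.inr z
  measure_inter : ∀ B ⊆ K, ∀ y ∈ K, ∀ S : Set (HalfTraj N.graph), MeasurableSet S →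
    (∀ g ∈ S, g.1 0 = y) → ν (κ ⁻¹' (Sum.inl '' S) ∩ hitSet N.graph B)
      = N.mass y * (N.hitProb (B : Set V) y * N.P y (escaping K S))

/-- With the origin at the last exit from `K j`, the condition on the future is to lie in `S` and
avoid `K j` afterwards, and the past is an unconditioned chain. Visiting `B` is an event of the past
alone, because `B` lies inside `K j`. -/
theorem IsTransient.isCut_keepFuture (hN : N.IsTransient) {K : ℕ → Finset V} (hK : IsExhaustion K)
    (hK0 : K 0 = ∅) (j : ℕ) : IsCut N (N.nu K) (K j) (keepFuture (K j)) := by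
  refine ⟨measurable_keepFuture _, ?_, ?_, ?_⟩
  · rintro z ⟨w, hw, rfl⟩
    refine ⟨w.future (K j), ?_, keepFuture_of_hits hw⟩
    change w.1 (w.lam (K j) + (0 : ℕ)) ∈ K j
    rw [Nat.cast_zero, add_zero]
    exact ((lam_eq_iff hw _).1 rfl).1
  · intro z hz
    induction z using Quotient.inductionOn with
    | h w => exact keepFuture_of_not_hits fun h => hz (mk_mem_hitSet.2 h)
  · intro B hB y hy S hS hSy
    have hD : MeasurableSet (keepFuture (K j) ⁻¹' (Sum.inl '' S) ∩ hitSet N.graph B) :=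
      (measurable_keepFuture _ hS.inl_image).inter (measurableSet_hitSet B)
    rw [hN.nu_apply_leaves hK hK0 j hD (Set.inter_subset_right.trans (hitSet_mono hB)),
      ← hN.P_halfTraj_visits]
    refine twoSided_apply_of_prod ((measurableSet_unfold hD).inter
      (measurableSet_leavesAtZero _)) y fun u v huv => ?_
    rw [escaping, returnTime_event_eq]
    constructor
    · rintro ⟨⟨t, ⟨⟨g, hgS, hg⟩, htB⟩, ht⟩, hl⟩
      have ht' : t.1 = glue (u, v) := ht
      rw [← ht'] at hl
      have hits : t.Hits (K j) := ⟨0, hl.1⟩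
      have hg' : keepFuture (K j) ⟦t⟧ = Sum.inl g := hg.symm
      rw [keepFuture_of_hits hits, Sum.inl.injEq] at hg'
      have hlam : t.lam (K j) = 0 := (lam_eq_iff hits 0).2 hl
      have hgv : g.1 = v := by
        funext n
        rw [← hg']
        change t.1 (t.lam (K j) + n) = v n
        rw [hlam, zero_add, ht', glue_natCast]
      have hu : (fun n : ℕ => t.1 (-n)) = u := by
        funext n
        rw [ht', glue_neg_natCast huv]
      refine ⟨?_, ⟨?_, ?_⟩, ⟨g, hgS, hgv⟩, ?_⟩
      · rw [← hgv]
        exact hSy g hgS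
      · have := (half_of_traj t).2
        rw [← hu]
        exact this
      · obtain ⟨k, hk⟩ := mk_mem_hitSet.1 htB
        have hk0 : k ≤ 0 := by
          by_contra h
          exact hl.2 k (by omega) (hB hk)
        refine ⟨k.natAbs, ?_⟩
        rw [← hu]
        dsimp only
        rwa [show -(k.natAbs : ℤ) = k by omega]
      · intro n hn hmem
        refine hl.2 n (by omega) ?_
        rw [ht', glue_natCast]
        exact hmem
    · rintro ⟨hvy, ⟨hu, n, hn⟩, ⟨g, hgS, hgv⟩, hesc⟩
      have hgv' : g.1 = v := hgv
      let t : Traj N.graph := ⟨glue (u, v), glue_mem_traj huv hu (hgv' ▸ g.2)⟩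
      have hl : glue (u, v) ∈ leavesAtZero (K j) := by
        refine ⟨by rw [glue_zero, hvy]; exact hy, fun n hn => ?_⟩
        obtain ⟨k, rfl⟩ := Int.eq_ofNat_of_zero_le hn.le
        rw [glue_natCast]
        exact hesc k (by omega)
      have hits : t.Hits (K j) := ⟨0, hl.1⟩
      have hlam : t.lam (K j) = 0 := (lam_eq_iff hits 0).2 hl
      refine ⟨⟨t, ⟨⟨g, hgS, ?_⟩, mk_mem_hitSet.2 ⟨-n, ?_⟩⟩, rfl⟩, hl⟩
      · refine Eq.trans ?_ (keepFuture_of_hits hits).symm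
        congr 1
        apply Subtype.ext
        funext n
        change g.1 n = glue (u, v) (t.lam (K j) + n)
        rw [hlam, zero_add, glue_natCast, hgv']
      · change glue (u, v) (-n) ∈ B
        rw [glue_neg_natCast huv]
        exact hn

/-- The same with the origin at the first entrance: the past carries the escape condition and the
future is the free chain that may visit `B`. -/
theorem IsTransient.isCut_keepPast (hN : N.IsTransient) {K : ℕ → Finset V} (hK : IsExhaustion K)
    (hK0 : K 0 = ∅) (j : ℕ) : IsCut N (N.nu K) (K j) (keepPast (K j)) := by
  refine ⟨measurable_keepPast _, ?_, ?_, ?_⟩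
  · rintro z ⟨w, hw, rfl⟩
    refine ⟨w.past (K j), ?_, keepPast_of_hits hw⟩
    change w.1 (w.tau (K j) - (0 : ℕ)) ∈ K j
    rw [Nat.cast_zero, sub_zero]
    exact ((tau_eq_iff hw _).1 rfl).1
  · intro z hz
    induction z using Quotient.inductionOn with
    | h w => exact keepPast_of_not_hits fun h => hz (mk_mem_hitSet.2 h)
  · intro B hB y hy S hS hSy
    have hD : MeasurableSet (keepPast (K j) ⁻¹' (Sum.inl '' S) ∩ hitSet N.graph B) :=
      (measurable_keepPast _ hS.inl_image).inter (measurableSet_hitSet B)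
    rw [hN.nu_apply_enters hK hK0 j hD (Set.inter_subset_right.trans (hitSet_mono hB)),
      ← hN.P_halfTraj_visits, mul_comm (N.P y _)]
    refine twoSided_apply_of_prod ((measurableSet_unfold hD).inter
      (measurableSet_entersAtZero _)) y fun u v huv => ?_
    rw [escaping, returnTime_event_eq]
    constructor
    · rintro ⟨⟨t, ⟨⟨g, hgS, hg⟩, htB⟩, ht⟩, hl⟩
      have ht' : t.1 = glue (u, v) := ht
      rw [← ht'] at hl
      have hits : t.Hits (K j) := ⟨0, hl.1⟩
      have hg' : keepPast (K j) ⟦t⟧ = Sum.inl g := hg.symm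
      rw [keepPast_of_hits hits, Sum.inl.injEq] at hg'
      have htau : t.tau (K j) = 0 := (tau_eq_iff hits 0).2 hl
      have hgu : g.1 = u := by
        funext n
        rw [← hg']
        change t.1 (t.tau (K j) - n) = u n
        rw [htau, zero_sub, ht', glue_neg_natCast huv]
      have hv : (fun n : ℕ => t.1 n) = v := by
        funext n
        rw [ht', glue_natCast]
      refine ⟨?_, ⟨⟨g, hgS, hgu⟩, ?_⟩, ?_, ?_⟩
      · rw [← huv, ← hgu]
        exact hSy g hgS
      · intro n hn hmem
        refine hl.2 (-n) (by omega) ?_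
        rw [ht', glue_neg_natCast huv]
        exact hmem
      · have := (half_of_traj t).1
        rw [← hv]
        exact this
      · obtain ⟨k, hk⟩ := mk_mem_hitSet.1 htB
        have hk0 : 0 ≤ k := by
          by_contra h
          exact hl.2 k (by omega) (hB hk)
        refine ⟨k.natAbs, ?_⟩
        rw [← hv]
        dsimp only
        rwa [show (k.natAbs : ℤ) = k by omega]
    · rintro ⟨hvy, ⟨⟨g, hgS, hgu⟩, hesc⟩, hv, n, hn⟩
      have hgu' : g.1 = u := hgu
      let t : Traj N.graph := ⟨glue (u, v), glue_mem_traj huv (hgu' ▸ g.2) hv⟩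
      have hl : glue (u, v) ∈ entersAtZero (K j) := by
        refine ⟨by rw [glue_zero, hvy]; exact hy, fun n hn => ?_⟩
        obtain ⟨k, rfl⟩ : ∃ k : ℕ, n = -(k : ℤ) := ⟨n.natAbs, by omega⟩
        rw [glue_neg_natCast huv]
        exact hesc k (by omega)
      have hits : t.Hits (K j) := ⟨0, hl.1⟩
      have htau : t.tau (K j) = 0 := (tau_eq_iff hits 0).2 hl
      refine ⟨⟨t, ⟨⟨g, hgS, ?_⟩, mk_mem_hitSet.2 ⟨n, ?_⟩⟩, rfl⟩, hl⟩
      · refine Eq.trans ?_ (keepPast_of_hits hits).symm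
        congr 1
        apply Subtype.ext
        funext n
        change g.1 n = glue (u, v) (t.tau (K j) - n)
        rw [htau, zero_sub, glue_neg_natCast huv, hgu']
      · change glue (u, v) n ∈ B
        rw [glue_natCast]
        exact hn

section IsCut

variable {ν : Measure (TrajMod N.graph)} {K : Finset V}
  {κ : TrajMod N.graph → HalfTraj N.graph ⊕ TrajMod N.graph}

omit [Countable V] in
theorem IsCut.preimage_inl_subset (h : IsCut N ν K κ) (S : Set (HalfTraj N.graph)) :
    κ ⁻¹' (Sum.inl '' S) ⊆ hitSet N.graph K := by
  rintro z ⟨g, _, hg⟩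
  by_contra hz
  rw [h.of_not_hits z hz] at hg
  exact Sum.inl_ne_inr hg

theorem hitProb_eq_one {y : V} (hy : y ∈ K) : N.hitProb (K : Set V) y = 1 := by
  rw [hitProb, ← (measure_univ : N.P y Set.univ = 1)]
  refine measure_congr ?_
  filter_upwards [N.P_zero_ae y] with w hw
  exact propext ⟨fun _ => trivial, fun _ => ⟨0, by rw [hw]; exact hy⟩⟩

theorem IsCut.measure_inl (h : IsCut N ν K κ) {y : V} (hy : y ∈ K) {S : Set (HalfTraj N.graph)}
    (hS : MeasurableSet S) (hSy : ∀ g ∈ S, g.1 0 = y) :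
    ν (κ ⁻¹' (Sum.inl '' S)) = N.mass y * N.P y (escaping K S) := by
  have := h.measure_inter K subset_rfl y hy S hS hSy
  rwa [Set.inter_eq_left.2 (h.preimage_inl_subset S), hitProb_eq_one hy, one_mul] at this

theorem IsCut.measure_inl_start_le (h : IsCut N ν K κ) {y : V} (hy : y ∈ K) :
    ν (κ ⁻¹' (Sum.inl '' {g | g.1 0 = y})) ≤ N.eqMass K y := by
  rw [h.measure_inl hy (measurableSet_start y) fun g hg => hg, eqMass, if_pos hy, ← mass]
  gcongr
  exact Set.inter_subset_right

omit [Countable V] in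
theorem IsCut.hitSet_subset (h : IsCut N ν K κ) :
    hitSet N.graph K ⊆ ⋃ y ∈ K, κ ⁻¹' (Sum.inl '' {g | g.1 0 = y}) := by
  intro z hz
  obtain ⟨g, hg, hκ⟩ := h.of_hits z hz
  simp only [Set.mem_iUnion]
  exact ⟨g.1 0, hg, g, rfl, hκ.symm⟩

theorem IsCut.measure_hitSet_ne_top (h : IsCut N ν K κ) : ν (hitSet N.graph K) ≠ ∞ := by
  refine ne_top_of_le_ne_top ?_ ((measure_mono h.hitSet_subset).trans
    ((measure_biUnion_finset_le K _).trans (Finset.sum_le_sum fun y hy =>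
      h.measure_inl_start_le hy)))
  refine ENNReal.sum_ne_top.2 fun y hy => ?_
  rw [eqMass, if_pos hy]
  exact ENNReal.mul_ne_top ENNReal.ofReal_ne_top (measure_ne_top _ _)

theorem IsCut.lintegral_startFun (h : IsCut N ν K κ) (f : V → ℝ≥0∞)
    {S : Set (HalfTraj N.graph ⊕ TrajMod N.graph)} (hS : MeasurableSet S) :
    ∫⁻ t in S, N.startFun K f t ∂(ν.map κ)
      = ∑ y ∈ K, f y * ν (κ ⁻¹' (Sum.inl '' {g | g.1 0 = y} ∩ S)) := by
  simp_rw [startFun_eq_sum]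
  have hm : ∀ y, MeasurableSet (Sum.inl '' {g : HalfTraj N.graph | g.1 0 = y} :
      Set (HalfTraj N.graph ⊕ TrajMod N.graph)) := fun y => (measurableSet_start y).inl_image
  rw [lintegral_finsetSum _ fun y _ => (measurable_one.indicator (hm y)).const_mul _]
  refine Finset.sum_congr rfl fun y _ => ?_
  rw [lintegral_const_mul _ (measurable_one.indicator (hm y)), lintegral_indicator_one (hm y),
    Measure.restrict_apply (hm y), Measure.map_apply h.measurable ((hm y).inter hS)]

/-- Given the kept piece, the conditional probability of visiting `B` is the probability that the
chain started at the beginning of the piece visits `B`. -/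
theorem IsCut.measure_preimage_inter (h : IsCut N ν K κ) {B : Finset V} (hB : B ⊆ K)
    {S : Set (HalfTraj N.graph ⊕ TrajMod N.graph)} (hS : MeasurableSet S) :
    ν (κ ⁻¹' S ∩ hitSet N.graph B)
      = ∫⁻ t in S, N.startFun K (N.hitProb (B : Set V)) t ∂(ν.map κ) := by
  rw [h.lintegral_startFun _ hS]
  let Sy : V → Set (HalfTraj N.graph) := fun y => {g | g.1 0 = y} ∩ Sum.inl ⁻¹' S
  have hSy : ∀ y, MeasurableSet (Sy y) := fun y =>
    (measurableSet_start y).inter (measurable_inl hS)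
  have e1 : ∀ y, (Sum.inl '' {g : HalfTraj N.graph | g.1 0 = y} ∩ S) = Sum.inl '' Sy y := fun y =>
    (Set.image_inter_preimage _ _ _).symm
  have e2 : κ ⁻¹' S ∩ hitSet N.graph B
      = ⋃ y ∈ K, (κ ⁻¹' (Sum.inl '' Sy y) ∩ hitSet N.graph B) := by
    ext z
    simp only [Set.mem_iUnion, Set.mem_inter_iff, exists_prop]
    constructor
    · rintro ⟨hzS, hzB⟩
      obtain ⟨g, hg, hκ⟩ := h.of_hits z (hitSet_mono hB hzB)
      refine ⟨g.1 0, hg, ⟨g, ⟨rfl, ?_⟩, hκ.symm⟩, hzB⟩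
      change Sum.inl g ∈ S
      rw [← hκ]
      exact hzS
    · rintro ⟨y, _, ⟨g, hg, hκ⟩, hzB⟩
      refine ⟨?_, hzB⟩
      change κ z ∈ S
      rw [← hκ]
      exact hg.2
  rw [e2, measure_biUnion_finset]
  · refine Finset.sum_congr rfl fun y hy => ?_
    rw [e1, h.measure_inter B hB y hy _ (hSy y) fun g hg => hg.1,
      h.measure_inl hy (hSy y) fun g hg => hg.1, mul_left_comm]
  · intro y _ y' _ hyy'
    refine Set.disjoint_left.2 ?_
    rintro z ⟨⟨g, hg, hκ⟩, _⟩ ⟨⟨g', hg', hκ'⟩, _⟩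
    have : g = g' := Sum.inl_injective (hκ.trans hκ'.symm)
    subst this
    exact hyy' ((hg.1 : g.1 0 = y).symm.trans hg'.1)
  · exact fun y _ => (h.measurable (hSy y).inl_image).inter (measurableSet_hitSet B)

/-- Links the second moment in the abstract zero-one law to the equilibrium sum that tends to 0. -/
theorem IsCut.lintegral_startFun_sq_le (h : IsCut N ν K κ) (f : V → ℝ≥0∞) :
    ∫⁻ t, N.startFun K f t ^ 2 ∂(ν.map κ) ≤ ∑ y ∈ K, N.eqMass K y * f y ^ 2 := by
  simp_rw [startFun_sq]
  rw [← setLIntegral_univ, h.lintegral_startFun _ MeasurableSet.univ]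
  refine Finset.sum_le_sum fun y hy => ?_
  rw [Set.inter_univ, mul_comm]
  gcongr
  exact h.measure_inl_start_le hy

end IsCut

/-- The zero-one law for the tail of the process of cut trajectories. -/
theorem IsTransient.zero_one_of_isCut (hN : N.IsTransient) {K : ℕ → Finset V}
    (hK : IsExhaustion K) {ν : Measure (TrajMod N.graph)} {Pr : Measure (Config N.graph)}
    (hPr : IsPoissonProcess ν Pr)
    {κ : Finset V → TrajMod N.graph → HalfTraj N.graph ⊕ TrajMod N.graph}
    (hκ : ∀ n, IsCut N ν (K n) (κ (K n))) {E : Set (Config N.graph)}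
    (hE : MeasurableSet[⨅ L : Finset V, MeasurableSpace.comap
      (fun ω : Config N.graph => ω.1.map (κ L)) Measure.instMeasurableSpace] E) :
    Pr E = 0 ∨ Pr E = 1 := by
  have := hPr.isProbabilityMeasure
  have hmono : Monotone fun n => hitSet N.graph (K n) := fun i j hij => hitSet_mono (hK.mono hij)
  have hcover : ⋃ n, hitSet N.graph (K n) = Set.univ := by
    refine Set.eq_univ_of_forall fun z => ?_
    induction z using Quotient.inductionOn with
    | h w =>
      obtain ⟨n, hn⟩ := hK.cover (w.1 0)
      exact Set.mem_iUnion.2 ⟨n, mk_mem_hitSet.2 ⟨0, hn⟩⟩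
  refine hPr.poissonCounts.zero_one measurable_config_val config_measurableSpace_eq.le hmono
    (fun n => measurableSet_hitSet _) hcover (isCounting_config K)
    (fun n => (hκ n).measure_hitSet_ne_top) (κ := fun n => κ (K n)) (fun n => (hκ n).measurable)
    -- All kept pieces, together with the uncut trajectories visiting `K (n + j)`: its preimage is
    -- exactly the set of trajectories visiting `K (n + j)`, and for `j = 0` it contains the support
    -- of the conditional probability.
    (S := fun n j => Set.range Sum.inl ∪ Sum.inr '' hitSet N.graph (K (n + j)))
    ?_ ?_ ?_ ?_ (q := fun m n => N.startFun (K n) (N.hitProb (K m : Set V)))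
    (fun m n => measurable_startFun _ _) ?_ ?_ ?_ ?_
  · intro n i j hij
    exact Set.union_subset_union_right _ (Set.image_mono (hmono (Nat.add_le_add_left hij n)))
  · exact fun n j => measurableSet_range_inl.union (measurableSet_hitSet _).inr_image
  · intro n
    refine Set.eq_univ_of_forall fun t => ?_
    rcases t with g | z
    · exact Set.mem_iUnion.2 ⟨0, Or.inl ⟨g, rfl⟩⟩
    · have hz : z ∈ ⋃ n, hitSet N.graph (K n) := hcover ▸ Set.mem_univ z
      obtain ⟨j, hj⟩ := Set.mem_iUnion.1 hz
      exact Set.mem_iUnion.2 ⟨j, Or.inr ⟨z, hmono (Nat.le_add_left j n) hj, rfl⟩⟩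
  · intro n j
    ext z
    by_cases hz : z ∈ hitSet N.graph (K n)
    · obtain ⟨g, _, hg⟩ := (hκ n).of_hits z hz
      have h1 : z ∈ hitSet N.graph (K (n + j)) := hmono (Nat.le_add_right n j) hz
      simp [hg, h1]
    · have hg := (hκ n).of_not_hits z hz
      simp [hg]
  · intro m n t
    rcases t with g | z
    · have hmem : (Sum.inl g : HalfTraj N.graph ⊕ TrajMod N.graph) ∈
          Set.range Sum.inl ∪ Sum.inr '' hitSet N.graph (K (n + 0)) := Or.inl ⟨g, rfl⟩
      rw [Set.indicator_of_mem hmem]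
      by_cases hg : g.1 0 ∈ K n
      · simpa [startFun, hg] using N.hitProb_le_one _ _
      · simp [startFun, hg]
    · simp [startFun]
  · intro m n hmn S hS
    exact (hκ n).measure_preimage_inter (hK.mono hmn) hS
  · intro m
    exact tendsto_of_tendsto_of_tendsto_of_le_of_le tendsto_const_nhds
      (hN.tendsto_sum_eqMass_mul_sq (K m) hK) (fun _ => zero_le)
      fun n => (hκ n).lintegral_startFun_sq_le _
  · intro n
    exact iInf_le (fun L : Finset V => MeasurableSpace.comap
      (fun ω : Config N.graph => ω.1.map (κ L)) Measure.instMeasurableSpace) (K n) E hE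

end Network

end Interlacement

end

theorem mainTheorem2 {V : Type*} [Countable V] [MeasurableSpace V] [DiscreteMeasurableSpace V]
    (N : Interlacement.Network V) (hN : N.IsTransient)
    (K : ℕ → Finset V) (hK : Interlacement.IsExhaustion K) (hK0 : K 0 = ∅)
    (Pr : Measure (Interlacement.Config N.graph))
    (hPr : Interlacement.IsPoissonProcess (N.nu K) Pr) :
    (∀ E : Set (Interlacement.Config N.graph),
      MeasurableSet[Interlacement.futureTail N.graph] E → Pr E = 0 ∨ Pr E = 1) ∧
    (∀ E : Set (Interlacement.Config N.graph),
      MeasurableSet[Interlacement.pastTail N.graph] E → Pr E = 0 ∨ Pr E = 1) ∧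
    (∀ (x : V) (ε : ℝ), 0 < ε → ∀ L : ℕ → Finset V, Interlacement.IsExhaustion L →
      Tendsto (fun n => N.eqMeasure (L n)
          {x' | ENNReal.ofReal ε < N.P x' {w | Interlacement.hitTime {x} w < ⊤}})
        atTop (𝓝 0)) := by
  refine ⟨fun E hE => ?_, fun E hE => ?_, fun x ε hε L hL => ?_⟩
  · exact hN.zero_one_of_isCut hK hPr (fun n => hN.isCut_keepFuture hK hK0 n) hE
  · exact hN.zero_one_of_isCut hK hPr (fun n => hN.isCut_keepPast hK hK0 n) hE
  · have h := hN.tendsto_eqMeasure x (ENNReal.ofReal_pos.2 hε).ne' hL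
    have e : {w : ℕ → V | Interlacement.hitTime {x} w < ⊤} = {w | ∃ n, w n ∈ ({x} : Set V)} := by
      ext w
      simp only [Set.mem_ofPred_eq]
      rw [lt_top_iff_ne_top, Ne, Interlacement.hitTime_eq_top_iff]
      push Not
      rfl
    rw [e]
    exact h
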